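/- **Conventions.** Let $\mathfrak A$ be a countably infinite alphabet containing distinct letters $x,y,z,p,x_0,x_1,x_2,\dots,t_1,t_2,t_3,a_1,a_2,\dots$. For a set of words $W\subseteq\mathfrak A^*$ let $S(W)$ be the Rees quotient of $\mathfrak A^*$ over the ideal of all words that are not (contiguous) subwords of words in $W$. Unless stated otherwise, identities are monoid identities: a set $\Delta$ of identities of a monoid $M$ is a *basis* of $M$ if every identity of $M$ can be deduced from $\Delta$, where possibly empty words may be substituted for variables. In semigroup deduction only nonempty words may be substituted. A semigroup is *finitely based* if some finite set of its semigroup identities is a basis for semigroup deduction. For a set $\mathfrak X$ of variables, $D_{\mathfrak X}(\mathbf u)$ is the word obtained from $\mathbf u$ by deleting all occurrences of all variables in $\mathfrak X$; an identity $\mathbf u\approx\mathbf v$ *deletes to* each identity $D_{\mathfrak X}(\mathbf u)\approx D_{\mathfrak X}(\mathbf v)$, and $\Delta^\delta$ is the set of all identities to which members of $\Delta$ delete. Put $$\mathcal A_3=\{t_1xt_2xt_3x\approx x^3t_1t_2t_3,\ x^3\approx x^4\},$$ $$\mathbf w_n=x_0(zxyp)\,x_1x_0\,x_2x_1\cdots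 x_nx_{n-1}\,(zxyp)\,x_n,\qquad \mathbf w_n'=x_0(zyxp)\,x_1x_0\,x_2x_1\cdots x_nx_{n-1}\,(zyxp)\,x_n,$$ $$\Sigma=\{\mathbf w_n\approx\mathbf w_n'\mid n\ge 2\}^\delta .$$ For $k\ge 1$ let $\Sigma_k$ be the set of those identities in $\Sigma$, obtained by deleting variables from some $\mathbf w_n\approx\mathbf w_n'$ with $n\ge2$, which do not delete to $xy\,b_1^2\cdots b_k^2\,xy\approx yx\,b_1^2\cdots b_k^2\,yx$ for any $b_1,\dots,b_k\in\{x_1,\dots,x_{n-1}\}$. **Theorem.** There is a finite set of words $\mathsf V$ such that $\Sigma\cup\mathcal A_3$ is a basis of identities of $S(\mathsf V)$. Moreover, for every such finite set $\mathsf V$ and every $k\ge 1$, putting $S_k=S(\mathsf V\cup\{xy\,a_1^2\cdots a_k^2\,xy\})$: 1. $\Sigma_k\cup\mathcal A_3$ is a basis of identities of the monoid $S_k$; equally, the identities in $\Sigma_k\cup\mathcal A_3^\delta$ with both sides nonempty form a basis of the identities of $S_k$ as a semigroup; 2. every nontrivial identity in $\Sigma_k$ has at most $2k+4$ variables; 3.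 up to renaming of variables, $\Sigma_k$ contains only finitely many nontrivial identities: there is a finite $F\subseteq\Sigma_k$ such that every nontrivial identity in $\Sigma_k$ arises from a member of $F$ by a permutation of $\mathfrak A$, and $F\cup\mathcal A_3$ is a finite basis of identities of the monoid $S_k$; 4. the semigroup $S_k$ is finitely based. -/

import Mathlib

/-- A countably infinite alphabet.  The names are those of the variables occurring in the
identities and words below: `x, y, z, p`, the variables `x₀, x₁, …` (`xs i`), the variables
`t₁, t₂, …` (`t i`) and the letters `a₁, a₂, …` (`a i`). -/
inductive Letter : Type
  | x : Letter
  | y : Letter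
  | z : Letter
  | p : Letter
  | xs : ℕ → Letter
  | t : ℕ → Letter
  | a : ℕ → Letter

/-- Words (including the empty word `1`) over the alphabet. -/
abbrev Word : Type := FreeMonoid Letter

/-- The one-letter word. -/
abbrev letter (c : Letter) : Word := FreeMonoid.of c

/-- `u` is a (contiguous) subword of `w`. -/
def IsSubword (u w : Word) : Prop := ∃ l r : Word, w = l * u * r

/-- The set of all subwords of words in `W`. -/
def subwordClosure (W : Set Word) : Set Word := {u | ∃ w ∈ W, IsSubword u w}

theorem mem_subwordClosure_of_mul_left {W : Set Word} {u v : Word}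
    (h : u * v ∈ subwordClosure W) : u ∈ subwordClosure W := by
  obtain ⟨w, hw, l, r, e⟩ := h
  exact ⟨w, hw, l, v * r, by rw [e]; simp only [mul_assoc]⟩

theorem mem_subwordClosure_of_mul_right {W : Set Word} {u v : Word}
    (h : u * v ∈ subwordClosure W) : v ∈ subwordClosure W := by
  obtain ⟨w, hw, l, r, e⟩ := h
  exact ⟨w, hw, l * u, r, by rw [e]; simp only [mul_assoc]⟩

/-- The Rees congruence of the ideal of all words that are not subwords of words in `W`. -/
def reesCon (W : Set Word) : Con Word where
  r u v := u = v ∨ (u ∉ subwordClosure W ∧ v ∉ subwordClosure W)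
  iseqv :=
    { refl := fun _ => Or.inl rfl
      symm := by
        rintro u v (h | ⟨h, h'⟩)
        · exact Or.inl h.symm
        · exact Or.inr ⟨h', h⟩
      trans := by
        rintro u v w (rfl | ⟨h, h'⟩) (rfl | ⟨k, k'⟩)
        · exact Or.inl rfl
        · exact Or.inr ⟨k, k'⟩
        · exact Or.inr ⟨h, h'⟩
        · exact Or.inr ⟨h, k'⟩ }
  mul' := by
    rintro a b c d (rfl | ⟨h, h'⟩) (rfl | ⟨k, k'⟩)
    · exact Or.inl rfl
    · exact Or.inr ⟨fun m => k (mem_subwordClosure_of_mul_right m),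
        fun m => k' (mem_subwordClosure_of_mul_right m)⟩
    · exact Or.inr ⟨fun m => h (mem_subwordClosure_of_mul_left m),
        fun m => h' (mem_subwordClosure_of_mul_left m)⟩
    · exact Or.inr ⟨fun m => h (mem_subwordClosure_of_mul_left m),
        fun m => h' (mem_subwordClosure_of_mul_left m)⟩

/-- The monoid `S(W)`: the Rees quotient of the free monoid over the ideal of all words that
are not subwords of words in `W`. -/
abbrev ReesMonoid (W : Set Word) : Type := (reesCon W).Quotient

/-- An identity `u ≈ v` is a pair of words. -/
abbrev Identity : Type := Word × Word

/-- The monoid `M` satisfies the identity `e`. -/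
def Satisfies (M : Type*) [Monoid M] (e : Identity) : Prop :=
  ∀ f : Word →* M, f e.1 = f e.2

/-- `e` can be deduced from `Δ` by the rules for monoid identities: its two sides are related by
the least congruence on the free monoid containing all `Θ(u) ≈ Θ(v)`, for `u ≈ v` in `Δ` and
`Θ` a substitution of (possibly empty) words for letters. -/
def Deducible (Δ : Set Identity) (e : Identity) : Prop :=
  conGen (fun b c : Word => ∃ d ∈ Δ, ∃ Θ : Word →* Word, b = Θ d.1 ∧ c = Θ d.2) e.1 e.2

/-- `Δ` is a basis of identities of the monoid `M`: all identities in `Δ` hold in `M`, and every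
identity of `M` can be deduced from `Δ`. -/
def IsBasis (M : Type*) [Monoid M] (Δ : Set Identity) : Prop :=
  (∀ e ∈ Δ, Satisfies M e) ∧ ∀ e : Identity, Satisfies M e → Deducible Δ e

/-- A semigroup identity: a pair of nonempty words. -/
abbrev SemigroupIdentity : Type := FreeSemigroup Letter × FreeSemigroup Letter

/-- The semigroup `T` satisfies the semigroup identity `e`. -/
def SemigroupSatisfies (T : Type*) [Semigroup T] (e : SemigroupIdentity) : Prop :=
  ∀ f : FreeSemigroup Letter →ₙ* T, f e.1 = f e.2

/-- Deduction of semigroup identities: only nonempty words may be substituted for letters. -/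
def SemigroupDeducible (Δ : Set SemigroupIdentity) (e : SemigroupIdentity) : Prop :=
  conGen (fun b c : FreeSemigroup Letter =>
    ∃ d ∈ Δ, ∃ Θ : FreeSemigroup Letter →ₙ* FreeSemigroup Letter, b = Θ d.1 ∧ c = Θ d.2) e.1 e.2

/-- `Δ` is a basis of identities of the semigroup `T`. -/
def IsSemigroupBasis (T : Type*) [Semigroup T] (Δ : Set SemigroupIdentity) : Prop :=
  (∀ e ∈ Δ, SemigroupSatisfies T e) ∧
    ∀ e : SemigroupIdentity, SemigroupSatisfies T e → SemigroupDeducible Δ e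

/-- A semigroup is finitely based if some finite set of its identities is a basis. -/
def IsFinitelyBased (T : Type*) [Semigroup T] : Prop :=
  ∃ Δ : Set SemigroupIdentity, Δ.Finite ∧ IsSemigroupBasis T Δ

/-- A nonempty word, regarded as an element of the free monoid. -/
def toWord : FreeSemigroup Letter →ₙ* Word := FreeSemigroup.lift letter

/-- The identities in `Δ` both of whose sides are nonempty, as semigroup identities. -/
def semigroupPart (Δ : Set Identity) : Set SemigroupIdentity :=
  {e | (toWord e.1, toWord e.2) ∈ Δ}

open scoped Classical in
/-- `deleteVars X u` is `D_X(u)`: all occurrences of all variables in `X` are deleted. -/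
noncomputable def deleteVars (X : Set Letter) : Word →* Word :=
  FreeMonoid.lift fun c => if c ∈ X then 1 else letter c

/-- `D_X(u) ≈ D_X(v)`. -/
noncomputable def deleteIdentity (X : Set Letter) (e : Identity) : Identity :=
  (deleteVars X e.1, deleteVars X e.2)

/-- `Δ^δ`, the closure of `Δ` under deleting variables. -/
def deletionClosure (Δ : Set Identity) : Set Identity :=
  {e | ∃ d ∈ Δ, ∃ X : Set Letter, e = deleteIdentity X d}

/-- The set `A₃ = {t₁xt₂xt₃x ≈ x³t₁t₂t₃, x³ ≈ x⁴}`. -/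
def A3 : Set Identity :=
  {(letter (.t 1) * letter .x * letter (.t 2) * letter .x * letter (.t 3) * letter .x,
      letter .x ^ 3 * letter (.t 1) * letter (.t 2) * letter (.t 3)),
    (letter .x ^ 3, letter .x ^ 4)}

/-- `chainWord c d n = x₀ (z c d p) x₁x₀ x₂x₁ x₃x₂ ⋯ xₙxₙ₋₁ (z c d p) xₙ`. -/
def chainWord (c d : Letter) (n : ℕ) : Word :=
  letter (.xs 0) * (letter .z * letter c * letter d * letter .p) *
    ((List.range n).map fun i => letter (.xs (i + 1)) * letter (.xs i)).prod *
    (letter .z * letter c * letter d * letter .p) * letter (.xs n)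

/-- The identity `wₙ ≈ w'ₙ`. -/
def wIdentity (n : ℕ) : Identity := (chainWord .x .y n, chainWord .y .x n)

/-- `Σ = {wₙ ≈ w'ₙ | n ≥ 2}^δ`. -/
def SigmaAll : Set Identity := deletionClosure {e | ∃ n : ℕ, 2 ≤ n ∧ e = wIdentity n}

/-- `squareWord c d [b₁, …, b_k] = c d b₁² ⋯ b_k² c d`. -/
def squareWord (c d : Letter) (l : List Letter) : Word :=
  letter c * letter d * (l.map fun b => letter b ^ 2).prod * letter c * letter d

/-- The word `xy a₁² ⋯ a_k² xy`. -/
def uWord (k : ℕ) : Word := squareWord .x .y ((List.range k).map fun i => Letter.a (i + 1))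

/-- `Σ_k`: the identities in `Σ` (obtained by deleting variables from some `wₙ ≈ w'ₙ`) which do
not delete to `xy b₁² ⋯ b_k² xy ≈ yx b₁² ⋯ b_k² yx` with `{b₁, …, b_k} ⊆ {x₁, …, xₙ₋₁}`. -/
def SigmaK (k : ℕ) : Set Identity :=
  {e | ∃ n : ℕ, 2 ≤ n ∧ (∃ X : Set Letter, e = deleteIdentity X (wIdentity n)) ∧
    ¬ ∃ l : List ℕ, l.length = k ∧ (∀ j ∈ l, 1 ≤ j ∧ j < n) ∧
      ∃ Y : Set Letter, deleteIdentity Y e =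
        (squareWord .x .y (l.map Letter.xs), squareWord .y .x (l.map Letter.xs))}

/-- The set of variables of an identity. -/
def identityVars (e : Identity) : Set Letter :=
  {c | c ∈ FreeMonoid.toList e.1 ∨ c ∈ FreeMonoid.toList e.2}

/-- The identity `e` with its variables renamed by the permutation `π` of the alphabet. -/
def renameIdentity (π : Equiv.Perm Letter) (e : Identity) : Identity :=
  (FreeMonoid.map π e.1, FreeMonoid.map π e.2)

/-! Call a word two-limited if no letter occurs in it more than twice, and say that it has a chain
at cd if it equals l X₀(Z cd P)X₁X₀X₂X₁⋯XₙXₙ₋₁(Z cd P)Xₙ r with n ≥ 2. If a member of Σ applies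
nontrivially to a factor of a word w, then w has a chain: what stands in θ(x) before its last letter
is absorbed by Z, what stands in θ(y) after its first letter by P. Hence S(w) satisfies Σ ∪ A₃
whenever w is two-limited and has no chain (`satisfies_singleton`). The finite set `isoWords` of
such words over ten letters serves as V.

For completeness let S(V) satisfy u ≈ v. By A₃ the letters occurring three times or more move to the
front as cubes, so u and v may be taken two-limited with equal occurrence numbers. If u ≠ v, the
first mismatch yields letters c, d with adjacent first occurrences in u, whose order is cdcd in u
and dcdc in v (`exists_adjacent_pair`). Up to renaming, chain-free two-limited words in at most ten
letters are isoterms, so every restriction of u to at most ten letters including c, d has a chain,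
and by induction on the number of letters even one at cd (`chainAt_filter_of_satisfies`). A
Helly-type theorem (`hasChain_of_filter`: eight letters besides c, d suffice) gives a chain of u
itself. Exchanging c and d in it brings u closer to v, as the number of pairs of letters on which
they differ drops (`deducible_of_satisfies`).

The Helly-type theorem rests on `exists_isBlockIndex`. In a chain each letter has a block index j,
and the order of the occurrences amounts to inequalities between indices. Summing the least steps
that these inequalities force between neighbouring letters gives a global index; it can violate an
inequality only if some six letters do.

A nontrivial application of wₙ ≈ wₙ′ to a factor of xy a₁²⋯a_k² xy can only come from an identity
that deletes to xy b₁²⋯b_k² xy ≈ yx b₁²⋯b_k² yx, so S_k satisfies Σ_k (`satisfies_uWord`).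
Conversely, if an identity outside Σ_k were called for in the deduction, the restriction of u to
suitable letters would be a renamed xy a₁²⋯a_k² xy, an isoterm for S_k, and v could not order c and
d differently (`deleteIdentity_mem_sigmaK`). An arbitrary V with basis Σ ∪ A₃ reduces to `isoWords`,
since identities of S(V) are then deducible from Σ ∪ A₃.

If 2k + 1 of the variables xᵢ survive in a nontrivial identity, every second one gives k squares, so
members of Σ_k retain at most 2k of them besides x, y, z, p. Finally, a monoid basis closed under
deletion of variables is a semigroup basis, because a substitution of possibly empty words is a
deletion followed by a substitution of nonempty ones. -/

set_option linter.unusedSectionVars false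

/-! ### A Helly-type theorem for block indices. -/

/-- `i` assigns to the letters of `S` indices of blocks: `f g` and `s g` are the positions of the
first and the second occurrence of `g`, and `a < b` are the positions of two markers. -/
structure IsBlockIndex {α : Type*} (f s : α → ℤ) (a b : ℤ) (S : Finset α) (i : α → ℤ) (n : ℤ) :
    Prop where
  two_le : 2 ≤ n
  eq_zero : ∀ g ∈ S, f g < a → i g = 0
  one_le : ∀ g ∈ S, a < f g → 1 ≤ i g
  eq_last : ∀ g ∈ S, b < s g → i g = n
  lt_last : ∀ g ∈ S, s g < b → i g + 1 ≤ n
  mono_first : ∀ g ∈ S, ∀ h ∈ S, f g ≤ f h → i g ≤ i h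
  mono_second : ∀ g ∈ S, ∀ h ∈ S, s g ≤ s h → i g ≤ i h
  -- In X₁X₀X₂X₁⋯ the second copy of Xⱼ stands right after the first copy of Xⱼ₊₁ and right before
  -- the first copy of Xⱼ₊₂. Hence a first occurrence after it has index at least j + 2, and one
  -- before it has index at most j + 1.
  far : ∀ g ∈ S, ∀ h ∈ S, s g < f h → i g + 2 ≤ i h
  near : ∀ g ∈ S, ∀ h ∈ S, f h < s g → i h ≤ i g + 1

theorem Finset.sum_le_one_of_forall_eq {α : Type*} (F : Finset α) (w : α → ℤ)
    (h1 : ∀ h ∈ F, w h ≤ 1) (h2 : ∀ h ∈ F, ∀ k ∈ F, 1 ≤ w h → 1 ≤ w k → h = k) :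
    ∑ h ∈ F, w h ≤ 1 := by
  classical
  by_cases hx : ∃ h ∈ F, 1 ≤ w h
  · obtain ⟨h, hF, hh⟩ := hx
    rw [← Finset.add_sum_erase F w hF]
    have : ∑ k ∈ F.erase h, w k ≤ 0 := by
      apply Finset.sum_nonpos
      intro k hk
      by_contra hc
      exact (Finset.mem_erase.1 hk).1 (h2 k (Finset.mem_erase.1 hk).2 h hF (by omega) hh)
    have := h1 h hF
    omega
  · push Not at hx
    have : ∑ k ∈ F, w k ≤ 0 := Finset.sum_nonpos fun k hk => by have := hx k hk; omega
    omega

section Helly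

variable {α : Type*} (f s : α → ℤ) (a b : ℤ) (D : Finset α)

/-- `k` is the letter of `D` whose first occurrence is the last one before that of `h`. -/
def IsPredLetter (k h : α) : Prop := k ∈ D ∧ f k < f h ∧ ∀ g ∈ D, f g < f h → f g ≤ f k

/-- The first or the second occurrences of `k` and `h` are separated. -/
def IsCut (k h : α) : Prop :=
  (f k < a ∧ a < f h) ∨ (s k < b ∧ b < s h) ∨ ∃ w ∈ D, (f k < s w ∧ s w < f h) ∨
    (s k < f w ∧ f w < s h)

open scoped Classical in
/-- The difference of the block indices of `h` and of the letter before it. -/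
noncomputable def blockStep (h : α) : ℤ :=
  -- The least step that every block index must make here: 2 by `far`, 1 by a cut.
  if ∃ k, IsPredLetter f D k h ∧ s k < f h then 2
  else if ∃ k, IsPredLetter f D k h ∧ IsCut f s a b D k h then 1 else 0

variable {f s a b D}

theorem blockStep_nonneg (h : α) : 0 ≤ blockStep f s a b D h := by
  unfold blockStep; split_ifs <;> norm_num

/-- A separation by a marker forces a jump by itself; a separation by an occurrence of w forces it
through `near` and `far` applied to w. One letter besides k and h thus certifies the jump, which
keeps the local test small. -/
theorem IsCut.exists_witness {k h : α} (hk : k ∈ D) (c : IsCut f s a b D k h) :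
    ∃ w ∈ D, ∀ S : Finset α, ∀ i n, k ∈ S → h ∈ S → w ∈ S → IsBlockIndex f s a b S i n →
      i k + 1 ≤ i h := by
  rcases c with ⟨h1, h2⟩ | ⟨h1, h2⟩ | ⟨w, hw, ⟨h1, h2⟩ | ⟨h1, h2⟩⟩
  · refine ⟨k, hk, fun S i n kS hS _ I => ?_⟩
    have := I.eq_zero k kS h1
    have := I.one_le h hS h2
    omega
  · refine ⟨k, hk, fun S i n kS hS _ I => ?_⟩
    have := I.lt_last k kS h1
    have := I.eq_last h hS h2
    omega
  · refine ⟨w, hw, fun S i n kS hS wS I => ?_⟩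
    have := I.near w wS k kS h1
    have := I.far w wS h hS h2
    omega
  · refine ⟨w, hw, fun S i n kS hS wS I => ?_⟩
    have := I.far k kS w wS h1
    have := I.near h hS w wS h2
    omega

theorem exists_isPredLetter {g h : α} (hg : g ∈ D) (hgh : f g < f h) :
    ∃ k, IsPredLetter f D k h ∧ f g ≤ f k := by
  classical
  obtain ⟨k, hk, hmax⟩ := Finset.exists_max_image (D.filter fun k => f k < f h) f
    ⟨g, by simp [hg, hgh]⟩
  simp only [Finset.mem_filter] at hk hmax
  exact ⟨k, ⟨hk.1, hk.2, fun g' hg' h' => hmax g' ⟨hg', h'⟩⟩, hmax g ⟨hg, hgh⟩⟩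

theorem one_le_blockStep {k h : α} (p : IsPredLetter f D k h) (c : IsCut f s a b D k h) :
    1 ≤ blockStep f s a b D h := by
  unfold blockStep
  split_ifs with h1 h2
  · norm_num
  · norm_num
  · exact absurd ⟨k, p, c⟩ h2

theorem two_le_blockStep {k h : α} (p : IsPredLetter f D k h) (c : s k < f h) :
    2 ≤ blockStep f s a b D h := by
  unfold blockStep
  rw [if_pos ⟨k, p, c⟩]

theorem exists_isPredLetter_of_blockStep {h : α} (c : 1 ≤ blockStep f s a b D h) :
    ∃ k, IsPredLetter f D k h ∧ (s k < f h ∨ IsCut f s a b D k h) := by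
  unfold blockStep at c
  split_ifs at c with h1 h2
  · obtain ⟨k, p, q⟩ := h1; exact ⟨k, p, Or.inl q⟩
  · obtain ⟨k, p, q⟩ := h2; exact ⟨k, p, Or.inr q⟩
  · norm_num at c

theorem blockStep_le_one {h : α} (c : ∀ k, IsPredLetter f D k h → ¬ s k < f h) :
    blockStep f s a b D h ≤ 1 := by
  unfold blockStep
  split_ifs with h1 h2
  · obtain ⟨k, p, q⟩ := h1; exact absurd q (c k p)
  · norm_num
  · norm_num

/-- Block indices exist as soon as they exist for any six letters. -/
theorem exists_isBlockIndex (hloc : ∀ S ⊆ D, S.card ≤ 6 → ∃ i n, IsBlockIndex f s a b S i n)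
    (hf : ∀ g ∈ D, ∀ h ∈ D, f g = f h → g = h) (hfs : ∀ g ∈ D, f g < s g)
    (hfifo : ∀ g ∈ D, ∀ h ∈ D, f g < f h → s g < s h)
    (hne : ∀ g ∈ D, ∀ h ∈ D, s g ≠ f h) (hfa : ∀ g ∈ D, f g ≠ a) (hsb : ∀ g ∈ D, s g ≠ b)
    (hfb : ∀ g ∈ D, f g < b) (has : ∀ g ∈ D, a < s g) :
    ∃ i n, IsBlockIndex f s a b D i n := by
  classical
  have hfifo' : ∀ g ∈ D, ∀ h ∈ D, f g ≤ f h → s g ≤ s h := by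
    intro g hg h hh hle
    rcases hle.lt_or_eq with hlt | heq
    · exact (hfifo g hg h hh hlt).le
    · rw [hf g hg h hh heq]
  rcases D.eq_empty_or_nonempty with rfl | hD
  · exact ⟨fun _ => 0, 2, by constructor <;> simp⟩
  set w := blockStep f s a b D with hw
  -- This is where six letters are needed: two cut pairs with a witness each. The two jumps raise
  -- the index by 2 from k to h', while `near` allows only 1.
  have loc : ∀ k ∈ D, ∀ h ∈ D, ∀ k' ∈ D, ∀ h' ∈ D, IsCut f s a b D k h →
      IsCut f s a b D k' h' → f h ≤ f k' → ¬ f h' < s k := by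
    intro k hk h hh k' hk' h' hh' c c' hle hnear
    obtain ⟨x, hx, cx⟩ := c.exists_witness hk
    obtain ⟨x', hx', cx'⟩ := c'.exists_witness hk'
    obtain ⟨i, n, I⟩ := hloc {k, h, x, k', h', x'} (by
      intro y hy; simp only [Finset.mem_insert, Finset.mem_singleton] at hy
      rcases hy with rfl | rfl | rfl | rfl | rfl | rfl <;> assumption) Finset.card_le_six
    have h1 := cx _ i n (by simp) (by simp) (by simp) I
    have h2 := cx' _ i n (by simp) (by simp) (by simp) I
    have h3 := I.mono_first h (by simp) k' (by simp) hle
    have h4 := I.near k (by simp) h' (by simp) hnear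
    omega
  -- The total of the forced steps on the way from g to g'.
  set W : α → α → ℤ := fun g g' => ∑ h ∈ D.filter (fun h => f g < f h ∧ f h ≤ f g'), w h with hW
  have Wnn : ∀ g g', 0 ≤ W g g' := fun g g' => Finset.sum_nonneg fun h _ => blockStep_nonneg h
  have Wge : ∀ g g', ∀ h ∈ D, f g < f h → f h ≤ f g' → w h ≤ W g g' := by
    intro g g' h hh h1 h2
    exact Finset.single_le_sum (f := w) (fun h _ => blockStep_nonneg h)
      (Finset.mem_filter.2 ⟨hh, h1, h2⟩)
  have Wge2 : ∀ g g', ∀ h ∈ D, ∀ k ∈ D, h ≠ k → f g < f h → f h ≤ f g' → f g < f k →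
      f k ≤ f g' → w h + w k ≤ W g g' := by
    intro g g' h hh k hk hhk h1 h2 h3 h4
    rw [← Finset.sum_pair (f := w) hhk]
    apply Finset.sum_le_sum_of_subset_of_nonneg
    · intro y hy
      simp only [Finset.mem_insert, Finset.mem_singleton] at hy
      rcases hy with rfl | rfl <;> simp [*]
    · exact fun h _ _ => blockStep_nonneg h
  -- As long as first occurrences precede the second occurrence of g, no step is 2, because the
  -- order of second occurrences is that of the first ones; and two steps equal to 1 are excluded by
  -- `loc`.
  have Wnear : ∀ g ∈ D, ∀ g' ∈ D, f g' < s g → W g g' ≤ 1 := by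
    intro g hg g' hg' hnear
    have nofar : ∀ h, f g < f h → f h ≤ f g' → ∀ k, IsPredLetter f D k h → ¬ s k < f h := by
      intro h h1 h2 k hk hlt
      have := hfifo' g hg k hk.1 (hk.2.2 g hg h1)
      omega
    apply Finset.sum_le_one_of_forall_eq
    · intro h hh
      simp only [Finset.mem_filter] at hh
      exact blockStep_le_one (nofar h hh.2.1 hh.2.2)
    · have key : ∀ h k, h ∈ D → k ∈ D → f g < f h → f k ≤ f g' → 1 ≤ w h → 1 ≤ w k →
          ¬ f h < f k := by
        intro h k hh hk h1 h2 wh wk hlt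
        obtain ⟨p, hp, hp'⟩ := exists_isPredLetter_of_blockStep wh
        obtain ⟨q, hq, hq'⟩ := exists_isPredLetter_of_blockStep wk
        have cp := hp'.resolve_left (nofar h h1 (by omega) p hp)
        have cq := hq'.resolve_left (nofar k (by omega) h2 q hq)
        have := hfifo' g hg p hp.1 (hp.2.2 g hg h1)
        exact loc p hp.1 h hh q hq.1 k hk cp cq (hq.2.2 h hh hlt) (by omega)
      intro h hh k hk wh wk
      simp only [Finset.mem_filter] at hh hk
      apply hf h hh.1 k hk.1
      have := key h k hh.1 hk.1 hh.2.1 hk.2.2 wh wk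
      have := key k h hk.1 hh.1 hk.2.1 hh.2.2 wk wh
      omega
  -- Let h' be the first letter starting after the end of g. Either its predecessor p has ended,
  -- giving a step 2, or the end of g cuts p from h'. In the latter case a second cut is found
  -- further left.
  have Wfar : ∀ g ∈ D, ∀ g' ∈ D, s g < f g' → 2 ≤ W g g' := by
    intro g hg g' hg' hfar
    obtain ⟨h', hh', hmin⟩ := Finset.exists_min_image (D.filter fun h => s g < f h) f
      ⟨g', by simp [hg', hfar]⟩
    simp only [Finset.mem_filter] at hh' hmin
    have hle := hmin g' ⟨hg', hfar⟩
    have hgh' : f g < f h' := (hfs g hg).trans hh'.2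
    obtain ⟨p, hp, hgp⟩ := exists_isPredLetter hg hgh'
    by_cases hpf : s p < f h'
    · exact (two_le_blockStep hp hpf).trans (Wge g g' h' hh'.1 hgh' hle)
    have hpg : f p < s g := by
      by_contra hc
      have := hne g hg p hp.1
      have := hmin p ⟨hp.1, by omega⟩
      have := hp.2.1
      omega
    have w1 : 1 ≤ w h' := one_le_blockStep hp (Or.inr (Or.inr ⟨g, hg, Or.inl ⟨hpg, hh'.2⟩⟩))
    -- k is the last letter that ends before h' starts and h is its successor, so the start of h'
    -- separates the second occurrences of k and h. As h comes no later than p, it differs from h'.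
    obtain ⟨k, hk, kmax⟩ := Finset.exists_max_image (D.filter fun h => s h < f h') f
      ⟨g, by simp [hg, hh'.2]⟩
    simp only [Finset.mem_filter] at hk kmax
    have hgk := kmax g ⟨hg, hh'.2⟩
    have hkp : f k < f p := by
      by_contra hc
      have := hfifo' p hp.1 k hk.1 (by omega)
      omega
    obtain ⟨h, hh, hmin2⟩ := Finset.exists_min_image (D.filter fun h => f k < f h) f
      ⟨p, by simp [hp.1, hkp]⟩
    simp only [Finset.mem_filter] at hh hmin2
    have hhp := hmin2 p ⟨hp.1, hkp⟩
    have hph' := hp.2.1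
    have hpred : IsPredLetter f D k h := by
      refine ⟨hk.1, hh.2, fun g1 hg1 hlt => ?_⟩
      by_contra hc
      have := hmin2 g1 ⟨hg1, by omega⟩
      omega
    have hsh : f h' < s h := by
      by_contra hc
      have := hne h hh.1 h' hh'.1
      have := kmax h ⟨hh.1, by omega⟩
      omega
    have w2 : 1 ≤ w h :=
      one_le_blockStep hpred (Or.inr (Or.inr ⟨h', hh'.1, Or.inr ⟨hk.2, hsh⟩⟩))
    have := Wge2 g g' h hh.1 h' hh'.1 (by rintro rfl; omega) (by omega) (by omega) hgh' hle
    omega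
  obtain ⟨m0, hm0, m0min⟩ := Finset.exists_min_image D f hD
  obtain ⟨m1, hm1, m1max⟩ := Finset.exists_max_image D f hD
  -- If no letter lies before the marker a, starting at 2 instead of 1 leaves room for n ≥ 2.
  set base : ℤ := if f m0 < a then 0 else 2 with hbase
  set i : α → ℤ := fun g => base + W m0 g with hi
  have iW : ∀ g ∈ D, ∀ g' ∈ D, f g ≤ f g' → i g' = i g + W g g' := by
    intro g hg g' hg' hle
    have : D.filter (fun h => f m0 < f h ∧ f h ≤ f g') =
        D.filter (fun h => f m0 < f h ∧ f h ≤ f g) ∪ D.filter (fun h => f g < f h ∧ f h ≤ f g') := by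
      ext y
      simp only [Finset.mem_filter, Finset.mem_union]
      constructor
      · rintro ⟨h1, h2, h3⟩
        by_cases hc : f y ≤ f g
        · exact Or.inl ⟨h1, h2, hc⟩
        · exact Or.inr ⟨h1, by omega, h3⟩
      · rintro (⟨h1, h2, h3⟩ | ⟨h1, h2, h3⟩)
        · exact ⟨h1, h2, by omega⟩
        · exact ⟨h1, by have := m0min g hg; omega, h3⟩
    simp only [hi, hW]
    rw [this, Finset.sum_union, add_assoc]
    rw [Finset.disjoint_left]
    intro y h1 h2
    simp only [Finset.mem_filter] at h1 h2
    omega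
  have imono : ∀ g ∈ D, ∀ h ∈ D, f g ≤ f h → i g ≤ i h := by
    intro g hg h hh hle
    rw [iW g hg h hh hle]
    have := Wnn g h
    omega
  have im0 : i m0 = base := by
    have : W m0 m0 = 0 := by
      simp only [hW]
      rw [Finset.filter_false_of_mem, Finset.sum_empty]
      intro y _ h; omega
    simp [hi, this]
  have Wzero : ∀ g ∈ D, ∀ g' ∈ D, (∀ h ∈ D, f g < f h → f h ≤ f g' → ∀ k, IsPredLetter f D k h →
      f g ≤ f k → ¬ s k < f h ∧ ¬ IsCut f s a b D k h) → W g g' = 0 := by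
    intro g hg g' hg' H
    apply le_antisymm _ (Wnn g g')
    apply Finset.sum_nonpos
    intro h hh
    simp only [Finset.mem_filter] at hh
    by_contra hc
    obtain ⟨k, hk, hk'⟩ := exists_isPredLetter_of_blockStep (f := f) (s := s) (a := a) (b := b)
      (D := D) (h := h) (by change 1 ≤ w h; omega)
    have := H h hh.1 hh.2.1 hh.2.2 k hk (hk.2.2 g hg hh.2.1)
    rcases hk' with h1 | h1
    · exact this.1 h1
    · exact this.2 h1
  have nocutA : ∀ k ∈ D, ∀ h ∈ D, f k < a → f h < a → ¬ IsCut f s a b D k h := by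
    intro k hk h hh h1 h2 c
    obtain ⟨x, hx, cx⟩ := c.exists_witness hk
    obtain ⟨i, n, I⟩ := hloc {k, h, x} (by
      intro y hy; simp only [Finset.mem_insert, Finset.mem_singleton] at hy
      rcases hy with rfl | rfl | rfl <;> assumption) (Finset.card_le_three.trans (by norm_num))
    have h3 := cx _ i n (by simp) (by simp) (by simp) I
    have := I.eq_zero k (by simp) h1
    have := I.eq_zero h (by simp) h2
    omega
  have nocutC : ∀ k ∈ D, ∀ h ∈ D, b < s k → b < s h → ¬ IsCut f s a b D k h := by
    intro k hk h hh h1 h2 c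
    obtain ⟨x, hx, cx⟩ := c.exists_witness hk
    obtain ⟨i, n, I⟩ := hloc {k, h, x} (by
      intro y hy; simp only [Finset.mem_insert, Finset.mem_singleton] at hy
      rcases hy with rfl | rfl | rfl <;> assumption) (Finset.card_le_three.trans (by norm_num))
    have h3 := cx _ i n (by simp) (by simp) (by simp) I
    have := I.eq_last k (by simp) h1
    have := I.eq_last h (by simp) h2
    omega
  -- If no letter ends after b, the last index must stay unused; adding 2 also ensures n ≥ 2.
  set n : ℤ := if b < s m1 then i m1 else i m1 + 2 with hn
  have hbn : 0 ≤ base := by rw [hbase]; split_ifs <;> norm_num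
  have ige : ∀ g ∈ D, base ≤ i g := fun g hg => im0 ▸ imono m0 hm0 g hg (m0min g hg)
  have ile : ∀ g ∈ D, i g ≤ i m1 := fun g hg => imono g hg m1 hm1 (m1max g hg)
  refine ⟨i, n, ?_, ?_, ?_, ?_, ?_, imono, ?_, ?_, ?_⟩
  · rw [hn]
    split_ifs with h1
    · by_cases h0 : f m0 < a
      · obtain ⟨j, n', I⟩ := hloc {m0, m1} (by
          intro y hy; simp only [Finset.mem_insert, Finset.mem_singleton] at hy
          rcases hy with rfl | rfl <;> assumption) (Finset.card_le_two.trans (by norm_num))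
        have e0 := I.eq_zero m0 (by simp) h0
        have e1 := I.eq_last m1 (by simp) h1
        have := I.two_le
        -- Here the local index runs from 0 to n' ≥ 2, so m0 and m1 cannot be near, and `Wfar`
        -- supplies the two steps.
        have hfar : s m0 < f m1 := by
          by_contra hc
          have := hne m0 hm0 m1 hm1
          have := I.near m0 (by simp) m1 (by simp) (by omega)
          omega
        rw [iW m0 hm0 m1 hm1 (m0min m1 hm1)]
        have := Wfar m0 hm0 m1 hm1 hfar
        omega
      · have := ige m1 hm1
        rw [hbase, if_neg h0] at this
        exact this
    · have := ige m1 hm1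
      omega
  · intro g hg hga
    have h0 : f m0 < a := lt_of_le_of_lt (m0min g hg) hga
    rw [iW m0 hm0 g hg (m0min g hg), im0, hbase, if_pos h0, Wzero m0 hm0 g hg, add_zero]
    intro h hh h1 h2 k hk h3
    have hkh := hk.2.1
    have := has k hk.1
    exact ⟨by omega, nocutA k hk.1 h hh (by omega) (by omega)⟩
  · intro g hg hga
    by_cases h0 : f m0 < a
    · obtain ⟨h, hh, hmin⟩ := Finset.exists_min_image (D.filter fun h => a < f h) f
        ⟨g, by simp [hg, hga]⟩
      simp only [Finset.mem_filter] at hh hmin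
      obtain ⟨k, hk, -⟩ := exists_isPredLetter (f := f) (h := h) hm0 (h0.trans hh.2)
      have hkh := hk.2.1
      have hka : f k < a := by
        by_contra hc
        have := hfa k hk.1
        have := hmin k ⟨hk.1, by omega⟩
        omega
      have : 1 ≤ w h := one_le_blockStep (s := s) (b := b) hk (Or.inl ⟨hka, hh.2⟩)
      have := Wge m0 g h hh.1 (h0.trans hh.2) (hmin g ⟨hg, hga⟩)
      rw [iW m0 hm0 g hg (m0min g hg), im0]
      omega
    · have := ige g hg
      rw [hbase, if_neg h0] at this
      omega
  · intro g hg hgb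
    have h1 : b < s m1 := lt_of_lt_of_le hgb (hfifo' g hg m1 hm1 (m1max g hg))
    rw [hn, if_pos h1, iW g hg m1 hm1 (m1max g hg), Wzero g hg m1 hm1, add_zero]
    intro h hh h1 h2 k hk h3
    have hsk := hfifo' g hg k hk.1 h3
    have := hfb h hh
    have := hfifo' g hg h hh h1.le
    exact ⟨by omega, nocutC k hk.1 h hh (by omega) (by omega)⟩
  · intro g hg hgb
    have h2 := ile g hg
    rw [hn]
    split_ifs with h1
    · obtain ⟨h, hh, hmin⟩ := Finset.exists_min_image (D.filter fun h => b < s h) f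
        ⟨m1, by simp [hm1, h1]⟩
      simp only [Finset.mem_filter] at hh hmin
      have hgh : f g < f h := by
        by_contra hc
        have := hfifo' h hh.1 g hg (by omega)
        omega
      obtain ⟨k, hk, -⟩ := exists_isPredLetter hg hgh
      have hkh := hk.2.1
      have hkb : s k < b := by
        by_contra hc
        have := hsb k hk.1
        have := hmin k ⟨hk.1, by omega⟩
        omega
      have : 1 ≤ w h := one_le_blockStep (a := a) hk (Or.inr (Or.inl ⟨hkb, hh.2⟩))
      have := Wge g m1 h hh.1 hgh (m1max h hh.1)
      rw [iW g hg m1 hm1 (m1max g hg)]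
      omega
    · omega
  · intro g hg h hh hle
    apply imono g hg h hh
    by_contra hc
    have := hfifo h hh g hg (by omega)
    omega
  · intro g hg h hh hlt
    rw [iW g hg h hh ((hfs g hg).trans hlt).le]
    have := Wfar g hg h hh hlt
    omega
  · intro g hg h hh hlt
    by_cases hle : f g ≤ f h
    · rw [iW g hg h hh hle]
      have := Wnear g hg h hh hlt
      omega
    · have := imono h hh g hg (by omega)
      omega

end Helly

/-! ### Marked occurrences and the form of a chain. -/

section Tags

variable {α : Type*} [DecidableEq α]

/-- Marks every entry of a list by whether it belongs to `s` or occurred before. -/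
def tagSeen : List α → List α → List (α × Bool)
  | _, [] => []
  | s, g :: M => (g, decide (g ∈ s)) :: tagSeen (g :: s) M

theorem tagSeen_map_fst (s M : List α) : (tagSeen s M).map Prod.fst = M := by
  induction M generalizing s with
  | nil => rfl
  | cons g M ih => simp [tagSeen, ih]

theorem tagSeen_congr {s s' M : List α} (h : ∀ g ∈ M, g ∈ s ↔ g ∈ s') :
    tagSeen s M = tagSeen s' M := by
  induction M generalizing s s' with
  | nil => rfl
  | cons g M ih =>
    simp only [tagSeen]
    rw [ih (s := g :: s) (s' := g :: s')]
    · simp [h g]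
    · intro k hk
      simp [h k (List.mem_cons_of_mem _ hk)]

theorem tagSeen_append (s A B : List α) : tagSeen s (A ++ B) = tagSeen s A ++ tagSeen (s ++ A) B := by
  induction A generalizing s with
  | nil => simp [tagSeen]
  | cons g A ih =>
    simp only [tagSeen, List.cons_append, ih]
    congr 2
    apply tagSeen_congr
    intro k _
    simp only [List.mem_append, List.mem_cons]
    tauto

theorem tagSeen_filter (S : Finset α) (s M : List α) :
    (tagSeen s M).filter (fun p => p.1 ∈ S) =
      tagSeen (s.filter (· ∈ S)) (M.filter (· ∈ S)) := by
  induction M generalizing s with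
  | nil => rfl
  | cons g M ih =>
    by_cases hg : g ∈ S
    · simp [tagSeen, hg, ih]
    · simp [tagSeen, hg, ih]

theorem tagSeen_of_subset {s A : List α} (h : ∀ g ∈ A, g ∈ s) :
    tagSeen s A = A.map fun g => (g, true) := by
  induction A generalizing s with
  | nil => rfl
  | cons g A ih =>
    simp only [tagSeen, List.map_cons, List.cons.injEq, Prod.mk.injEq, decide_eq_true_eq, true_and]
    exact ⟨h g (by simp), ih fun k hk => List.mem_cons_of_mem _ (h k (List.mem_cons_of_mem _ hk))⟩

theorem tagSeen_of_disjoint {s A : List α} (h : ∀ g ∈ A, g ∉ s) (hA : A.Nodup) :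
    tagSeen s A = A.map fun g => (g, false) := by
  induction A generalizing s with
  | nil => rfl
  | cons g A ih =>
    simp only [tagSeen, List.map_cons, List.cons.injEq, Prod.mk.injEq, decide_eq_false_iff_not,
      true_and]
    refine ⟨h g (by simp), ih (fun k hk => ?_) (List.nodup_cons.1 hA).2⟩
    simp only [List.mem_cons, not_or]
    exact ⟨by rintro rfl; exact (List.nodup_cons.1 hA).1 hk, h k (List.mem_cons_of_mem _ hk)⟩

theorem count_tagSeen (s M : List α) (g : α) :
    (tagSeen s M).count (g, false) = (if g ∈ s then 0 else min 1 (M.count g)) ∧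
    (tagSeen s M).count (g, true) = (if g ∈ s then M.count g else M.count g - 1) := by
  induction M generalizing s with
  | nil => simp [tagSeen]
  | cons k M ih =>
    have := ih (k :: s)
    simp only [tagSeen, List.count_cons, this, List.mem_cons, beq_iff_eq, Prod.mk.injEq]
    by_cases hgk : k = g
    · subst hgk
      by_cases hs : k ∈ s <;> simp [hs]
    · have : ¬ g = k := fun h => hgk h.symm
      by_cases hs : g ∈ s <;> simp [hs, hgk, this]

/-- The restriction to the two heads shows that they coincide; the common head then cancels in every
restriction. -/
theorem List.prefix_of_filter_prefix {A L : List α}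
    (h : ∀ S : Finset α, S.card ≤ 2 → A.filter (· ∈ S) <+: L.filter (· ∈ S)) : A <+: L := by
  induction A generalizing L with
  | nil => simp
  | cons a A ih =>
    cases L with
    | nil =>
      have := h {a} (by simp)
      simp at this
    | cons b L =>
      have hab : a = b := by
        have := h {a, b} Finset.card_le_two
        simp only [Finset.mem_insert, Finset.mem_singleton, true_or, decide_true,
          List.filter_cons_of_pos, or_true] at this
        exact (List.cons_prefix_cons.1 this).1
      subst hab
      rw [List.cons_prefix_cons]
      refine ⟨rfl, ih fun S hS => ?_⟩
      have := h S hS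
      by_cases ha : a ∈ S
      · simpa [ha] using this
      · simpa [ha] using this

theorem List.suffix_of_filter_suffix {A L : List α}
    (h : ∀ S : Finset α, S.card ≤ 2 → A.filter (· ∈ S) <:+ L.filter (· ∈ S)) : A <:+ L := by
  rw [← List.reverse_prefix]
  apply List.prefix_of_filter_prefix
  intro S hS
  rw [List.filter_reverse, List.filter_reverse, List.reverse_prefix]
  exact h S hS

theorem List.eq_of_filter_eq {A L : List α}
    (h : ∀ S : Finset α, S.card ≤ 2 → A.filter (· ∈ S) = L.filter (· ∈ S)) : A = L := by
  have h1 : A <+: L := List.prefix_of_filter_prefix fun S hS => by rw [h S hS]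
  have h2 : L <+: A := List.prefix_of_filter_prefix fun S hS => by rw [h S hS]
  exact h1.eq_of_length_le h2.length_le

/-- The word `X₁X₀X₂X₁ ⋯ XₙXₙ₋₁`. -/
def chainBlocks (X : ℕ → List α) (n : ℕ) : List α :=
  (List.range n).flatMap fun j => X (j + 1) ++ X j

/-- The word `L cd M cd R` has the form `l X₀ (Z cd P) X₁X₀X₂X₁ ⋯ XₙXₙ₋₁ (Z cd P) Xₙ r`. -/
def HasChain (L M R : List α) : Prop :=
  ∃ (n : ℕ) (X : ℕ → List α) (Z P l r : List α), 2 ≤ n ∧ L = l ++ X 0 ++ Z ∧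
    M = P ++ chainBlocks X n ++ Z ∧ R = P ++ X n ++ r

theorem chainBlocks_succ (X : ℕ → List α) (n : ℕ) :
    chainBlocks X (n + 1) = chainBlocks X n ++ (X (n + 1) ++ X n) := by
  simp [chainBlocks, List.range_succ, List.flatMap_append]

/-- Inner blocks occur twice, X₀ and Xₙ once each; the added terms are the copies that a chain has
outside, in L and in R. -/
theorem count_chainBlocks (X : ℕ → List α) (n : ℕ) (g : α) :
    (chainBlocks X n).count g + (X 0).count g + (X n).count g =
      2 * ∑ j ∈ Finset.range (n + 1), (X j).count g := by
  induction n with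
  | zero => simp [chainBlocks]; omega
  | succ n ih =>
    rw [chainBlocks_succ, Finset.sum_range_succ, mul_add, ← ih]
    simp only [List.count_append]
    omega

theorem mem_chainBlocks {X : ℕ → List α} {n : ℕ} {g : α} (h : g ∈ chainBlocks X n) :
    ∃ j ≤ n, g ∈ X j := by
  simp only [chainBlocks, List.mem_flatMap, List.mem_range, List.mem_append] at h
  obtain ⟨j, hj, h | h⟩ := h
  · exact ⟨j + 1, hj, h⟩
  · exact ⟨j, hj.le, h⟩

/-- `chainBlocks` with the occurrences marked as first or second ones. -/
def taggedBlocks (X : ℕ → List α) (n : ℕ) : List (α × Bool) :=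
  (List.range n).flatMap fun j =>
    ((X (j + 1)).map fun g => (g, false)) ++ ((X j).map fun g => (g, true))

theorem taggedBlocks_succ (X : ℕ → List α) (n : ℕ) :
    taggedBlocks X (n + 1) = taggedBlocks X n ++
      (((X (n + 1)).map fun g => (g, false)) ++ ((X n).map fun g => (g, true))) := by
  simp [taggedBlocks, List.range_succ, List.flatMap_append]

theorem tagSeen_chainBlocks {X : ℕ → List α} {s : List α} (n : ℕ) (h0 : ∀ g ∈ X 0, g ∈ s)
    (hs : ∀ j, 1 ≤ j → j ≤ n → ∀ g ∈ X j, g ∉ s) (hn : ∀ j ≤ n, (X j).Nodup)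
    (hd : ∀ i ≤ n, ∀ j ≤ n, ∀ g, g ∈ X i → g ∈ X j → i = j) :
    tagSeen s (chainBlocks X n) = taggedBlocks X n ∧
      ∀ g ∈ X n, g ∈ s ++ chainBlocks X n := by
  induction n with
  | zero => simpa [chainBlocks, taggedBlocks, tagSeen] using h0
  | succ n ih =>
    obtain ⟨ih1, ih2⟩ := ih (fun j h1 h2 => hs j h1 (by omega)) (fun j hj => hn j (by omega))
      (fun i hi j hj => hd i (by omega) j (by omega))
    rw [chainBlocks_succ, taggedBlocks_succ, tagSeen_append, ih1, tagSeen_append]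
    refine ⟨?_, fun g hg => by simp [hg]⟩
    congr 2
    · apply tagSeen_of_disjoint _ (hn _ le_rfl)
      intro g hg h
      rw [List.mem_append] at h
      rcases h with h | h
      · exact hs _ (by omega) le_rfl g hg h
      · obtain ⟨j, hj, h⟩ := mem_chainBlocks h
        have := hd _ le_rfl j (by omega) g hg h
        omega
    · apply tagSeen_of_subset
      intro g hg
      exact List.mem_append_left _ (ih2 g hg)

/-- The numbers of occurrences in the parts of a chain. -/
theorem count_le_of_chain {X : ℕ → List α} {n : ℕ} {Z P l r : List α}
    (h2 : ∀ g, (l ++ X 0 ++ Z).count g + (P ++ chainBlocks X n ++ Z).count g +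
      (P ++ X n ++ r).count g ≤ 2) (g : α) :
    l.count g + r.count g + 2 * (Z.count g + P.count g +
      ∑ j ∈ Finset.range (n + 1), (X j).count g) ≤ 2 := by
  have := h2 g
  have := count_chainBlocks X n g
  simp only [List.count_append] at *
  omega

end Tags

/-! ### Invariants of chains in two-limited words. -/

section ChainTimes

variable {α : Type*} [DecidableEq α]

/-- Each block already accounts for two occurrences of its letters, so in a two-limited word the
blocks are disjoint from one another and from l, r, Z, P, and free of repetitions. -/
theorem mem_unique_of_chain {X : ℕ → List α} {n : ℕ} {Z P l r : List α}
    (h2 : ∀ g, (l ++ X 0 ++ Z).count g + (P ++ chainBlocks X n ++ Z).count g +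
      (P ++ X n ++ r).count g ≤ 2) {j : ℕ} (hj : j ≤ n) {g : α} (hg : g ∈ X j) :
    g ∉ l ∧ g ∉ r ∧ g ∉ Z ∧ g ∉ P ∧ (X j).count g = 1 ∧ ∀ i ≤ n, g ∈ X i → i = j := by
  have hc := count_le_of_chain h2 g
  have h1 := List.count_pos_iff.2 hg
  have hs : (X j).count g ≤ ∑ j ∈ Finset.range (n + 1), (X j).count g :=
    Finset.single_le_sum (f := fun j => (X j).count g) (fun _ _ => Nat.zero_le _)
      (Finset.mem_range.2 (by omega))
  refine ⟨fun h => ?_, fun h => ?_, fun h => ?_, fun h => ?_, by omega, fun i hi h => ?_⟩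
  · have := List.count_pos_iff.2 h; omega
  · have := List.count_pos_iff.2 h; omega
  · have := List.count_pos_iff.2 h; omega
  · have := List.count_pos_iff.2 h; omega
  · by_contra hne
    have h3 := List.count_pos_iff.2 h
    have : ∑ k ∈ ({i, j} : Finset ℕ), (X k).count g ≤
        ∑ j ∈ Finset.range (n + 1), (X j).count g :=
      Finset.sum_le_sum_of_subset (by
        intro k hk
        simp only [Finset.mem_insert, Finset.mem_singleton] at hk
        rw [Finset.mem_range]
        rcases hk with rfl | rfl <;> omega)
    rw [Finset.sum_pair hne] at this
    omega

theorem notMem_of_chain_margin {X : ℕ → List α} {n : ℕ} {Z P l r : List α}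
    (h2 : ∀ g, (l ++ X 0 ++ Z).count g + (P ++ chainBlocks X n ++ Z).count g +
      (P ++ X n ++ r).count g ≤ 2) {g : α} :
    (g ∈ Z → g ∉ l ∧ g ∉ r ∧ g ∉ P ∧ ∀ i ≤ n, g ∉ X i) ∧
    (g ∈ P → g ∉ l ∧ g ∉ r ∧ g ∉ Z ∧ ∀ i ≤ n, g ∉ X i) := by
  have hc := count_le_of_chain h2
  refine ⟨fun h => ?_, fun h => ?_⟩
  · have := hc g
    have := List.count_pos_iff.2 h
    exact ⟨fun h' => by have := List.count_pos_iff.2 h'; omega,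
      fun h' => by have := List.count_pos_iff.2 h'; omega,
      fun h' => by have := List.count_pos_iff.2 h'; omega,
      fun i hi h' => (mem_unique_of_chain h2 hi h').2.2.1 h⟩
  · have := hc g
    have := List.count_pos_iff.2 h
    exact ⟨fun h' => by have := List.count_pos_iff.2 h'; omega,
      fun h' => by have := List.count_pos_iff.2 h'; omega,
      fun h' => by have := List.count_pos_iff.2 h'; omega,
      fun i hi h' => (mem_unique_of_chain h2 hi h').2.2.2.1 h⟩

theorem mem_left_iff_of_chain {X : ℕ → List α} {n : ℕ} {Z P l r : List α}
    (h2 : ∀ g, (l ++ X 0 ++ Z).count g + (P ++ chainBlocks X n ++ Z).count g +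
      (P ++ X n ++ r).count g ≤ 2) {j : ℕ} (hj : j ≤ n) {g : α} (hg : g ∈ X j) :
    (g ∈ l ++ X 0 ++ Z ↔ j = 0) ∧ (g ∈ P ++ X n ++ r ↔ j = n) := by
  obtain ⟨h1, h2, h3, h4, -, h5⟩ := mem_unique_of_chain h2 hj hg
  simp only [List.mem_append, h1, h2, h3, h4, false_or, or_false]
  refine ⟨⟨fun h => ?_, ?_⟩, fun h => ?_, ?_⟩
  · have := h5 0 (by omega) h; omega
  · rintro rfl; exact hg
  · have := h5 n le_rfl h; omega
  · rintro rfl; exact hg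

theorem tagSeen_of_chain {X : ℕ → List α} {n : ℕ} {Z P l r : List α}
    (h2 : ∀ g, (l ++ X 0 ++ Z).count g + (P ++ chainBlocks X n ++ Z).count g +
      (P ++ X n ++ r).count g ≤ 2) :
    tagSeen (l ++ X 0 ++ Z) (P ++ chainBlocks X n ++ Z) =
      P.map (fun g => (g, false)) ++ taggedBlocks X n ++ Z.map fun g => (g, true) := by
  rw [tagSeen_append, tagSeen_append]
  congr 2
  · apply tagSeen_of_disjoint
    · intro g hg
      obtain ⟨h1, -, h3, h4⟩ := (notMem_of_chain_margin h2).2 hg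
      simp [h1, h3, h4 0 (by omega)]
    · rw [List.nodup_iff_count_le_one]
      intro g
      have := count_le_of_chain h2 g
      omega
  · refine (tagSeen_chainBlocks n (by simp +contextual) ?_ ?_ ?_).1
    · intro j hj1 hj g hg h
      rw [List.mem_append] at h
      rcases h with h | h
      · have := (mem_left_iff_of_chain h2 hj hg).1.1 h
        omega
      · exact (mem_unique_of_chain h2 hj hg).2.2.2.1 h
    · intro j hj
      rw [List.nodup_iff_count_eq_one]
      exact fun g hg => (mem_unique_of_chain h2 hj hg).2.2.2.2.1
    · intro i hi j hj g hgi hgj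
      exact (mem_unique_of_chain h2 hj hgj).2.2.2.2.2 i hi hgi
  · apply tagSeen_of_subset
    intro g hg
    simp [hg]

theorem chainBlocks_eq_of_two_le (X : ℕ → List α) {n : ℕ} (hn : 1 ≤ n) :
    chainBlocks X n = X 1 ++ X 0 ++ chainBlocks (fun j => X (j + 1)) (n - 1) := by
  obtain ⟨m, rfl⟩ := Nat.exists_eq_add_of_le' hn
  simp [chainBlocks, List.range_succ_eq_map, List.flatMap_map]

theorem filter_chainBlocks_left {X : ℕ → List α} {n : ℕ} (hn : 1 ≤ n) {p : α → Bool}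
    (h0 : ∀ g ∈ X 0, p g) (h1 : ∀ j, 1 ≤ j → j ≤ n → ∀ g ∈ X j, p g = false) :
    (chainBlocks X n).filter p = X 0 := by
  rw [chainBlocks_eq_of_two_le X hn, List.filter_append, List.filter_append]
  have e1 : (X 1).filter p = [] := by
    rw [List.filter_eq_nil_iff]; intro g hg; simp [h1 1 le_rfl hn g hg]
  have e2 : (chainBlocks (fun j => X (j + 1)) (n - 1)).filter p = [] := by
    rw [List.filter_eq_nil_iff]; intro g hg
    obtain ⟨j, hj, hg⟩ := mem_chainBlocks hg
    simp [h1 (j + 1) (by omega) (by omega) g hg]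
  rw [e1, e2, List.filter_eq_self.2 h0]
  simp

theorem filter_chainBlocks_right {X : ℕ → List α} {n : ℕ} (hn : 1 ≤ n) {p : α → Bool}
    (h0 : ∀ g ∈ X n, p g) (h1 : ∀ j, j < n → ∀ g ∈ X j, p g = false) :
    (chainBlocks X n).filter p = X n := by
  obtain ⟨m, rfl⟩ := Nat.exists_eq_add_of_le' hn
  rw [chainBlocks_succ, List.filter_append, List.filter_append]
  have e1 : (X m).filter p = [] := by
    rw [List.filter_eq_nil_iff]; intro g hg; simp [h1 m (by omega) g hg]
  have e2 : (chainBlocks X m).filter p = [] := by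
    rw [List.filter_eq_nil_iff]; intro g hg
    obtain ⟨j, hj, hg⟩ := mem_chainBlocks hg
    simp [h1 j (by omega) g hg]
  rw [e1, e2, List.filter_eq_self.2 h0]
  simp

/-- In a chain the letters of `L` occur in `M` in the order in which they end `L`. -/
theorem HasChain.suffix_left {L M R : List α} (h : HasChain L M R)
    (h2 : ∀ g, L.count g + M.count g + R.count g ≤ 2) : M.filter (· ∈ L) <:+ L := by
  obtain ⟨n, X, Z, P, l, r, hn, rfl, rfl, rfl⟩ := h
  refine ⟨l, ?_⟩
  rw [List.filter_append, List.filter_append, filter_chainBlocks_left (by omega)]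
  · rw [(List.filter_eq_nil_iff (l := P)).2, List.filter_eq_self.2]
    · simp
    · simp +contextual
    · intro g hg
      obtain ⟨h1, -, h3, h4⟩ := (notMem_of_chain_margin h2).2 hg
      simp [h1, h3, h4 0 (by omega)]
  · simp +contextual
  · intro j h1 hj g hg
    have := (mem_left_iff_of_chain h2 hj hg).1
    rw [decide_eq_false_iff_not, this]
    omega

theorem HasChain.prefix_right {L M R : List α} (h : HasChain L M R)
    (h2 : ∀ g, L.count g + M.count g + R.count g ≤ 2) : M.filter (· ∈ R) <+: R := by
  obtain ⟨n, X, Z, P, l, r, hn, rfl, rfl, rfl⟩ := h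
  refine ⟨r, ?_⟩
  rw [List.filter_append, List.filter_append, filter_chainBlocks_right (by omega)]
  · rw [(List.filter_eq_nil_iff (l := Z)).2, List.filter_eq_self.2]
    · simp
    · simp +contextual
    · intro g hg
      obtain ⟨h1, h1', h3, h4⟩ := (notMem_of_chain_margin h2).1 hg
      simp [h1', h3, h4 n (by omega)]
  · simp +contextual
  · intro j hj g hg
    have := (mem_left_iff_of_chain h2 hj.le hg).2
    rw [decide_eq_false_iff_not, this]
    omega

/-- Both sides are X₁X₂⋯Xₙ₋₁: among the first copies p discards Xₙ, among the second copies q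
discards X₀. -/
theorem filter_taggedBlocks {X : ℕ → List α} {n : ℕ} {p q : α → Bool}
    (hp : ∀ j < n, ∀ g ∈ X (j + 1), p g = decide (j + 1 ≠ n))
    (hq : ∀ j < n, ∀ g ∈ X j, q g = decide (j ≠ 0)) :
    ((taggedBlocks X n).filter fun x => !x.2 && p x.1).map Prod.fst =
      ((taggedBlocks X n).filter fun x => x.2 && q x.1).map Prod.fst := by
  have e1 : ((taggedBlocks X n).filter fun x => !x.2 && p x.1).map Prod.fst =
      (List.range n).flatMap fun j => if j + 1 = n then [] else X (j + 1) := by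
    rw [taggedBlocks, List.filter_flatMap, List.map_flatMap, List.flatMap_congr]
    intro j hj
    rw [List.mem_range] at hj
    rw [List.filter_append, List.map_append, List.filter_map, List.filter_map]
    split_ifs with hjn
    · rw [(List.filter_eq_nil_iff (l := X (j + 1))).2, (List.filter_eq_nil_iff (l := X j)).2]
      · rfl
      · simp
      · intro g hg; simp [hp j hj g hg, hjn]
    · rw [List.filter_eq_self.2, (List.filter_eq_nil_iff (l := X j)).2]
      · simp [Function.comp_def]
      · simp
      · intro g hg; simp [hp j hj g hg, hjn]
  have e2 : ((taggedBlocks X n).filter fun x => x.2 && q x.1).map Prod.fst =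
      (List.range n).flatMap fun j => if j = 0 then [] else X j := by
    rw [taggedBlocks, List.filter_flatMap, List.map_flatMap, List.flatMap_congr]
    intro j hj
    rw [List.mem_range] at hj
    rw [List.filter_append, List.map_append, List.filter_map, List.filter_map]
    split_ifs with hjn
    · rw [(List.filter_eq_nil_iff (l := X (j + 1))).2, (List.filter_eq_nil_iff (l := X j)).2]
      · rfl
      · intro g hg; simp [hq j hj g hg, hjn]
      · simp
    · rw [(List.filter_eq_nil_iff (l := X (j + 1))).2, List.filter_eq_self.2]
      · simp [Function.comp_def]
      · intro g hg; simp [hq j hj g hg, hjn]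
      · simp
  rw [e1, e2]
  cases n with
  | zero => rfl
  | succ m =>
    conv_lhs => rw [List.range_succ, List.flatMap_append]
    conv_rhs => rw [List.range_succ_eq_map, List.flatMap_cons, List.flatMap_map]
    simp only [List.flatMap_cons, if_true, List.flatMap_nil, List.append_nil, List.nil_append]
    apply List.flatMap_congr
    intro j hj
    rw [List.mem_range] at hj
    rw [if_neg (by omega), if_neg (by omega)]

/-- In a chain the letters with both occurrences in `M` occur twice in the same order. -/
theorem HasChain.firsts_eq_seconds {L M R : List α} (h : HasChain L M R)
    (h2 : ∀ g, L.count g + M.count g + R.count g ≤ 2) :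
    ((tagSeen L M).filter fun x => !x.2 && decide (x.1 ∉ R)).map Prod.fst =
      ((tagSeen L M).filter fun x => x.2 && decide (x.1 ∉ L)).map Prod.fst := by
  obtain ⟨n, X, Z, P, l, r, hn, rfl, rfl, rfl⟩ := h
  rw [tagSeen_of_chain h2]
  have e1 : ∀ p : α → Bool, (∀ g ∈ P, p g = false) →
      ((P.map (fun g => (g, false)) ++ taggedBlocks X n ++ Z.map fun g => (g, true)).filter
        fun x => !x.2 && p x.1) = (taggedBlocks X n).filter fun x => !x.2 && p x.1 := by
    intro p hp
    rw [List.filter_append, List.filter_append, List.filter_map, List.filter_map,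
      (List.filter_eq_nil_iff (l := P)).2, (List.filter_eq_nil_iff (l := Z)).2]
    · simp
    · simp
    · simpa using hp
  have e2 : ∀ p : α → Bool, (∀ g ∈ Z, p g = false) →
      ((P.map (fun g => (g, false)) ++ taggedBlocks X n ++ Z.map fun g => (g, true)).filter
        fun x => x.2 && p x.1) = (taggedBlocks X n).filter fun x => x.2 && p x.1 := by
    intro p hp
    rw [List.filter_append, List.filter_append, List.filter_map, List.filter_map,
      (List.filter_eq_nil_iff (l := P)).2, (List.filter_eq_nil_iff (l := Z)).2]
    · simp
    · simpa using hp
    · simp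
  rw [e1 (fun g => decide (g ∉ P ++ X n ++ r)) (by simp +contextual),
    e2 (fun g => decide (g ∉ l ++ X 0 ++ Z)) (by simp +contextual)]
  refine filter_taggedBlocks (p := fun g => decide (g ∉ P ++ X n ++ r))
    (q := fun g => decide (g ∉ l ++ X 0 ++ Z)) ?_ ?_
  · intro j hj g hg
    simp only [ne_eq, (mem_left_iff_of_chain h2 (show j + 1 ≤ n by omega) hg).2]
  · intro j hj g hg
    simp only [ne_eq, (mem_left_iff_of_chain h2 hj.le hg).1]

theorem mem_taggedBlocks {X : ℕ → List α} {n : ℕ} {p : α × Bool} (h : p ∈ taggedBlocks X n) :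
    ∃ j < n, (p.2 = false ∧ p.1 ∈ X (j + 1)) ∨ (p.2 = true ∧ p.1 ∈ X j) := by
  obtain ⟨g, c⟩ := p
  simp only [taggedBlocks, List.mem_flatMap, List.mem_range, List.mem_append, List.mem_map,
    Prod.mk.injEq] at h
  obtain ⟨j, hj, ⟨k, hk, rfl, rfl⟩ | ⟨k, hk, rfl, rfl⟩⟩ := h
  · exact ⟨j, hj, Or.inl ⟨rfl, hk⟩⟩
  · exact ⟨j, hj, Or.inr ⟨rfl, hk⟩⟩

theorem pairwise_taggedBlocks {X : ℕ → List α} (n : ℕ) {τ : α × Bool → ℤ}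
    (h1 : ∀ j < n, ∀ g ∈ X (j + 1), τ (g, false) = 2 * j + 1)
    (h2 : ∀ j < n, ∀ g ∈ X j, τ (g, true) = 2 * j + 2) :
    (taggedBlocks X n).Pairwise fun p q => τ p ≤ τ q := by
  induction n with
  | zero => simp [taggedBlocks]
  | succ n ih =>
    rw [taggedBlocks_succ, List.pairwise_append, List.pairwise_append, List.pairwise_map,
      List.pairwise_map]
    refine ⟨ih (fun j hj => h1 j (by omega)) (fun j hj => h2 j (by omega)), ⟨?_, ?_, ?_⟩, ?_⟩
    · rw [List.pairwise_iff_forall_sublist]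
      intro a b hab
      rw [h1 n (by omega) a (hab.subset (by simp)), h1 n (by omega) b (hab.subset (by simp))]
    · rw [List.pairwise_iff_forall_sublist]
      intro a b hab
      rw [h2 n (by omega) a (hab.subset (by simp)), h2 n (by omega) b (hab.subset (by simp))]
    · intro p hp q hq
      simp only [List.mem_map] at hp hq
      obtain ⟨g, hg, rfl⟩ := hp
      obtain ⟨k, hk, rfl⟩ := hq
      rw [h1 n (by omega) g hg, h2 n (by omega) k hk]
      omega
    · intro p hp q hq
      have e1 : τ p ≤ 2 * n := by
        obtain ⟨g, c⟩ := p
        obtain ⟨j, hj, ⟨rfl, hg⟩ | ⟨rfl, hg⟩⟩ := mem_taggedBlocks hp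
        · simp only at hg; rw [h1 j (by omega) g hg]; omega
        · simp only at hg; rw [h2 j (by omega) g hg]; omega
      have e2 : 2 * n + 1 ≤ τ q := by
        simp only [List.mem_append, List.mem_map] at hq
        obtain ⟨k, hk, rfl⟩ | ⟨k, hk, rfl⟩ := hq
        · rw [h1 n (by omega) k hk]
        · rw [h2 n (by omega) k hk]; omega
      omega

/-- The block indices of the letters of a chain determine the order of the occurrences. -/
theorem HasChain.exists_time {L M R : List α} (h : HasChain L M R)
    (h2 : ∀ g, L.count g + M.count g + R.count g ≤ 2) :
    ∃ (i : α → ℤ) (n : ℤ) (τ : α × Bool → ℤ), 2 ≤ n ∧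
      ((tagSeen L M).Pairwise fun p q => τ p ≤ τ q) ∧
      (∀ g, (g, false) ∈ tagSeen L M → (g ∈ R ∧ τ (g, false) = 0) ∨
        (τ (g, false) = 2 * i g - 1 ∧ 1 ≤ i g ∧ i g ≤ n ∧ (g ∈ R ↔ i g = n))) ∧
      (∀ g, (g, true) ∈ tagSeen L M → (g ∈ L ∧ τ (g, true) = 2 * n + 1) ∨
        (τ (g, true) = 2 * i g + 2 ∧ 0 ≤ i g ∧ i g + 1 ≤ n ∧ (g ∈ L ↔ i g = 0))) := by
  classical
  obtain ⟨n, X, Z, P, l, r, hn, rfl, rfl, rfl⟩ := h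
  set i : α → ℕ := fun g => if h : ∃ j ≤ n, g ∈ X j then h.choose else 0 with hi
  have iX : ∀ j ≤ n, ∀ g ∈ X j, i g = j := by
    intro j hj g hg
    have hex : ∃ j ≤ n, g ∈ X j := ⟨j, hj, hg⟩
    simp only [hi, dif_pos hex]
    exact (mem_unique_of_chain h2 hj hg).2.2.2.2.2 _ hex.choose_spec.1 hex.choose_spec.2
  -- Times in P X₁X₀X₂X₁⋯XₙXₙ₋₁ Z: P has time 0, the first copy of Xⱼ has 2j − 1, the second 2j + 2,
  -- and Z has 2n + 1.
  set τ : α × Bool → ℤ := fun p => if p.2 then (if p.1 ∈ Z then 2 * n + 1 else 2 * i p.1 + 2)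
    else (if p.1 ∈ P then 0 else 2 * i p.1 - 1) with hτ
  have t1 : ∀ j < n, ∀ g ∈ X (j + 1), τ (g, false) = 2 * j + 1 := by
    intro j hj g hg
    have h4 := (mem_unique_of_chain h2 (show j + 1 ≤ n by omega) hg).2.2.2.1
    simp only [hτ, h4, iX (j + 1) (by omega) g hg, if_false, Bool.false_eq_true]
    push_cast; ring
  have t2 : ∀ j < n, ∀ g ∈ X j, τ (g, true) = 2 * j + 2 := by
    intro j hj g hg
    have h4 := (mem_unique_of_chain h2 hj.le hg).2.2.1
    simp only [hτ, h4, iX j (by omega) g hg, if_false, if_true]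
  have tP : ∀ g ∈ P, τ (g, false) = 0 := by
    intro g hg; simp [hτ, hg]
  have tZ : ∀ g ∈ Z, τ (g, true) = 2 * n + 1 := by
    intro g hg; simp [hτ, hg]
  rw [tagSeen_of_chain h2]
  have tB : ∀ p ∈ taggedBlocks X n, 1 ≤ τ p ∧ τ p ≤ 2 * n := by
    rintro ⟨g, c⟩ hp
    obtain ⟨j, hj, ⟨hc, hg⟩ | ⟨hc, hg⟩⟩ := mem_taggedBlocks hp
    · simp only at hg hc; subst hc; rw [t1 j (by omega) g hg]; omega
    · simp only at hg hc; subst hc; rw [t2 j (by omega) g hg]; omega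
  refine ⟨fun g => i g, n, τ, by omega, ?_, ?_, ?_⟩
  · rw [List.pairwise_append, List.pairwise_append, List.pairwise_map, List.pairwise_map]
    refine ⟨⟨?_, pairwise_taggedBlocks n t1 t2, ?_⟩, ?_, ?_⟩
    · rw [List.pairwise_iff_forall_sublist]
      intro a b hab
      rw [tP a (hab.subset (by simp)), tP b (hab.subset (by simp))]
    · intro p hp q hq
      obtain ⟨g, hg, rfl⟩ := List.mem_map.1 hp
      rw [tP g hg]
      linarith [(tB q hq).1]
    · rw [List.pairwise_iff_forall_sublist]
      intro a b hab
      rw [tZ a (hab.subset (by simp)), tZ b (hab.subset (by simp))]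
    · intro p hp q hq
      obtain ⟨g, hg, rfl⟩ := List.mem_map.1 hq
      rw [tZ g hg]
      rcases List.mem_append.1 hp with hp | hp
      · obtain ⟨k, hk, rfl⟩ := List.mem_map.1 hp
        rw [tP k hk]; omega
      · linarith [(tB p hp).2]
  · intro g hg
    simp only [List.mem_append, List.mem_map, Prod.mk.injEq, Bool.true_eq_false, and_false,
      exists_false, or_false, and_true, exists_eq_right] at hg
    rcases hg with hg | hg
    · left; simp [hg, tP g hg]
    · right
      obtain ⟨j, hj, ⟨-, hg⟩ | ⟨hc, -⟩⟩ := mem_taggedBlocks hg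
      · simp only at hg
        have e := iX (j + 1) (by omega) g hg
        rw [t1 j hj g hg, (mem_left_iff_of_chain h2 (show j + 1 ≤ n by omega) hg).2]
        simp only [e]
        push_cast
        omega
      · simp at hc
  · intro g hg
    simp only [List.mem_append, List.mem_map, Prod.mk.injEq, Bool.false_eq_true, and_false,
      exists_false, false_or, and_true, exists_eq_right] at hg
    rcases hg with hg | hg
    · right
      obtain ⟨j, hj, ⟨hc, -⟩ | ⟨-, hg⟩⟩ := mem_taggedBlocks hg
      · simp at hc
      · simp only at hg
        have e := iX j (by omega) g hg
        rw [t2 j hj g hg, (mem_left_iff_of_chain h2 hj.le hg).1]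
        simp only [e]
        exact ⟨trivial, by positivity, by omega, by norm_cast⟩
    · left; simp [hg, tZ g hg]

end ChainTimes

/-! ### Eight letters suffice to recognise a chain. -/

section ChainHelly

variable {α : Type*} [DecidableEq α]

theorem List.Pairwise.of_idxOf_lt {β : Type*} [BEq β] [LawfulBEq β] {R : β → β → Prop} {l : List β} (h : l.Pairwise R) {p q : β}
    (hp : p ∈ l) (hq : q ∈ l) (hpq : l.idxOf p < l.idxOf q) : R p q := by
  rw [List.pairwise_iff_getElem] at h
  have := h (l.idxOf p) (l.idxOf q) (List.idxOf_lt_length_iff.2 hp)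
    (List.idxOf_lt_length_iff.2 hq) hpq
  simpa using this

theorem List.Nodup.pairwise_of_idxOf {β : Type*} [BEq β] [LawfulBEq β] {R : β → β → Prop} {l : List β} (hl : l.Nodup)
    (h : ∀ p ∈ l, ∀ q ∈ l, l.idxOf p < l.idxOf q → R p q) : l.Pairwise R := by
  rw [List.pairwise_iff_getElem]
  intro i j hi hj hij
  apply h _ (List.getElem_mem _) _ (List.getElem_mem _)
  rwa [hl.idxOf_getElem, hl.idxOf_getElem]

theorem List.pair_sublist_of_idxOf_lt {β : Type*} [BEq β] [LawfulBEq β] {l : List β} {p q : β}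
    (hp : p ∈ l) (hq : q ∈ l) (hpq : l.idxOf p < l.idxOf q) : List.Sublist [p, q] l :=
  (List.pairwise_iff_forall_sublist.2 fun h => h : l.Pairwise fun a b => List.Sublist [a, b] l).of_idxOf_lt
    hp hq hpq

theorem List.Nodup.not_pair_sublist {β : Type*} [BEq β] [LawfulBEq β] {l : List β} (hl : l.Nodup) {p q : β}
    (h1 : List.Sublist [p, q] l) (h2 : List.Sublist [q, p] l) : False := by
  have key : l.Pairwise fun a b => l.idxOf a < l.idxOf b := hl.pairwise_of_idxOf fun _ _ _ _ h => h
  have e1 := List.pairwise_iff_forall_sublist.1 key h1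
  have e2 := List.pairwise_iff_forall_sublist.1 key h2
  omega

/-- The margins P and Z of a chain are not determined by the word. Taking them as large as possible
leaves a middle part whose end letters cannot belong to any margin. -/
theorem exists_strip (p q : α → Prop) [DecidablePred p] [DecidablePred q] (M : List α) :
    ∃ P M0 Z, M = P ++ M0 ++ Z ∧ (∀ g ∈ P, p g) ∧ (∀ g ∈ Z, q g) ∧
      (M0 = [] ∨ ((∃ g t, M0 = g :: t ∧ ¬ p g) ∧ ∃ t g, M0 = t ++ [g] ∧ ¬ q g)) := by
  have step1 : ∃ M1 Z, M = M1 ++ Z ∧ (∀ g ∈ Z, q g) ∧ (M1 = [] ∨ ∃ t g, M1 = t ++ [g] ∧ ¬ q g) := by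
    induction M using List.reverseRecOn with
    | nil => exact ⟨[], [], by simp⟩
    | append_singleton M g ih =>
      by_cases hg : q g
      · obtain ⟨M1, Z, rfl, hZ, h⟩ := ih
        refine ⟨M1, Z ++ [g], by simp, ?_, h⟩
        intro k hk
        rcases List.mem_append.1 hk with hk | hk
        · exact hZ k hk
        · rw [List.mem_singleton] at hk; rwa [hk]
      · exact ⟨M ++ [g], [], by simp, by simp, Or.inr ⟨M, g, rfl, hg⟩⟩
  obtain ⟨M1, Z, rfl, hZ, h⟩ := step1
  have step2 : ∃ P M0, M1 = P ++ M0 ∧ (∀ g ∈ P, p g) ∧ (M0 = [] ∨ ∃ g t, M0 = g :: t ∧ ¬ p g) := by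
    clear h
    induction M1 with
    | nil => exact ⟨[], [], by simp⟩
    | cons g M ih =>
      by_cases hg : p g
      · obtain ⟨P, M0, rfl, hP, h⟩ := ih
        exact ⟨g :: P, M0, by simp, by simp [hg]; exact hP, h⟩
      · exact ⟨[], g :: M, by simp, by simp, Or.inr ⟨g, M, rfl, hg⟩⟩
  obtain ⟨P, M0, rfl, hP, h'⟩ := step2
  refine ⟨P, M0, Z, rfl, hP, hZ, ?_⟩
  rcases h' with rfl | ⟨g, t, rfl, hg⟩
  · exact Or.inl rfl
  · right
    refine ⟨⟨g, t, rfl, hg⟩, ?_⟩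
    rcases h with h | ⟨t', g', e, hg'⟩
    · simp at h
    · rcases List.eq_nil_or_concat (g :: t) with h0 | ⟨t2, g2, e2⟩
      · simp at h0
      · rw [List.concat_eq_append] at e2
        rw [e2] at e ⊢
        rw [← List.append_assoc] at e
        have := List.append_inj_right' e rfl
        simp only [List.cons.injEq, and_true] at this
        exact ⟨t2, g2, rfl, this ▸ hg'⟩

theorem List.eq_filter_append_of_pairwise {β : Type*} {key : β → ℤ} {l : List β} (c : ℤ)
    (h : l.Pairwise fun p q => key p ≤ key q) :
    l = l.filter (fun p => key p ≤ c) ++ l.filter (fun p => c < key p) := by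
  induction l with
  | nil => rfl
  | cons a l ih =>
    rw [List.pairwise_cons] at h
    by_cases ha : key a ≤ c
    · rw [List.filter_cons_of_pos (by simpa using ha), List.filter_cons_of_neg (by simpa using ha),
        List.cons_append, ← ih h.2]
    · rw [List.filter_cons_of_neg (by simpa using ha), List.filter_cons_of_pos (by simpa using ha),
        (List.filter_eq_nil_iff (l := l)).2, List.nil_append, List.filter_eq_self.2]
      · intro b hb
        have := h.1 b hb
        simp only [decide_eq_true_eq]; omega
      · intro b hb
        have := h.1 b hb
        simp only [decide_eq_true_eq]; omega

/-- A sorted list is the concatenation of its level sets, by splitting off the highest level. -/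
theorem List.eq_flatMap_of_pairwise {β : Type*} {key : β → ℤ} {l : List β} (m : ℕ)
    (h : l.Pairwise fun p q => key p ≤ key q) (hr : ∀ p ∈ l, 1 ≤ key p ∧ key p ≤ m) :
    l = (List.range m).flatMap fun t : ℕ => l.filter fun p => key p = (t : ℤ) + 1 := by
  induction m generalizing l with
  | zero =>
    rw [(List.eq_nil_iff_forall_not_mem (l := l)).2]
    · rfl
    · intro p hp
      have := hr p hp
      omega
  | succ m ih =>
    conv_lhs => rw [List.eq_filter_append_of_pairwise m h]
    rw [List.range_succ, List.flatMap_append, ih (h.filter _)]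
    · congr 1
      · apply List.flatMap_congr
        intro t ht
        rw [List.mem_range] at ht
        rw [List.filter_filter]
        apply List.filter_congr
        intro p _
        rw [← Bool.decide_and]
        apply decide_eq_decide.2
        omega
      · simp only [List.flatMap_cons, List.flatMap_nil, List.append_nil]
        apply List.filter_congr
        intro p hp
        have := hr p hp
        apply decide_eq_decide.2
        push_cast at this
        omega
    · intro p hp
      rw [List.mem_filter, decide_eq_true_eq] at hp
      exact ⟨(hr p hp.1).1, hp.2⟩

theorem List.range_two_mul_flatMap {β : Type*} (f : ℕ → List β) (n : ℕ) :
    (List.range (2 * n)).flatMap f = (List.range n).flatMap fun j => f (2 * j) ++ f (2 * j + 1) := by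
  induction n with
  | zero => rfl
  | succ n ih =>
    rw [show 2 * (n + 1) = 2 * n + 1 + 1 by ring, List.range_succ, List.range_succ,
      List.range_succ (n := n)]
    simp [List.flatMap_append, ih]

/-- A list of occurrences ordered by block indices is a chain of blocks. -/
theorem exists_chainBlocks {T0 : List (α × Bool)} {i : α → ℤ} {n : ℕ}
    (hs : T0.Pairwise fun p q => (if p.2 then 2 * i p.1 + 2 else 2 * i p.1 - 1) ≤
      (if q.2 then 2 * i q.1 + 2 else 2 * i q.1 - 1))
    (hr : ∀ p ∈ T0, 1 ≤ (if p.2 then 2 * i p.1 + 2 else 2 * i p.1 - 1) ∧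
      (if p.2 then 2 * i p.1 + 2 else 2 * i p.1 - 1) ≤ 2 * n)
    (hB : ∀ m : ℤ, 1 ≤ m → m < n → (T0.filter fun p => !p.2 && decide (i p.1 = m)).map Prod.fst =
      (T0.filter fun p => p.2 && decide (i p.1 = m)).map Prod.fst) :
    T0.map Prod.fst = chainBlocks (fun j =>
      if j = n then (T0.filter fun p => !p.2 && decide (i p.1 = n)).map Prod.fst
      else (T0.filter fun p => p.2 && decide (i p.1 = j)).map Prod.fst) n := by
  conv_lhs => rw [List.eq_flatMap_of_pairwise (2 * n) hs (by exact_mod_cast hr)]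
  -- Level 2j + 1 consists of the first copies of block j + 1, level 2j + 2 of the second copies of
  -- block j.
  rw [List.range_two_mul_flatMap, List.map_flatMap, chainBlocks]
  apply List.flatMap_congr
  intro j hj
  rw [List.mem_range] at hj
  rw [List.map_append]
  congr 1
  · have : (T0.filter fun p => decide ((if p.2 = true then 2 * i p.1 + 2 else 2 * i p.1 - 1) =
        ((2 * j : ℕ) : ℤ) + 1)) = T0.filter fun p => !p.2 && decide (i p.1 = ((j + 1 : ℕ) : ℤ)) := by
      apply List.filter_congr
      rintro ⟨g, c⟩ _
      cases c <;> simp <;> omega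
    rw [this]
    split_ifs with h
    · rw [h]
    · exact hB _ (by omega) (by omega)
  · rw [if_neg (by omega)]
    congr 1
    apply List.filter_congr
    rintro ⟨g, c⟩ _
    cases c <;> simp <;> omega

/-- A word has the form of a chain as soon as its restrictions to any eight letters have. -/
theorem hasChain_of_filter {L M R : List α} (h2 : ∀ g, L.count g + M.count g + R.count g ≤ 2)
    (h : ∀ S : Finset α, S.card ≤ 8 →
      HasChain (L.filter (· ∈ S)) (M.filter (· ∈ S)) (R.filter (· ∈ S))) :
    HasChain L M R := by
  have h2S : ∀ S : Finset α, ∀ g, (L.filter (· ∈ S)).count g + (M.filter (· ∈ S)).count g +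
      (R.filter (· ∈ S)).count g ≤ 2 := by
    intro S g
    have := h2 g
    have a1 := (List.filter_sublist (p := (· ∈ S)) (l := L)).count_le g
    have a2 := (List.filter_sublist (p := (· ∈ S)) (l := M)).count_le g
    have a3 := (List.filter_sublist (p := (· ∈ S)) (l := R)).count_le g
    omega
  have memS : ∀ (S : Finset α) (A : List α) g, g ∈ S → (g ∈ A.filter (· ∈ S) ↔ g ∈ A) := by
    intro S A g hg; simp [hg]
  -- The conditions `suf`, `pre` and `fs` on the order of letters concern two letters at a time, so
  -- they pass from restrictions to the whole word. What remains is the global choice of block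
  -- indices.
  have suf : M.filter (· ∈ L) <:+ L := by
    apply List.suffix_of_filter_suffix
    intro S hS
    have := (h S (by omega)).suffix_left (h2S S)
    rw [List.filter_filter] at this ⊢
    convert this using 1
    apply List.filter_congr
    intro g _
    by_cases hg : g ∈ S <;> simp [hg]
  have pre : M.filter (· ∈ R) <+: R := by
    apply List.prefix_of_filter_prefix
    intro S hS
    have := (h S (by omega)).prefix_right (h2S S)
    rw [List.filter_filter] at this ⊢
    convert this using 1
    apply List.filter_congr
    intro g _
    by_cases hg : g ∈ S <;> simp [hg]
  have fs : ((tagSeen L M).filter fun x => !x.2 && decide (x.1 ∉ R)).map Prod.fst =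
      ((tagSeen L M).filter fun x => x.2 && decide (x.1 ∉ L)).map Prod.fst := by
    apply List.eq_of_filter_eq
    intro S hS
    have := (h S (by omega)).firsts_eq_seconds (h2S S)
    rw [← tagSeen_filter, List.filter_filter, List.filter_filter] at this
    rw [List.filter_map, List.filter_map, List.filter_filter, List.filter_filter]
    convert this using 2
    · apply List.filter_congr
      intro p _
      by_cases hg : p.1 ∈ S <;> simp [hg]
    · apply List.filter_congr
      intro p _
      by_cases hg : p.1 ∈ S <;> simp [hg]
  obtain ⟨P, M0, Z, rfl, hP, hZ, hM0⟩ := exists_strip (· ∈ R) (· ∈ L) M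
  have cP : ∀ g ∈ P, g ∉ L ∧ g ∉ M0 ∧ g ∉ Z ∧ P.count g = 1 := by
    intro g hg
    have := h2 g
    have e1 := List.count_pos_iff.2 hg
    have e2 := List.count_pos_iff.2 (hP g hg)
    simp only [List.count_append] at this
    refine ⟨fun h' => ?_, fun h' => ?_, fun h' => ?_, by omega⟩ <;>
    · have := List.count_pos_iff.2 h'; omega
  have cZ : ∀ g ∈ Z, g ∉ R := by
    intro g hg h'
    have := h2 g
    have e1 := List.count_pos_iff.2 hg
    have e2 := List.count_pos_iff.2 (hZ g hg)
    simp only [List.count_append] at this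
    have := List.count_pos_iff.2 h'; omega
  have cM : ∀ g ∈ M0, g ∈ L → g ∉ R := by
    intro g hg hL hR
    have := h2 g
    have e1 := List.count_pos_iff.2 hg
    have e2 := List.count_pos_iff.2 hL
    have e3 := List.count_pos_iff.2 hR
    simp only [List.count_append] at this
    omega
  have eL : (P ++ M0 ++ Z).filter (· ∈ L) = M0.filter (· ∈ L) ++ Z := by
    rw [List.filter_append, List.filter_append, (List.filter_eq_nil_iff (l := P)).2,
      (List.filter_eq_self (l := Z)).2 (by simpa using hZ)]
    · rfl
    · intro g hg; simpa using (cP g hg).1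
  have eR : (P ++ M0 ++ Z).filter (· ∈ R) = P ++ M0.filter (· ∈ R) := by
    rw [List.filter_append, List.filter_append, (List.filter_eq_nil_iff (l := Z)).2,
      (List.filter_eq_self (l := P)).2 (by simpa using hP), List.append_nil]
    intro g hg; simpa using cZ g hg
  rw [eL] at suf
  rw [eR] at pre
  obtain ⟨l, suf⟩ := suf
  obtain ⟨r, pre⟩ := pre
  rcases hM0 with rfl | ⟨⟨q1, t1, hq1, hq1R⟩, t2, q2, hq2, hq2L⟩
  · refine ⟨2, fun _ => [], Z, P, l, r, le_rfl, ?_, ?_, ?_⟩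
    · rw [← suf]; simp
    · simp [chainBlocks]
    · rw [← pre]; simp
  have eT : tagSeen L (P ++ M0 ++ Z) =
      P.map (fun g => (g, false)) ++ tagSeen L M0 ++ Z.map fun g => (g, true) := by
    rw [tagSeen_append, tagSeen_append, tagSeen_of_disjoint (A := P),
      tagSeen_of_subset (A := Z), tagSeen_congr (s' := L) (M := M0)]
    · intro g hg
      rw [List.mem_append, or_iff_left]
      intro h'; exact (cP g h').2.1 hg
    · intro g hg; simp [hZ g hg]
    · intro g hg; exact (cP g hg).1
    · rw [List.nodup_iff_count_eq_one]; intro g hg; exact (cP g hg).2.2.2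
  set T0 := tagSeen L M0 with hT0
  have cF : ∀ g, T0.count (g, false) = if g ∈ L then 0 else min 1 (M0.count g) :=
    fun g => (count_tagSeen L M0 g).1
  have cS : ∀ g, T0.count (g, true) = if g ∈ L then M0.count g else M0.count g - 1 :=
    fun g => (count_tagSeen L M0 g).2
  have fst_mem : ∀ p ∈ T0, p.1 ∈ M0 := by
    intro p hp
    rw [← tagSeen_map_fst L M0]
    exact List.mem_map_of_mem hp
  have memF : ∀ g, (g, false) ∈ T0 ↔ g ∈ M0 ∧ g ∉ L := by
    intro g
    rw [← List.count_pos_iff, cF, ← List.count_pos_iff (l := M0)]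
    split_ifs with hg <;> simp [hg]
  have hTnd : T0.Nodup := by
    rw [List.nodup_iff_count_le_one]
    rintro ⟨g, c⟩
    have hg2 := h2 g
    simp only [List.count_append] at hg2
    cases c
    · rw [cF]; split_ifs <;> omega
    · rw [cS]; split_ifs with hg
      · have := List.count_pos_iff.2 hg; omega
      · omega
  have fs0 : (T0.filter fun x => !x.2 && decide (x.1 ∉ R)).map Prod.fst =
      (T0.filter fun x => x.2 && decide (x.1 ∉ L)).map Prod.fst := by
    rw [eT] at fs
    simp only [List.filter_append, List.filter_map] at fs
    rw [(List.filter_eq_nil_iff (l := P)).2, (List.filter_eq_nil_iff (l := Z)).2,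
      (List.filter_eq_nil_iff (l := P)).2, (List.filter_eq_nil_iff (l := Z)).2] at fs
    · simpa using fs
    · intro g hg; simp [hZ g hg]
    · simp
    · simp
    · intro g hg; simp [hP g hg]
  have memT : ∀ g, (g, true) ∈ T0 ↔ g ∈ M0 ∧ g ∉ R := by
    intro g
    constructor
    · intro hg
      refine ⟨fst_mem _ hg, fun hR => ?_⟩
      have hg2 := h2 g
      simp only [List.count_append] at hg2
      have e1 := List.count_pos_iff.2 hg
      have e2 := List.count_pos_iff.2 hR
      rw [cS] at e1
      split_ifs at e1 with hL
      · have := List.count_pos_iff.2 hL; omega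
      · omega
    · rintro ⟨hg, hR⟩
      by_cases hL : g ∈ L
      · rw [← List.count_pos_iff, cS, if_pos hL]
        exact List.count_pos_iff.2 hg
      · have : g ∈ (T0.filter fun x => !x.2 && decide (x.1 ∉ R)).map Prod.fst := by
          rw [List.mem_map]
          exact ⟨(g, false), by rw [List.mem_filter]; simp [memF, hg, hL, hR], rfl⟩
        rw [fs0, List.mem_map] at this
        obtain ⟨⟨k, c⟩, hk, rfl⟩ := this
        rw [List.mem_filter] at hk
        simp only [Bool.and_eq_true, decide_eq_true_eq] at hk
        rw [← hk.2.1]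
        exact hk.1
  have idx_inj : ∀ p ∈ T0, ∀ q ∈ T0, T0.idxOf p = T0.idxOf q → p = q :=
    fun p hp q _ h => (List.idxOf_inj hp).1 h
  obtain ⟨N, hN⟩ : ∃ N : ℤ, N = (T0.length : ℤ) := ⟨_, rfl⟩
  have idx_lt : ∀ p ∈ T0, (T0.idxOf p : ℤ) < N := fun p hp => by
    rw [hN]; exact_mod_cast List.idxOf_lt_length_iff.2 hp
  -- A letter of L has its first occurrence outside M0; it gets a fictitious position below the
  -- marker -1, in the order in which these letters occur in M0. Likewise second occurrences in R
  -- lie above the marker N.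
  set f : α → ℤ := fun g => if g ∈ L then (T0.idxOf (g, true) : ℤ) - (N + 1)
    else T0.idxOf (g, false) with hf
  set s : α → ℤ := fun g => if g ∈ R then (T0.idxOf (g, false) : ℤ) + (N + 1)
    else T0.idxOf (g, true) with hs
  have fL : ∀ g ∈ L, f g = (T0.idxOf (g, true) : ℤ) - (N + 1) := fun g hg => if_pos hg
  have fnL : ∀ g ∉ L, f g = T0.idxOf (g, false) := fun g hg => if_neg hg
  have sR : ∀ g ∈ R, s g = (T0.idxOf (g, false) : ℤ) + (N + 1) := fun g hg => if_pos hg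
  have snR : ∀ g ∉ R, s g = T0.idxOf (g, true) := fun g hg => if_neg hg
  -- every occurrence has a position
  have posL : ∀ g ∈ M0, g ∈ L → g ∉ R ∧ (g, true) ∈ T0 ∧
      f g = (T0.idxOf (g, true) : ℤ) - (N + 1) ∧ s g = T0.idxOf (g, true) ∧
      (T0.idxOf (g, true) : ℤ) < N := fun g hg hL =>
    ⟨cM g hg hL, (memT g).2 ⟨hg, cM g hg hL⟩, fL g hL, snR g (cM g hg hL),
      idx_lt _ ((memT g).2 ⟨hg, cM g hg hL⟩)⟩
  have posR : ∀ g ∈ M0, g ∈ R → g ∉ L ∧ (g, false) ∈ T0 ∧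
      f g = T0.idxOf (g, false) ∧ s g = (T0.idxOf (g, false) : ℤ) + (N + 1) ∧
      (T0.idxOf (g, false) : ℤ) < N := fun g hg hR => by
    have hL : g ∉ L := fun hL => cM g hg hL hR
    exact ⟨hL, (memF g).2 ⟨hg, hL⟩, fnL g hL, sR g hR, idx_lt _ ((memF g).2 ⟨hg, hL⟩)⟩
  have posB : ∀ g ∈ M0, g ∉ L → g ∉ R → (g, false) ∈ T0 ∧ (g, true) ∈ T0 ∧
      f g = T0.idxOf (g, false) ∧ s g = T0.idxOf (g, true) ∧
      (T0.idxOf (g, false) : ℤ) < N ∧ (T0.idxOf (g, true) : ℤ) < N := fun g hg hL hR =>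
    ⟨(memF g).2 ⟨hg, hL⟩, (memT g).2 ⟨hg, hR⟩, fnL g hL, snR g hR,
      idx_lt _ ((memF g).2 ⟨hg, hL⟩), idx_lt _ ((memT g).2 ⟨hg, hR⟩)⟩
  have q1M : q1 ∈ M0 := by rw [hq1]; simp
  have q2M : q2 ∈ M0 := by rw [hq2]; simp
  obtain ⟨p1, hp1, hp1min⟩ : ∃ p1 ∈ T0, p1.1 = q1 ∧ ∀ p ∈ T0, p = p1 ∨
      T0.idxOf p1 < T0.idxOf p := by
    have : T0 = (q1, decide (q1 ∈ L)) :: tagSeen (q1 :: L) t1 := by rw [hT0, hq1]; rfl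
    refine ⟨(q1, decide (q1 ∈ L)), by rw [this]; simp, rfl, fun p hp => ?_⟩
    by_cases hpe : p = (q1, decide (q1 ∈ L))
    · exact Or.inl hpe
    · right
      rw [this, List.idxOf_cons_self, List.idxOf_cons_ne _ (fun h => hpe h.symm)]
      omega
  obtain ⟨p2, hp2, hp2max⟩ : ∃ p2 ∈ T0, p2.1 = q2 ∧ ∀ p ∈ T0, p = p2 ∨
      T0.idxOf p < T0.idxOf p2 := by
    have e : T0 = tagSeen L t2 ++ [(q2, decide (q2 ∈ L ++ t2))] := by
      rw [hT0, hq2, tagSeen_append]; rfl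
    set p2 := (q2, decide (q2 ∈ L ++ t2)) with hp2
    refine ⟨p2, by rw [e]; simp, rfl, fun p hp => ?_⟩
    rw [e] at hTnd hp ⊢
    have hnot : p2 ∉ tagSeen L t2 := fun h => by
      rw [List.nodup_append] at hTnd
      exact hTnd.2.2 p2 h p2 (by simp) rfl
    rcases List.mem_append.1 hp with hp | hp
    · right
      rw [List.idxOf_append_of_mem hp, List.idxOf_append_of_notMem hnot]
      have := List.idxOf_lt_length_iff.2 hp
      omega
    · left; simpa using hp
  have idxne : ∀ g h, (g, true) ∈ T0 → (h, false) ∈ T0 →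
      T0.idxOf (g, true) ≠ T0.idxOf (h, false) := fun g h hg hh e => by
    simpa using idx_inj _ hg _ hh e
  have hloc : ∀ S ⊆ M0.toFinset, S.card ≤ 6 → ∃ i n, IsBlockIndex f s (-1) N S i n := by
    intro S hSM hS
    have hSM' : ∀ g ∈ S, g ∈ M0 := fun g hg => List.mem_toFinset.1 (hSM hg)
    -- The end letters q1 and q2 of M0 are added: they keep the letters of S from being taken into
    -- the margins of the local chain. This is why eight letters are needed and not six.
    set S' : Finset α := insert q1 (insert q2 S) with hS'
    have hcard : S'.card ≤ 8 := by
      rw [hS']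
      have := Finset.card_insert_le q1 (insert q2 S)
      have := Finset.card_insert_le q2 S
      omega
    obtain ⟨i, n, τ, hn, hpw, hFi, hSe⟩ := (h S' hcard).exists_time (h2S S')
    rw [← tagSeen_filter, eT] at hpw
    rw [← tagSeen_filter, eT] at hFi hSe
    have hpw0 : (T0.filter fun p => decide (p.1 ∈ S')).Pairwise fun p q => τ p ≤ τ q := by
      rw [List.filter_append, List.filter_append] at hpw
      exact ((List.pairwise_append.1 hpw).1 |> List.pairwise_append.1).2.1
    rw [List.pairwise_filter] at hpw0
    have ord : ∀ p ∈ T0, ∀ q ∈ T0, p.1 ∈ S' → q.1 ∈ S' → T0.idxOf p ≤ T0.idxOf q →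
        τ p ≤ τ q := by
      intro p hp q hq hpS hqS hle
      rcases hle.lt_or_eq with hlt | heq
      · exact hpw0.of_idxOf_lt hp hq hlt (by simpa using hpS) (by simpa using hqS)
      · rw [idx_inj p hp q hq heq]
    have hq1S : q1 ∈ S' := by simp [hS']
    have hq2S : q2 ∈ S' := by simp [hS']
    have hFi' : ∀ g ∈ S', (g, false) ∈ T0 → (g ∈ R ∧ τ (g, false) = 0) ∨
        (τ (g, false) = 2 * i g - 1 ∧ 1 ≤ i g ∧ i g ≤ n ∧ (g ∈ R ↔ i g = n)) := by
      intro g hgS hg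
      have := hFi g (by rw [List.mem_filter]; simp [hg, hgS])
      rwa [memS S' R g hgS] at this
    have hSe' : ∀ g ∈ S', (g, true) ∈ T0 → (g ∈ L ∧ τ (g, true) = 2 * n + 1) ∨
        (τ (g, true) = 2 * i g + 2 ∧ 0 ≤ i g ∧ i g + 1 ≤ n ∧ (g ∈ L ↔ i g = 0)) := by
      intro g hgS hg
      have := hSe g (by rw [List.mem_filter]; simp [hg, hgS])
      rwa [memS S' L g hgS] at this
    -- Time 0 is reserved for letters of R. The first entry of M0 is not in R, so its time is at
    -- least 1, and all later times are too.
    have lower : ∀ p ∈ T0, p.1 ∈ S' → 1 ≤ τ p := by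
      have e1 : 1 ≤ τ p1 := by
        obtain ⟨g, c⟩ := p1
        simp only at hp1min
        obtain ⟨rfl, -⟩ := hp1min
        cases c
        · rcases hFi' g hq1S hp1 with h' | h'
          · exact absurd h'.1 hq1R
          · omega
        · rcases hSe' g hq1S hp1 with h' | h' <;> omega
      intro p hp hpS
      rcases hp1min.2 p hp with rfl | hlt
      · exact e1
      · exact e1.trans (ord p1 hp1 p hp (by rw [hp1min.1]; exact hq1S) hpS hlt.le)
    -- Dually, time 2n + 1 is reserved for letters of L, and the last entry of M0 is not in L.
    have upper : ∀ p ∈ T0, p.1 ∈ S' → τ p ≤ 2 * n := by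
      have e1 : τ p2 ≤ 2 * n := by
        obtain ⟨g, c⟩ := p2
        simp only at hp2max
        obtain ⟨rfl, -⟩ := hp2max
        cases c
        · rcases hFi' g hq2S hp2 with h' | h' <;> omega
        · rcases hSe' g hq2S hp2 with h' | h'
          · exact absurd h'.1 hq2L
          · omega
      intro p hp hpS
      rcases hp2max.2 p hp with rfl | hlt
      · exact e1
      · exact (ord p hp p2 hp2 hpS (by rw [hp2max.1]; exact hq2S) hlt.le).trans e1
    have inS' : ∀ g ∈ S, g ∈ S' := fun g hg => by simp [hS', hg]
    have vF : ∀ g ∈ S, (g, false) ∈ T0 →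
        τ (g, false) = 2 * i g - 1 ∧ 1 ≤ i g ∧ i g ≤ n ∧ (g ∈ R ↔ i g = n) := by
      intro g hgS hg
      rcases hFi' g (inS' g hgS) hg with h' | h'
      · have := lower _ hg (inS' g hgS); omega
      · exact h'
    have vS : ∀ g ∈ S, (g, true) ∈ T0 →
        τ (g, true) = 2 * i g + 2 ∧ 0 ≤ i g ∧ i g + 1 ≤ n ∧ (g ∈ L ↔ i g = 0) := by
      intro g hgS hg
      rcases hSe' g (inS' g hgS) hg with h' | h'
      · have := upper _ hg (inS' g hgS); omega
      · exact h'
    have iL : ∀ g ∈ S, g ∈ L → i g = 0 := fun g hg hL =>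
      (vS g hg (posL g (hSM' g hg) hL).2.1).2.2.2.1 hL
    have inL : ∀ g ∈ S, g ∉ L → 1 ≤ i g := fun g hg hL =>
      (vF g hg ((memF g).2 ⟨hSM' g hg, hL⟩)).2.1
    have iR : ∀ g ∈ S, g ∈ R → i g = n := fun g hg hR =>
      (vF g hg (posR g (hSM' g hg) hR).2.1).2.2.2.1 hR
    have inR : ∀ g ∈ S, g ∉ R → i g + 1 ≤ n := fun g hg hR =>
      (vS g hg ((memT g).2 ⟨hSM' g hg, hR⟩)).2.2.1
    have i0 : ∀ g ∈ S, 0 ≤ i g := fun g hg => by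
      by_cases hL : g ∈ L
      · rw [iL g hg hL]
      · have := inL g hg hL; omega
    have iN : ∀ g ∈ S, i g ≤ n := fun g hg => by
      by_cases hR : g ∈ R
      · rw [iR g hg hR]
      · have := inR g hg hR; omega
    have fneg : ∀ g ∈ S, f g < 0 ↔ g ∈ L := fun g hg => by
      by_cases hL : g ∈ L
      · have := posL g (hSM' g hg) hL; simp only [hL, iff_true]; omega
      · simp only [hL, iff_false]; rw [fnL g hL]; omega
    have sbig : ∀ g ∈ S, N ≤ s g ↔ g ∈ R := fun g hg => by
      by_cases hR : g ∈ R
      · have := posR g (hSM' g hg) hR; simp only [hR, iff_true]; omega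
      · have := idx_lt _ ((memT g).2 ⟨hSM' g hg, hR⟩)
        simp only [hR, iff_false]; rw [snR g hR]; omega
    refine ⟨i, n, hn, ?_, ?_, ?_, ?_, ?_, ?_, ?_, ?_⟩
    · intro g hg hlt
      exact iL g hg ((fneg g hg).1 (by omega))
    · intro g hg hlt
      exact inL g hg fun hL => by have := (fneg g hg).2 hL; have := posL g (hSM' g hg) hL; omega
    · intro g hg hlt
      exact iR g hg ((sbig g hg).1 hlt.le)
    · intro g hg hlt
      exact inR g hg fun hR => by have := (sbig g hg).2 hR; omega
    · intro g hg k hk hle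
      by_cases hL : g ∈ L
      · rw [iL g hg hL]; exact i0 k hk
      · have hkL : k ∉ L := fun hkL => by
          have := (fneg k hk).2 hkL
          exact hL ((fneg g hg).1 (by omega))
        rw [fnL g hL, fnL k hkL] at hle
        have mg := (memF g).2 ⟨hSM' g hg, hL⟩
        have mk := (memF k).2 ⟨hSM' k hk, hkL⟩
        have := ord _ mg _ mk (inS' g hg) (inS' k hk) (by omega)
        rw [(vF g hg mg).1, (vF k hk mk).1] at this
        omega
    · intro g hg k hk hle
      by_cases hR : k ∈ R
      · rw [iR k hk hR]; exact iN g hg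
      · have hgR : g ∉ R := fun hgR => by
          have := (sbig g hg).2 hgR
          exact hR ((sbig k hk).1 (by omega))
        rw [snR g hgR, snR k hR] at hle
        have mg := (memT g).2 ⟨hSM' g hg, hgR⟩
        have mk := (memT k).2 ⟨hSM' k hk, hR⟩
        have := ord _ mg _ mk (inS' g hg) (inS' k hk) (by omega)
        rw [(vS g hg mg).1, (vS k hk mk).1] at this
        omega
    · intro g hg k hk hlt
      have hkL : k ∉ L := fun hkL => by
        have := (fneg k hk).2 hkL
        have : 0 ≤ s g := by simp only [hs]; split_ifs <;> omega
        omega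
      have mk := (memF k).2 ⟨hSM' k hk, hkL⟩
      have hgR : g ∉ R := fun hgR => by
        have := (sbig g hg).2 hgR
        have := idx_lt _ mk
        rw [fnL k hkL] at hlt
        omega
      have mg := (memT g).2 ⟨hSM' g hg, hgR⟩
      rw [snR g hgR, fnL k hkL] at hlt
      have := ord _ mg _ mk (inS' g hg) (inS' k hk) (by omega)
      rw [(vS g hg mg).1, (vF k hk mk).1] at this
      omega
    · intro g hg k hk hlt
      by_cases hkL : k ∈ L
      · rw [iL k hk hkL]; have := i0 g hg; omega
      by_cases hgR : g ∈ R
      · rw [iR g hg hgR]; have := iN k hk; omega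
      have mk := (memF k).2 ⟨hSM' k hk, hkL⟩
      have mg := (memT g).2 ⟨hSM' g hg, hgR⟩
      rw [snR g hgR, fnL k hkL] at hlt
      have := ord _ mk _ mg (inS' k hk) (inS' g hg) (by omega)
      rw [(vS g hg mg).1, (vF k hk mk).1] at this
      omega
  have nd_of_bool : ∀ (c : Bool) (p : α × Bool → Bool), (∀ x, p x → x.2 = c) →
      ((T0.filter p).map Prod.fst).Nodup := by
    intro c p hp
    refine (hTnd.filter _).map_on ?_
    rintro ⟨g, c1⟩ h1 ⟨k, c2⟩ h2 rfl
    rw [List.mem_filter] at h1 h2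
    have e1 := hp _ h1.2
    have e2 := hp _ h2.2
    simp only at e1 e2
    rw [e1, e2]
  -- Otherwise g, k and k, g would both be sublists of the common list of firsts and seconds, which
  -- has no repetitions.
  have fifoB : ∀ g ∈ M0, ∀ k ∈ M0, g ∉ L → g ∉ R → k ∉ L → k ∉ R →
      T0.idxOf (g, false) < T0.idxOf (k, false) → T0.idxOf (g, true) < T0.idxOf (k, true) := by
    intro g hg k hk hgL hgR hkL hkR hlt
    by_contra hc
    have mg := posB g hg hgL hgR
    have mk := posB k hk hkL hkR
    have hlt' : T0.idxOf (k, true) < T0.idxOf (g, true) := by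
      refine lt_of_le_of_ne (not_lt.1 hc) fun e => ?_
      have := idx_inj _ mk.2.1 _ mg.2.1 e
      simp only [Prod.mk.injEq, and_true] at this
      rw [this] at hlt
      exact lt_irrefl _ hlt
    have s1 := ((List.pair_sublist_of_idxOf_lt mg.1 mk.1 hlt).filter
      (fun x => !x.2 && decide (x.1 ∉ R))).map Prod.fst
    have s2 := ((List.pair_sublist_of_idxOf_lt mk.2.1 mg.2.1 hlt').filter
      (fun x => x.2 && decide (x.1 ∉ L))).map Prod.fst
    rw [← fs0] at s2
    simp only [hgR, hkR, hgL, hkL, not_false_eq_true, decide_true, Bool.and_true, Bool.not_false,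
      List.filter_cons_of_pos, List.filter_nil, List.map_cons, List.map_nil] at s1 s2
    exact (nd_of_bool false _ (by simp +contextual)).not_pair_sublist s1 s2
  have pairIndex : ∀ g ∈ M0, ∀ k ∈ M0, ∃ i n, IsBlockIndex f s (-1) N {g, k} i n := by
    intro g hg k hk
    apply hloc
    · intro x hx
      simp only [Finset.mem_insert, Finset.mem_singleton] at hx
      rw [List.mem_toFinset]
      rcases hx with rfl | rfl <;> assumption
    · exact Finset.card_le_two.trans (by norm_num)
  have key := exists_isBlockIndex (f := f) (s := s) (a := -1) (b := N) (D := M0.toFinset) hloc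
    ?_ ?_ ?_ ?_ ?_ ?_ ?_ ?_
  · obtain ⟨i, n, I⟩ := key
    obtain ⟨m, rfl⟩ := Int.eq_ofNat_of_zero_le (show 0 ≤ n by have := I.two_le; omega)
    have hm2 : 2 ≤ m := by exact_mod_cast I.two_le
    have mD : ∀ g ∈ M0, g ∈ M0.toFinset := fun g hg => List.mem_toFinset.2 hg
    have iL : ∀ g ∈ M0, g ∈ L → i g = 0 := fun g hg hL =>
      I.eq_zero g (mD g hg) (by have := posL g hg hL; omega)
    have inL : ∀ g ∈ M0, g ∉ L → 1 ≤ i g := fun g hg hL =>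
      I.one_le g (mD g hg) (by rw [fnL g hL]; omega)
    have iR : ∀ g ∈ M0, g ∈ R → i g = m := fun g hg hR =>
      I.eq_last g (mD g hg) (by have := posR g hg hR; omega)
    have inR : ∀ g ∈ M0, g ∉ R → i g + 1 ≤ m := fun g hg hR =>
      I.lt_last g (mD g hg) (by rw [snR g hR]; exact idx_lt _ ((memT g).2 ⟨hg, hR⟩))
    have i0 : ∀ g ∈ M0, 0 ≤ i g := fun g hg => by
      by_cases hL : g ∈ L
      · rw [iL g hg hL]
      · have := inL g hg hL; omega
    have iN : ∀ g ∈ M0, i g ≤ m := fun g hg => by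
      by_cases hR : g ∈ R
      · rw [iR g hg hR]
      · have := inR g hg hR; omega
    have notL : ∀ g, (g, false) ∈ T0 → g ∉ L := fun g hg => ((memF g).1 hg).2
    have notR : ∀ g, (g, true) ∈ T0 → g ∉ R := fun g hg => ((memT g).1 hg).2
    -- The blocks are the level sets of the global index. Block 0 is read off from letters of L and
    -- block m from letters of R, which match L and R through `suf` and `pre`.
    have chain := exists_chainBlocks (T0 := T0) (i := i) (n := m) ?_ ?_ ?_
    · rw [tagSeen_map_fst] at chain
      have em : ∀ p : α → Bool, M0.filter p = (T0.filter fun x => p x.1).map Prod.fst := by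
        intro p
        conv_lhs => rw [← tagSeen_map_fst L M0, List.filter_map]
        rfl
      refine ⟨m, _, Z, P, l, r, hm2, ?_, by rw [← chain], ?_⟩
      · rw [← suf, if_neg (by omega), em, List.append_assoc]
        congr 3
        apply List.filter_congr
        rintro ⟨g, c⟩ hp
        have hg := fst_mem _ hp
        cases c
        · simp [notL g hp]
        · simp only [Bool.true_and, decide_eq_decide, Nat.cast_zero]
          exact ⟨iL g hg, fun h0 => by_contra fun hL => by have := inL g hg hL; omega⟩
      · rw [← pre, if_pos rfl, em]
        congr 3
        apply List.filter_congr
        rintro ⟨g, c⟩ hp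
        have hg := fst_mem _ hp
        cases c
        · simp only [Bool.true_and, Bool.not_false, decide_eq_decide]
          exact ⟨iR g hg, fun h0 => by_contra fun hR => by have := inR g hg hR; omega⟩
        · simp [notR g hp]
    · apply hTnd.pairwise_of_idxOf
      rintro ⟨g, c⟩ hp ⟨k, d⟩ hq hlt
      have hg := fst_mem _ hp
      have hk := fst_mem _ hq
      simp only at hg hk
      cases c <;> cases d <;> simp only [if_true, Bool.false_eq_true, if_false]
      · have := I.mono_first g (mD g hg) k (mD k hk) (by
          rw [fnL g (notL g hp), fnL k (notL k hq)]; exact_mod_cast hlt.le)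
        change 2 * i g - 1 ≤ 2 * i k - 1
        omega
      · have := I.near k (mD k hk) g (mD g hg) (by
          rw [fnL g (notL g hp), snR k (notR k hq)]; exact_mod_cast hlt)
        change 2 * i g - 1 ≤ 2 * i k + 2
        omega
      · have := I.far g (mD g hg) k (mD k hk) (by
          rw [snR g (notR g hp), fnL k (notL k hq)]; exact_mod_cast hlt)
        change 2 * i g + 2 ≤ 2 * i k - 1
        omega
      · have := I.mono_second g (mD g hg) k (mD k hk) (by
          rw [snR g (notR g hp), snR k (notR k hq)]; exact_mod_cast hlt.le)
        change 2 * i g + 2 ≤ 2 * i k + 2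
        omega
    · rintro ⟨g, c⟩ hp
      have hg := fst_mem _ hp
      have := i0 g hg
      have := iN g hg
      cases c <;> simp only [if_true, Bool.false_eq_true, if_false]
      · have := inL g hg (notL g hp)
        omega
      · have := inR g hg (notR g hp)
        omega
    · intro m' h1 h2
      have e1 : (T0.filter fun p => !p.2 && decide (i p.1 = m')).map Prod.fst =
          ((T0.filter fun x => !x.2 && decide (x.1 ∉ R)).map Prod.fst).filter
            fun g => i g = m' := by
        rw [List.filter_map, List.filter_filter]
        congr 1
        apply List.filter_congr
        rintro ⟨g, c⟩ hp
        have hg := fst_mem _ hp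
        cases c
        · by_cases hR : g ∈ R
          · have : i g ≠ m' := by rw [iR g hg hR]; omega
            simp [this]
          · simp [hR]
        · simp
      have e2 : (T0.filter fun p => p.2 && decide (i p.1 = m')).map Prod.fst =
          ((T0.filter fun x => x.2 && decide (x.1 ∉ L)).map Prod.fst).filter
            fun g => i g = m' := by
        rw [List.filter_map, List.filter_filter]
        congr 1
        apply List.filter_congr
        rintro ⟨g, c⟩ hp
        have hg := fst_mem _ hp
        cases c
        · simp
        · by_cases hL : g ∈ L
          · have : i g ≠ m' := by rw [iL g hg hL]; omega
            simp [this]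
          · simp [hL]
      rw [e1, e2, fs0]
  all_goals simp only [List.mem_toFinset]
  · intro g hg k hk e
    by_cases hgL : g ∈ L <;> by_cases hkL : k ∈ L
    · have e1 := posL g hg hgL
      have e2 := posL k hk hkL
      simpa using idx_inj _ e1.2.1 _ e2.2.1 (by omega)
    · have e1 := posL g hg hgL
      have e2 := fnL k hkL
      omega
    · have e1 := fnL g hgL
      have e2 := posL k hk hkL
      omega
    · have e1 := fnL g hgL
      have e2 := fnL k hkL
      simpa using idx_inj _ ((memF g).2 ⟨hg, hgL⟩) _ ((memF k).2 ⟨hk, hkL⟩) (by omega)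
  · intro g hg
    by_cases hgL : g ∈ L
    · have := posL g hg hgL; omega
    by_cases hgR : g ∈ R
    · have := posR g hg hgR; omega
    have mg := posB g hg hgL hgR
    -- If g ended before it started, `far` applied to g and itself would give i g + 2 ≤ i g.
    obtain ⟨i, n, I⟩ := pairIndex g hg g hg
    by_contra hc
    have := idxne g g mg.2.1 mg.1
    have := I.far g (by simp) g (by simp) (by omega)
    omega
  · intro g hg k hk hlt
    by_cases hgL : g ∈ L <;> by_cases hkL : k ∈ L
    · have e1 := posL g hg hgL
      have e2 := posL k hk hkL
      omega
    · obtain ⟨i, n, I⟩ := pairIndex g hg k hk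
      by_contra hc
      have e1 := posL g hg hgL
      have := I.eq_zero g (by simp) (by omega)
      have := I.one_le k (by simp) (by rw [fnL k hkL]; omega)
      have := I.mono_second k (by simp) g (by simp) (by omega)
      omega
    · have e1 := fnL g hgL
      have e2 := posL k hk hkL
      omega
    by_cases hgR : g ∈ R <;> by_cases hkR : k ∈ R
    · have e1 := posR g hg hgR
      have e2 := posR k hk hkR
      omega
    · obtain ⟨i, n, I⟩ := pairIndex g hg k hk
      have e1 := posR g hg hgR
      have e2 := posB k hk hkL hkR
      have := I.eq_last g (by simp) (by omega)
      have := I.lt_last k (by simp) (by omega)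
      have := I.mono_first g (by simp) k (by simp) (by omega)
      omega
    · have e1 := posR k hk hkR
      have e2 := posB g hg hgL hgR
      omega
    · have e1 := posB g hg hgL hgR
      have e2 := posB k hk hkL hkR
      have := fifoB g hg k hk hgL hgR hkL hkR (by omega)
      omega
  · intro g hg k hk
    by_cases hkL : k ∈ L
    · have e1 := posL k hk hkL
      have : 0 ≤ s g := by simp only [hs]; split_ifs <;> omega
      omega
    have mk := (memF k).2 ⟨hk, hkL⟩
    have e1 := fnL k hkL
    have e2 := idx_lt _ mk
    by_cases hgR : g ∈ R
    · have := posR g hg hgR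
      omega
    · have mg := (memT g).2 ⟨hg, hgR⟩
      have e3 := snR g hgR
      have := idxne g k mg mk
      omega
  · intro g hg
    by_cases hgL : g ∈ L
    · have := posL g hg hgL; omega
    · have := fnL g hgL; omega
  · intro g hg
    by_cases hgR : g ∈ R
    · have := posR g hg hgR; omega
    · have := idx_lt _ ((memT g).2 ⟨hg, hgR⟩)
      have := snR g hgR; omega
  · intro g hg
    by_cases hgL : g ∈ L
    · have := posL g hg hgL; omega
    · have := idx_lt _ ((memF g).2 ⟨hg, hgL⟩)
      have := fnL g hgL; omega
  · intro g hg
    have : 0 ≤ s g := by simp only [hs]; split_ifs <;> omega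
    omega

end ChainHelly

/-! ### Words, deduction, and identities of Rees quotients. -/

noncomputable instance Letter.instDecidableEq : DecidableEq Letter := Classical.decEq _

section Words

open FreeMonoid

/-- The substitution that replaces each letter `g` by `θ g`. -/
def substHom (θ : Letter → List Letter) : Word →* Word := FreeMonoid.lift fun g => ofList (θ g)

theorem toList_substHom (θ : Letter → List Letter) (w : Word) :
    toList (substHom θ w) = (toList w).flatMap θ := by
  rw [substHom, FreeMonoid.lift_apply, FreeMonoid.toList_prod, List.map_map, List.flatMap_def]
  rfl

/-- The subwords of words in `W`, as lists. -/
def listClosure (W : Set Word) : Set (List Letter) := {u | ∃ w ∈ W, u <:+: toList w}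

theorem mem_subwordClosure_iff {W : Set Word} {u : Word} :
    u ∈ subwordClosure W ↔ toList u ∈ listClosure W := by
  constructor
  · rintro ⟨w, hw, l, r, rfl⟩
    exact ⟨_, hw, toList l, toList r, rfl⟩
  · rintro ⟨w, hw, l, r, e⟩
    exact ⟨w, hw, ofList l, ofList r, e.symm⟩

/-- The quotient map is surjective, so every homomorphism from the free monoid to S(W) lifts to a
substitution of words. -/
theorem satisfies_iff {W : Set Word} {e : Identity} :
    Satisfies (ReesMonoid W) e ↔ ∀ θ : Letter → List Letter,
      (toList e.1).flatMap θ = (toList e.2).flatMap θ ∨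
      ((toList e.1).flatMap θ ∉ listClosure W ∧ (toList e.2).flatMap θ ∉ listClosure W) := by
  have key : ∀ θ : Letter → List Letter, ((reesCon W).mk' (substHom θ e.1) =
      (reesCon W).mk' (substHom θ e.2)) ↔
      ((toList e.1).flatMap θ = (toList e.2).flatMap θ ∨
      ((toList e.1).flatMap θ ∉ listClosure W ∧ (toList e.2).flatMap θ ∉ listClosure W)) := by
    intro θ
    rw [Con.coe_mk', Con.eq]
    change (_ ∨ _) ↔ _
    rw [mem_subwordClosure_iff, mem_subwordClosure_iff, toList_substHom, toList_substHom,
      ← toList_substHom, ← toList_substHom, toList.injective.eq_iff]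
  constructor
  · intro h θ
    exact (key θ).1 (h ((reesCon W).mk'.comp (substHom θ)))
  · intro h f
    have : ∃ θ : Letter → List Letter, f = (reesCon W).mk'.comp (substHom θ) := by
      have hs : ∀ g, ∃ l : List Letter, (reesCon W).mk' (ofList l) = f (of g) := fun g => by
        obtain ⟨w, hw⟩ := Con.mk'_surjective (c := reesCon W) (f (of g))
        exact ⟨toList w, hw⟩
      choose θ hθ using hs
      refine ⟨θ, FreeMonoid.hom_eq fun g => ?_⟩
      rw [MonoidHom.comp_apply, substHom, FreeMonoid.lift_eval_of, hθ]
    obtain ⟨θ, rfl⟩ := this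
    exact (key θ).2 (h θ)

theorem Satisfies.subst {M : Type*} [Monoid M] {u v : Word} (h : Satisfies M (u, v))
    (Θ : Word →* Word) : Satisfies M (Θ u, Θ v) := fun f => h (f.comp Θ)

theorem Satisfies.symm {M : Type*} [Monoid M] {u v : Word} (h : Satisfies M (u, v)) :
    Satisfies M (v, u) := fun f => (h f).symm

theorem Satisfies.trans {M : Type*} [Monoid M] {u v w : Word} (h : Satisfies M (u, v))
    (h' : Satisfies M (v, w)) : Satisfies M (u, w) := fun f => (h f).trans (h' f)

theorem Deducible.refl (Δ : Set Identity) (u : Word) : Deducible Δ (u, u) :=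
  (conGen _).refl u

theorem Deducible.symm {Δ : Set Identity} {u v : Word} (h : Deducible Δ (u, v)) :
    Deducible Δ (v, u) := (conGen _).symm h

theorem Deducible.trans {Δ : Set Identity} {u v w : Word} (h : Deducible Δ (u, v))
    (h' : Deducible Δ (v, w)) : Deducible Δ (u, w) := (conGen _).trans h h'

theorem Deducible.mul {Δ : Set Identity} {u v u' v' : Word} (h : Deducible Δ (u, v))
    (h' : Deducible Δ (u', v')) : Deducible Δ (u * u', v * v') := (conGen _).mul h h'

theorem Deducible.of_mem {Δ : Set Identity} {e : Identity} (h : e ∈ Δ) (Θ : Word →* Word) :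
    Deducible Δ (Θ e.1, Θ e.2) := ConGen.Rel.of _ _ ⟨e, h, Θ, rfl, rfl⟩

theorem Deducible.le {Δ : Set Identity} {c : Con Word}
    (h : ∀ e ∈ Δ, ∀ Θ : Word →* Word, c (Θ e.1) (Θ e.2)) {e : Identity} (he : Deducible Δ e) :
    c e.1 e.2 := by
  refine (Con.conGen_le (c := c)).2 ?_ he
  rintro _ _ ⟨d, hd, Θ, rfl, rfl⟩
  exact h d hd Θ

theorem Deducible.mono_of_deducible {Δ Δ' : Set Identity} (h : ∀ e ∈ Δ, Deducible Δ' e)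
    {e : Identity} (he : Deducible Δ e) : Deducible Δ' e := by
  refine Deducible.le (c := conGen (fun b c : Word => ∃ d ∈ Δ', ∃ Θ : Word →* Word,
    b = Θ d.1 ∧ c = Θ d.2)) ?_ he
  intro e he Θ
  refine Deducible.le (c := Con.comap Θ (map_mul Θ) (conGen (fun b c : Word => ∃ d ∈ Δ',
    ∃ Θ : Word →* Word, b = Θ d.1 ∧ c = Θ d.2))) ?_ (h e he)
  intro e he Θ'
  exact Deducible.of_mem he (Θ.comp Θ')

theorem Deducible.satisfies {M : Type*} [Monoid M] {Δ : Set Identity}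
    (h : ∀ e ∈ Δ, Satisfies M e) {e : Identity} (he : Deducible Δ e) : Satisfies M e := by
  intro f
  refine Deducible.le (c := Con.ker f) ?_ he
  intro e he Θ
  exact h e he (f.comp Θ)

theorem toList_deleteVars (X : Set Letter) [DecidablePred (· ∈ X)] (w : Word) :
    toList (deleteVars X w) = (toList w).flatMap fun c => if c ∈ X then [] else [c] := by
  rw [deleteVars, FreeMonoid.lift_apply, FreeMonoid.toList_prod, List.map_map, List.flatMap_def]
  congr 2
  funext c
  simp only [Function.comp]
  split_ifs <;> rfl

theorem flatMap_deleteVars (X : Set Letter) [DecidablePred (· ∈ X)] (w : Word)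
    (θ : Letter → List Letter) :
    (toList (deleteVars X w)).flatMap θ =
      (toList w).flatMap fun c => if c ∈ X then [] else θ c := by
  rw [toList_deleteVars, List.flatMap_assoc]
  apply List.flatMap_congr
  intro c _
  split_ifs <;> simp

theorem toList_deleteVars_filter (X : Set Letter) [DecidablePred (· ∈ X)] (w : Word) :
    toList (deleteVars X w) = (toList w).filter (· ∉ X) := by
  rw [toList_deleteVars]
  induction toList w with
  | nil => rfl
  | cons c l ih =>
    rw [List.flatMap_cons, ih]
    by_cases h : c ∈ X <;> simp [h]

theorem toList_chainWord (c d : Letter) (n : ℕ) :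
    toList (chainWord c d n) = [.xs 0] ++ [.z, c, d, .p] ++
      chainBlocks (fun i => [Letter.xs i]) n ++ [.z, c, d, .p] ++ [.xs n] := by
  simp only [chainWord, FreeMonoid.toList_mul, FreeMonoid.toList_prod, List.map_map, chainBlocks,
    List.flatMap_def, letter, FreeMonoid.toList_of]
  rfl

theorem flatMap_chainBlocks {α β : Type*} (θ : α → List β) (X : ℕ → List α) (n : ℕ) :
    (chainBlocks X n).flatMap θ = chainBlocks (fun i => (X i).flatMap θ) n := by
  rw [chainBlocks, chainBlocks, List.flatMap_assoc]
  simp [List.flatMap_append]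

theorem flatMap_chainWord (θ : Letter → List Letter) (c d : Letter) (n : ℕ) :
    (toList (chainWord c d n)).flatMap θ =
      θ (.xs 0) ++ θ .z ++ θ c ++ θ d ++ θ .p ++ chainBlocks (fun i => θ (.xs i)) n ++
        θ .z ++ θ c ++ θ d ++ θ .p ++ θ (.xs n) := by
  rw [toList_chainWord]
  simp [List.flatMap_append, flatMap_chainBlocks]

/-- `w` has the form `l X₀ (Z cd P) X₁X₀X₂X₁ ⋯ XₙXₙ₋₁ (Z cd P) Xₙ r`. -/
def ChainAt (c d : Letter) (w : List Letter) : Prop :=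
  ∃ L M R, w = L ++ c :: d :: M ++ c :: d :: R ∧ HasChain L M R

/-- Every letter occurs at most twice. -/
def TwoLimited (w : List Letter) : Prop := ∀ g, w.count g ≤ 2

theorem TwoLimited.of_infix {u w : List Letter} (h : TwoLimited w) (hu : u <:+: w) :
    TwoLimited u := fun g => (hu.sublist.count_le g).trans (h g)

theorem TwoLimited.filter {w : List Letter} (h : TwoLimited w) (p : Letter → Bool) :
    TwoLimited (w.filter p) := fun g => (List.filter_sublist.count_le g).trans (h g)

theorem TwoLimited.factor {L M R : List Letter} {c d : Letter}
    (h : TwoLimited (L ++ c :: d :: M ++ c :: d :: R)) : c ≠ d ∧ c ∉ L ∧ c ∉ M ∧ c ∉ R ∧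
      d ∉ L ∧ d ∉ M ∧ d ∉ R := by
  have hc := h c
  have hd := h d
  simp only [List.count_append, List.count_cons_self] at hc hd
  have hne : c ≠ d := by
    rintro rfl
    simp only [List.count_cons_self] at hc
    omega
  simp only [List.count_cons_of_ne hne, List.count_cons_of_ne hne.symm, List.count_cons_self]
    at hc hd
  simp only [← List.count_eq_zero]
  exact ⟨hne, by omega, by omega, by omega, by omega, by omega, by omega⟩

/-- A nontrivial application of `wₙ ≈ w'ₙ` to a word gives a chain. -/
theorem chainAt_of_flatMap {w l r : List Letter} {θ : Letter → List Letter} {n : ℕ} (hn : 2 ≤ n)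
    {x' y' : List Letter} {c d : Letter} (hx : θ .x = x' ++ [c]) (hy : θ .y = d :: y')
    (h : w = l ++ (toList (chainWord .x .y n)).flatMap θ ++ r) : ChainAt c d w := by
  -- The rest x' of θ(x) joins Z and the rest y' of θ(y) joins P; this is the purpose of the
  -- variables z and p in wₙ.
  refine ⟨l ++ θ (.xs 0) ++ (θ .z ++ x'), (y' ++ θ .p) ++ chainBlocks (fun i => θ (.xs i)) n ++
    (θ .z ++ x'), (y' ++ θ .p) ++ θ (.xs n) ++ r, ?_, n, fun i => θ (.xs i), _, _, l, r, hn, rfl,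
    rfl, rfl⟩
  rw [h, flatMap_chainWord, hx, hy]
  simp

theorem flatMap_chainWord_eq_of_nil {θ : Letter → List Letter} (n : ℕ)
    (h : θ .x = [] ∨ θ .y = []) : (toList (chainWord .x .y n)).flatMap θ =
      (toList (chainWord .y .x n)).flatMap θ := by
  rw [flatMap_chainWord, flatMap_chainWord]
  rcases h with h | h <;> simp [h]

theorem exists_chainAt {w : List Letter} {θ : Letter → List Letter} {n : ℕ} (hn : 2 ≤ n)
    (h : (toList (chainWord .x .y n)).flatMap θ <:+: w)
    (hne : (toList (chainWord .x .y n)).flatMap θ ≠ (toList (chainWord .y .x n)).flatMap θ) :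
    ∃ c d, ChainAt c d w := by
  obtain ⟨l, r, h⟩ := h
  rcases List.eq_nil_or_concat (θ .x) with hx | ⟨x', c, hx⟩
  · exact absurd (flatMap_chainWord_eq_of_nil n (Or.inl hx)) hne
  rcases hy : θ .y with - | ⟨d, y'⟩
  · exact absurd (flatMap_chainWord_eq_of_nil n (Or.inr hy)) hne
  rw [List.concat_eq_append] at hx
  exact ⟨c, d, chainAt_of_flatMap hn hx hy h.symm⟩

/-- Exchanging the letters `x` and `y`. -/
noncomputable def swapXY (θ : Letter → List Letter) : Letter → List Letter :=
  Function.update (Function.update θ .x (θ .y)) .y (θ .x)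

theorem flatMap_chainWord_swapXY (θ : Letter → List Letter) (n : ℕ) :
    (toList (chainWord .x .y n)).flatMap (swapXY θ) = (toList (chainWord .y .x n)).flatMap θ ∧
    (toList (chainWord .y .x n)).flatMap (swapXY θ) = (toList (chainWord .x .y n)).flatMap θ := by
  rw [flatMap_chainWord, flatMap_chainWord, flatMap_chainWord, flatMap_chainWord]
  simp [swapXY]

/-- If x is not sent to the empty word, some letter occurs three times in both images, and neither
is a subword of a two-limited word. -/
theorem satisfies_A3 {W : Set Word} (h : ∀ w ∈ W, TwoLimited (toList w)) {e : Identity}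
    (he : e ∈ A3) : Satisfies (ReesMonoid W) e := by
  rw [satisfies_iff]
  intro θ
  have key : ∀ u : List Letter, (∃ g ∈ θ .x, 3 ≤ u.count g) → u ∉ listClosure W := by
    rintro u ⟨g, -, hg⟩ ⟨w, hw, hu⟩
    have := (h w hw).of_infix hu g
    omega
  rcases hx : θ .x with - | ⟨g, t⟩
  · left
    rcases he with rfl | rfl <;>
      simp [letter, FreeMonoid.toList_mul, pow_succ, hx]
  · right
    have hc : 1 ≤ (θ .x).count g := List.count_pos_iff.2 (by rw [hx]; simp)
    rcases he with rfl | rfl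
    · constructor <;>
      · refine key _ ⟨g, by rw [hx]; simp, ?_⟩
        simp only [letter, FreeMonoid.toList_mul, pow_succ, pow_zero, one_mul, List.flatMap_append,
          FreeMonoid.toList_of, List.flatMap_cons, List.flatMap_nil, List.append_nil,
          List.count_append]
        omega
    · constructor <;>
      · refine key _ ⟨g, by rw [hx]; simp, ?_⟩
        simp only [letter, FreeMonoid.toList_mul, pow_succ, pow_zero, one_mul, List.flatMap_append,
          FreeMonoid.toList_of, List.flatMap_cons, List.flatMap_nil, List.append_nil,
          List.count_append]
        omega

/-- A two-limited word without chains satisfies all identities in question. -/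
theorem satisfies_singleton {w : Word} (h2 : TwoLimited (toList w))
    (h : ∀ c d, ¬ ChainAt c d (toList w)) :
    ∀ e ∈ SigmaAll ∪ A3, Satisfies (ReesMonoid {w}) e := by
  classical
  rintro e (⟨_, ⟨n, hn, rfl⟩, X, rfl⟩ | he)
  · rw [satisfies_iff]
    intro θ
    simp only [deleteIdentity, wIdentity, flatMap_deleteVars]
    set θ' : Letter → List Letter := fun c => if c ∈ X then [] else θ c
    by_cases heq : (toList (chainWord .x .y n)).flatMap θ' = (toList (chainWord .y .x n)).flatMap θ'
    · exact Or.inl heq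
    · right
      constructor
      · rintro ⟨w', rfl, hw⟩
        obtain ⟨c, d, hc⟩ := exists_chainAt hn hw heq
        exact h c d hc
      · rintro ⟨w', rfl, hw⟩
        -- The right side of the identity is the left side under the substitution with the values of
        -- x and y exchanged.
        rw [← (flatMap_chainWord_swapXY θ' n).1] at hw heq
        rw [← (flatMap_chainWord_swapXY θ' n).2] at heq
        obtain ⟨c, d, hc⟩ := exists_chainAt hn hw (fun h => heq h.symm)
        exact h c d hc
  · exact satisfies_A3 (by simpa using h2) he

end Words

/-! ### The isoterms over ten letters. -/

section Isoterms

open FreeMonoid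

theorem List.eq_of_append_cons_eq {α : Type*} {A B A' B' : List α} {c : α}
    (h : A ++ c :: B = A' ++ c :: B') (hA : c ∉ A) (hA' : c ∉ A') : A = A' ∧ B = B' := by
  induction A generalizing A' with
  | nil =>
    cases A' with
    | nil => simpa using h
    | cons a A' =>
      simp only [List.nil_append, List.cons_append, List.cons.injEq] at h
      exact absurd (by simp [h.1]) hA'
  | cons a A ih =>
    cases A' with
    | nil =>
      simp only [List.nil_append, List.cons_append, List.cons.injEq] at h
      exact absurd (by simp [h.1]) hA
    | cons a' A' =>
      simp only [List.cons_append, List.cons.injEq] at h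
      obtain ⟨rfl, h⟩ := h
      simp only [List.mem_cons, not_or] at hA hA'
      obtain ⟨rfl, rfl⟩ := ih h hA.2 hA'.2
      exact ⟨rfl, rfl⟩

/-- The images of the blocks are again blocks, and the rests x' and y' are absorbed by the images of
Z and P. Both renaming and reinsertion of a deleted letter are instances. -/
theorem ChainAt.flatMap {w : List Letter} {c d c' d' : Letter} {φ : Letter → List Letter}
    {x' y' : List Letter} (h : ChainAt c d w) (hc : φ c = x' ++ [c']) (hd : φ d = d' :: y') :
    ChainAt c' d' (w.flatMap φ) := by
  obtain ⟨L, M, R, rfl, n, X, Z, P, l, r, hn, rfl, rfl, rfl⟩ := h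
  refine ⟨_, _, _, ?_, n, fun i => (X i).flatMap φ, Z.flatMap φ ++ x', y' ++ P.flatMap φ,
    l.flatMap φ, r.flatMap φ, hn, rfl, rfl, rfl⟩
  simp [List.flatMap_append, flatMap_chainBlocks, hc, hd]

theorem List.flatMap_eq_self_of_forall {α : Type*} {A : List α} {φ : α → List α}
    (h : ∀ g ∈ A, φ g = [g]) : A.flatMap φ = A := by
  induction A with
  | nil => rfl
  | cons a A ih =>
    rw [List.flatMap_cons, h a (by simp), ih fun g hg => h g (List.mem_cons_of_mem _ hg)]
    rfl

/-- Letters for the isoterms below. -/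
noncomputable def baseLetters : Finset Letter := (Finset.range 10).image Letter.xs

/-- The two-limited words over ten letters to which no identity in `Σ` applies. -/
def isoWords : Set Word := {w | (∀ g ∈ toList w, g ∈ baseLetters) ∧ TwoLimited (toList w) ∧
  ∀ c d, ¬ ChainAt c d (toList w)}

theorem List.finite_setOf_count_le {α : Type*} [DecidableEq α] (L : List α) :
    {l : List α | ∀ g, l.count g ≤ L.count g}.Finite := by
  refine Set.Finite.subset (s := {l | l ∈ L.sublists.flatMap List.permutations})
    (List.finite_toSet _) ?_
  intro l hl
  have hsub : l.Subperm L := List.subperm_ext_iff.2 fun g _ => hl g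
  obtain ⟨m, hm, hmL⟩ := hsub
  simp only [Set.mem_ofPred_eq, List.mem_flatMap, List.mem_sublists, List.mem_permutations]
  exact ⟨m, hmL, hm.symm⟩

theorem finite_twoLimited (B : Finset Letter) :
    {w : Word | TwoLimited (toList w) ∧ ∀ g ∈ toList w, g ∈ B}.Finite := by
  have := List.finite_setOf_count_le (B.toList ++ B.toList)
  refine Set.Finite.subset (s := toList ⁻¹' _) (this.preimage toList.injective.injOn) ?_
  rintro w ⟨h2, h1⟩ g
  by_cases hg : g ∈ toList w
  · have : 1 ≤ B.toList.count g := List.count_pos_iff.2 (Finset.mem_toList.2 (h1 g hg))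
    have := h2 g
    rw [List.count_append]
    omega
  · rw [List.count_eq_zero_of_not_mem hg]
    exact Nat.zero_le _

theorem finite_isoWords : isoWords.Finite :=
  (finite_twoLimited baseLetters).subset fun _ hw => ⟨hw.2.1, hw.1⟩

theorem satisfies_of_forall_singleton {W : Set Word} {e : Identity}
    (h : ∀ w ∈ W, Satisfies (ReesMonoid {w}) e) : Satisfies (ReesMonoid W) e := by
  rw [satisfies_iff]
  intro θ
  by_cases heq : (toList e.1).flatMap θ = (toList e.2).flatMap θ
  · exact Or.inl heq
  · right
    constructor
    · rintro ⟨w, hw, hu⟩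
      have := ((satisfies_iff.1 (h w hw) θ).resolve_left heq).1
      exact this ⟨w, rfl, hu⟩
    · rintro ⟨w, hw, hu⟩
      have := ((satisfies_iff.1 (h w hw) θ).resolve_left heq).2
      exact this ⟨w, rfl, hu⟩

theorem satisfies_isoWords {e : Identity} (he : e ∈ SigmaAll ∪ A3) :
    Satisfies (ReesMonoid isoWords) e :=
  satisfies_of_forall_singleton fun _ hw => satisfies_singleton hw.2.1 hw.2.2 e he

theorem exists_perm_mapsTo_image (s : Finset Letter) {m : ℕ} (hs : s.card ≤ m) {f : ℕ → Letter}
    (hf : Function.Injective f) :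
    ∃ σ : Equiv.Perm Letter, ∀ g ∈ s, σ g ∈ (Finset.range m).image f := by
  have := Equiv.Perm.isMultiplyPretransitive Letter s.card
  let a : Fin s.card ↪ Letter := s.equivFin.symm.toEmbedding.trans (Function.Embedding.subtype _)
  let b : Fin s.card ↪ Letter := ⟨fun i => f i, fun i j h => Fin.ext (hf h)⟩
  obtain ⟨σ, hσ⟩ := MulAction.exists_smul_eq (M := Equiv.Perm Letter) a b
  refine ⟨σ, fun g hg => ?_⟩
  have h1 : a (s.equivFin ⟨g, hg⟩) = g := by simp [a]
  have h2 := DFunLike.congr_fun hσ (s.equivFin ⟨g, hg⟩)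
  rw [Function.Embedding.smul_apply, h1, Equiv.Perm.smul_def] at h2
  rw [h2, Finset.mem_image]
  exact ⟨_, Finset.mem_range.2 ((s.equivFin ⟨g, hg⟩).2.trans_le hs), rfl⟩

theorem eq_of_satisfies_of_mem {W : Set Word} {u v : Word} (h : Satisfies (ReesMonoid W) (u, v))
    (hu : u ∈ W) : u = v := by
  have := satisfies_iff.1 h fun g => [g]
  simp only [List.flatMap_singleton', toList.injective.eq_iff] at this
  exact this.resolve_right fun h' => h'.1 ⟨u, hu, List.infix_refl _⟩

theorem flatMap_singleton_comp {α β : Type*} (f : α → β) (l : List α) :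
    l.flatMap (fun g => [f g]) = l.map f := by
  induction l with
  | nil => rfl
  | cons a l ih => rw [List.flatMap_cons, ih]; rfl

/-- Two-limited words in at most ten letters without chains are isoterms for `S(isoWords)`. -/
theorem eq_of_satisfies_isoWords {u v : Word} (h : Satisfies (ReesMonoid isoWords) (u, v))
    (h2 : TwoLimited (toList u)) (hc : (toList u).toFinset.card ≤ 10)
    (hch : ∀ c d, ¬ ChainAt c d (toList u)) : u = v := by
  obtain ⟨σ, hσ⟩ := exists_perm_mapsTo_image (toList u).toFinset hc (f := Letter.xs)
    fun a b h => by simpa using h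
  have hmap := Satisfies.subst h (FreeMonoid.map σ)
  have hmem : FreeMonoid.map σ u ∈ isoWords := by
    refine ⟨?_, ?_, ?_⟩
    · intro g hg
      rw [FreeMonoid.toList_map, List.mem_map] at hg
      obtain ⟨k, hk, rfl⟩ := hg
      exact hσ k (List.mem_toFinset.2 hk)
    · intro g
      rw [FreeMonoid.toList_map, ← σ.apply_symm_apply g, List.count_map_of_injective _ _ σ.injective]
      exact h2 _
    · intro c d hcd
      apply hch (σ.symm c) (σ.symm d)
      have := hcd.flatMap (φ := fun g => [σ.symm g]) (x' := []) (y' := []) rfl rfl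
      rwa [flatMap_singleton_comp, FreeMonoid.toList_map, List.map_map,
        show σ.symm ∘ σ = id by funext; simp, List.map_id] at this
  have := eq_of_satisfies_of_mem hmap hmem
  exact (List.map_injective_iff.2 σ.injective) this

/-- Restriction to a set of letters. -/
theorem Satisfies.filter {M : Type*} [Monoid M] {u v : List Letter}
    (h : Satisfies M (ofList u, ofList v)) (S : Finset Letter) :
    Satisfies M (ofList (u.filter (· ∈ S)), ofList (v.filter (· ∈ S))) := by
  have key : ∀ w : List Letter, substHom (fun g => if g ∈ S then [g] else []) (ofList w) =
      ofList (w.filter (· ∈ S)) := by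
    intro w
    apply toList.injective
    rw [toList_substHom]
    simp only [FreeMonoid.toList_ofList]
    induction w with
    | nil => rfl
    | cons g w ih => by_cases hg : g ∈ S <;> simp [hg, ih]
  rw [← key, ← key]
  exact h.subst _

/-- If `S(isoWords)` satisfies `u ≈ v`, and `u` and `v` differ on the two letters `c`, `d`, then
the restriction of `u` to any ten letters is a chain. -/
theorem chainAt_filter_of_satisfies {l r v : List Letter} {c d : Letter}
    (h : Satisfies (ReesMonoid isoWords) (ofList (l ++ c :: d :: r), ofList v))
    (h2 : TwoLimited (l ++ c :: d :: r)) (hcl : c ∉ l) (hdl : d ∉ l) (hne : c ≠ d)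
    (hcd : (l ++ c :: d :: r).filter (· ∈ ({c, d} : Finset Letter)) = [c, d, c, d])
    (hv : (l ++ c :: d :: r).filter (· ∈ ({c, d} : Finset Letter)) ≠
      v.filter (· ∈ ({c, d} : Finset Letter)))
    (n : ℕ) (hn : n ≤ 10) (S : Finset Letter) (hS : S.card = n) (hcS : c ∈ S) (hdS : d ∈ S) :
    ChainAt c d ((l ++ c :: d :: r).filter (· ∈ S)) := by
  induction n generalizing S with
  | zero =>
    rw [Finset.card_eq_zero] at hS
    simp [hS] at hcS
  | succ n ih =>
    by_contra hnc
    have hsub : ∀ w : List Letter, (w.filter (· ∈ S)).filter (· ∈ ({c, d} : Finset Letter)) =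
        w.filter (· ∈ ({c, d} : Finset Letter)) := by
      intro w
      rw [List.filter_filter]
      apply List.filter_congr
      intro g _
      rw [← Bool.decide_and, decide_eq_decide]
      constructor
      · exact fun h => h.1
      · intro hg
        refine ⟨hg, ?_⟩
        simp only [Finset.mem_insert, Finset.mem_singleton] at hg
        rcases hg with rfl | rfl <;> assumption
    -- Without any chain the restriction would be an isoterm and would agree with that of v, also on
    -- c and d.
    obtain ⟨e, f, hef⟩ : ∃ e f, ChainAt e f ((l ++ c :: d :: r).filter (· ∈ S)) := by
      by_contra hno
      push Not at hno
      have := eq_of_satisfies_isoWords (h.filter S) (h2.filter _) (by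
        refine (Finset.card_le_card ?_).trans (hS.le.trans hn)
        intro g hg
        simp only [FreeMonoid.toList_ofList, List.mem_toFinset, List.mem_filter,
          decide_eq_true_eq] at hg
        exact hg.2) hno
      have := ofList.injective this
      apply hv
      rw [← hsub, this, hsub]
    have hef' := hef
    obtain ⟨A, B, C, hw, -⟩ := hef'
    have hwS : ∀ g, g ∈ A ++ e :: f :: B ++ e :: f :: C → g ∈ S := by
      intro g hg
      rw [← hw, List.mem_filter] at hg
      simpa using hg.2
    have tl := h2.filter (fun g => decide (g ∈ S))
    rw [hw] at tl
    obtain ⟨hef1, heA, heB, heC, hfA, hfB, hfC⟩ := tl.factor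
    have hw' : (l.filter (· ∈ S)) ++ c :: d :: (r.filter (· ∈ S)) =
        A ++ e :: f :: (B ++ e :: f :: C) := by
      rw [← show A ++ e :: f :: B ++ e :: f :: C = A ++ e :: f :: (B ++ e :: f :: C) by simp, ← hw,
        List.filter_append, List.filter_cons_of_pos (by simpa using hcS),
        List.filter_cons_of_pos (by simpa using hdS)]
    have hcl' : c ∉ l.filter (· ∈ S) := fun h => hcl (List.mem_of_mem_filter h)
    have hdl' : d ∉ l.filter (· ∈ S) := fun h => hdl (List.mem_of_mem_filter h)
    have hec : e ≠ c := by
      rintro rfl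
      have := (List.eq_of_append_cons_eq hw' hcl' heA).2
      simp only [List.cons.injEq] at this
      rw [← this.1] at hef
      exact hnc hef
    have hfd : f ≠ d := by
      rintro rfl
      have e1 : (l.filter (· ∈ S) ++ [c]) ++ f :: (r.filter (· ∈ S)) =
        (A ++ [e]) ++ f :: (B ++ e :: f :: C) := by simpa using hw'
      have := (List.eq_of_append_cons_eq e1 (by simp [hdl', hne.symm])
        (by simp [hfA, hef1.symm])).1
      have := List.append_inj_right' this rfl
      simp only [List.cons.injEq, and_true] at this
      exact hec this.symm
    have heS : e ∈ S := hwS e (by simp)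
    have hfS : f ∈ S := hwS f (by simp)
    have herase : ∀ k, (l ++ c :: d :: r).filter (· ∈ S.erase k) =
        (A ++ e :: f :: B ++ e :: f :: C).filter (· ≠ k) := by
      intro k
      rw [← hw, List.filter_filter]
      apply List.filter_congr
      intro g _
      rw [← Bool.decide_and, decide_eq_decide, Finset.mem_erase]
    have selfA : ∀ k, k ∉ A → A.filter (· ≠ k) = A := fun k hk =>
      List.filter_eq_self.2 fun g hg => by simpa using fun h : g = k => hk (h ▸ hg)
    have selfB : ∀ k, k ∉ B → B.filter (· ≠ k) = B := fun k hk =>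
      List.filter_eq_self.2 fun g hg => by simpa using fun h : g = k => hk (h ▸ hg)
    have selfC : ∀ k, k ∉ C → C.filter (· ≠ k) = C := fun k hk =>
      List.filter_eq_self.2 fun g hg => by simpa using fun h : g = k => hk (h ▸ hg)
    -- The chain is at ef ≠ cd, and the two copies of ef are all the occurrences of e and f. One of
    -- e, f, distinct from c and d, is deleted; the smaller restriction has a chain at cd by
    -- induction. Substituting ef for the remaining letter restores the word. The value of c still
    -- ends in c (it is ec if f = c) and that of d still begins with d (it is df if e = d), so the
    -- chain at cd persists.
    by_cases hfc : f = c
    · subst hfc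
      have hed : e ≠ d := by
        rintro rfl
        rw [← hsub, hw] at hcd
        have z : ∀ A : List Letter, f ∉ A → e ∉ A →
            A.filter (· ∈ ({f, e} : Finset Letter)) = [] := by
          intro A h1 h2
          rw [List.filter_eq_nil_iff]
          intro g hg
          simp only [Finset.mem_insert, Finset.mem_singleton, decide_eq_true_eq, not_or]
          exact ⟨fun h => h1 (h ▸ hg), fun h => h2 (h ▸ hg)⟩
        simp only [List.filter_append, List.filter_cons, z A hfA heA, z B hfB heB, z C hfC heC]
          at hcd
        simp at hcd
        exact hne hcd.1.symm
      have := ih (by omega) (S.erase e) (by rw [Finset.card_erase_of_mem heS, hS]; rfl)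
        (Finset.mem_erase.2 ⟨hec.symm, hcS⟩) (Finset.mem_erase.2 ⟨hed.symm, hdS⟩)
      rw [herase] at this
      simp only [List.filter_append, List.filter_cons, selfA e heA, selfB e heB, selfC e heC] at this
      have := this.flatMap (φ := fun g => if g = f then [e, f] else [g]) (x' := [e]) (y' := [])
        (c' := f) (d' := d)
        (by simp) (by simp [hfd.symm])
      apply hnc
      rw [hw]
      convert this using 1
      have z : ∀ A : List Letter, f ∉ A → A.flatMap (fun g => if g = f then [e, f] else [g]) = A :=
        fun A h => List.flatMap_eq_self_of_forall fun g hg => if_neg fun h' : g = f => h (h' ▸ hg)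
      simp [List.flatMap_append, z A hfA, z B hfB, z C hfC, hec.symm]
    · have := ih (by omega) (S.erase f) (by rw [Finset.card_erase_of_mem hfS, hS]; rfl)
        (Finset.mem_erase.2 ⟨fun h => hfc h.symm, hcS⟩) (Finset.mem_erase.2 ⟨hfd.symm, hdS⟩)
      rw [herase] at this
      simp only [List.filter_append, List.filter_cons, selfA f hfA, selfB f hfB, selfC f hfC] at this
      have hφd : ∃ y', (fun g => if g = e then [e, f] else [g] : Letter → List Letter) d =
          d :: y' := by
        by_cases hed : d = e
        · exact ⟨[f], by simp [hed]⟩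
        · exact ⟨[], by simp [hed]⟩
      obtain ⟨y', hy'⟩ := hφd
      have := this.flatMap (φ := fun g => if g = e then [e, f] else [g]) (x' := []) (y' := y')
        (c' := c) (d' := d)
        (by simp [hec.symm]) hy'
      apply hnc
      rw [hw]
      convert this using 1
      have z : ∀ A : List Letter, e ∉ A → A.flatMap (fun g => if g = e then [e, f] else [g]) = A :=
        fun A h => List.flatMap_eq_self_of_forall fun g hg => if_neg fun h' : g = e => h (h' ▸ hg)
      simp [List.flatMap_append, z A heA, z B heB, z C heC, hef1]

end Isoterms

/-! ### Finding an applicable identity. -/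

section ChainStep

open FreeMonoid

theorem List.filter_pair_eq_nil {A : List Letter} {c d : Letter} :
    A.filter (· ∈ ({c, d} : Finset Letter)) = [] ↔ c ∉ A ∧ d ∉ A := by
  rw [List.filter_eq_nil_iff]
  simp only [Finset.mem_insert, Finset.mem_singleton, decide_eq_true_eq, not_or]
  exact ⟨fun h => ⟨fun hc => (h c hc).1 rfl, fun hd => (h d hd).2 rfl⟩,
    fun h a ha => ⟨fun e => h.1 (e ▸ ha), fun e => h.2 (e ▸ ha)⟩⟩

/-- The factor cd occurs twice and exhausts the occurrences of both letters, so nothing else is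
left. -/
theorem ChainAt.eq_of_two_letters {w : List Letter} {c d q e : Letter} (h : ChainAt c d w)
    (h2 : TwoLimited w) (hw : ∀ g ∈ w, g = q ∨ g = e) :
    w = [q, e, q, e] ∨ w = [e, q, e, q] := by
  obtain ⟨A, B, C, rfl, -⟩ := h
  obtain ⟨hcd, hcA, hcB, hcC, hdA, hdB, hdC⟩ := h2.factor
  have key : ∀ g, g ∈ A ++ c :: d :: B ++ c :: d :: C → g = c ∨ g = d := by
    intro g hg
    have h1 := hw c (by simp)
    have h3 := hw d (by simp)
    have h4 := hw g hg
    clear hw h2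
    grind
  have nil : ∀ D : List Letter, (∀ g ∈ D, g ∈ A ++ c :: d :: B ++ c :: d :: C) → c ∉ D → d ∉ D →
      D = [] := by
    intro D hD hc hd
    rw [List.eq_nil_iff_forall_not_mem]
    intro g hg
    rcases key g (hD g hg) with rfl | rfl
    · exact hc hg
    · exact hd hg
  have eA := nil A (fun g hg => by simp [hg]) hcA hdA
  have eB := nil B (fun g hg => by simp [hg]) hcB hdB
  have eC := nil C (fun g hg => by simp [hg]) hcC hdC
  subst eA eB eC
  have h1 := hw c (by simp)
  have h3 := hw d (by simp)
  rcases h1 with rfl | rfl <;> rcases h3 with rfl | rfl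
  · exact absurd rfl hcd
  · exact Or.inl rfl
  · exact Or.inr rfl
  · exact absurd rfl hcd

theorem exists_mismatch {u v : List Letter} (hc : ∀ g, u.count g = v.count g) (hne : u ≠ v) :
    ∃ w c u1 e v1, u = w ++ c :: u1 ∧ v = w ++ e :: v1 ∧ c ≠ e := by
  induction u generalizing v with
  | nil =>
    cases v with
    | nil => exact absurd rfl hne
    | cons e v =>
      have := hc e
      simp at this
  | cons c u ih =>
    cases v with
    | nil =>
      have := hc c
      simp at this
    | cons e v =>
      by_cases hce : c = e
      · subst hce
        obtain ⟨w, c', u1, e', v1, rfl, rfl, h⟩ := ih (v := v) (fun g => by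
          have := hc g
          simp only [List.count_cons] at this
          omega) (fun h => hne (by rw [h]))
        exact ⟨c :: w, c', u1, e', v1, rfl, rfl, h⟩
      · exact ⟨[], c, u, e, v, rfl, rfl, hce⟩

/-- Where `u` and `v` differ, there are adjacent first occurrences of two letters in `u` which
have to be exchanged. -/
theorem exists_adjacent_pair {u v : List Letter}
    (h : Satisfies (ReesMonoid isoWords) (ofList u, ofList v)) (hu : TwoLimited u)
    (hc : ∀ g, u.count g = v.count g) (hne : u ≠ v) :
    ∃ l q e r, u = l ++ q :: e :: r ∧ q ∉ l ∧ e ∉ l ∧ q ≠ e ∧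
      u.filter (· ∈ ({q, e} : Finset Letter)) = [q, e, q, e] ∧
      v.filter (· ∈ ({q, e} : Finset Letter)) = [e, q, e, q] := by
  have hv : TwoLimited v := fun g => hc g ▸ hu g
  obtain ⟨w, c, u1, e, v1, rfl, rfl, hce⟩ := exists_mismatch hc hne
  have hmem : e ∈ c :: u1 := by
    have := hc e
    rw [List.count_append, List.count_append, List.count_cons_self] at this
    exact List.count_pos_iff.1 (by omega)
  -- After the common prefix w, the word v continues with e. In u the first e after w has a left
  -- neighbour q, and since c ≠ e this neighbour also lies after w.
  obtain ⟨m, r, hm, hem⟩ := List.eq_append_cons_of_mem hmem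
  rcases List.eq_nil_or_concat m with rfl | ⟨m', q, rfl⟩
  · simp only [List.nil_append, List.cons.injEq] at hm
    exact absurd hm.1 hce
  rw [List.concat_eq_append] at hm hem
  rw [hm] at h hu hc hne ⊢
  simp only [List.mem_append, List.mem_singleton, not_or] at hem
  obtain ⟨hem', heq⟩ := hem
  have hqe : q ≠ e := fun h => heq h.symm
  have eu : (w ++ (m' ++ [q] ++ e :: r)).filter (· ∈ ({q, e} : Finset Letter)) =
      w.filter (· ∈ ({q, e} : Finset Letter)) ++ (m'.filter (· ∈ ({q, e} : Finset Letter)) ++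
        q :: e :: r.filter (· ∈ ({q, e} : Finset Letter))) := by
    simp [List.filter_append]
  have ev : (w ++ e :: v1).filter (· ∈ ({q, e} : Finset Letter)) =
      w.filter (· ∈ ({q, e} : Finset Letter)) ++ e :: v1.filter (· ∈ ({q, e} : Finset Letter)) := by
    simp [List.filter_append]
  have hm'q : ∀ g ∈ m'.filter (· ∈ ({q, e} : Finset Letter)), g = q := by
    intro g hg
    simp only [List.mem_filter, Finset.mem_insert, Finset.mem_singleton, decide_eq_true_eq] at hg
    exact hg.2.resolve_right fun h => hem' (h ▸ hg.1)
  have two : ∀ x : List Letter, ∀ g ∈ x.filter (· ∈ ({q, e} : Finset Letter)), g = q ∨ g = e := by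
    intro x g hg
    simpa using (List.mem_filter.1 hg).2
  have card2 : ∀ x : List Letter,
      (x.filter (· ∈ ({q, e} : Finset Letter))).toFinset.card ≤ 10 := by
    intro x
    refine (Finset.card_le_card (t := {q, e}) ?_).trans (Finset.card_le_two.trans (by norm_num))
    intro g hg
    rw [List.mem_toFinset] at hg
    simpa using two x g hg
  have hdiff : (w ++ (m' ++ [q] ++ e :: r)).filter (· ∈ ({q, e} : Finset Letter)) ≠
      (w ++ e :: v1).filter (· ∈ ({q, e} : Finset Letter)) := by
    rw [eu, ev]
    intro h'
    have := List.append_cancel_left h'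
    cases hm'' : m'.filter (· ∈ ({q, e} : Finset Letter)) with
    | nil =>
      rw [hm''] at this
      simp only [List.nil_append, List.cons.injEq] at this
      exact hqe this.1
    | cons a t =>
      rw [hm''] at this
      simp only [List.cons_append, List.cons.injEq] at this
      have := hm'q a (by rw [hm'']; simp)
      simp_all
  -- On two letters, only qeqe and eqeq fail to be isoterms.
  have forms : ∀ x y : List Letter, Satisfies (ReesMonoid isoWords) (ofList x, ofList y) →
      TwoLimited x → x.filter (· ∈ ({q, e} : Finset Letter)) ≠
        y.filter (· ∈ ({q, e} : Finset Letter)) →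
      x.filter (· ∈ ({q, e} : Finset Letter)) = [q, e, q, e] ∨
      x.filter (· ∈ ({q, e} : Finset Letter)) = [e, q, e, q] := by
    intro x y hxy hx hd
    by_contra hno
    have := eq_of_satisfies_isoWords (hxy.filter {q, e}) (hx.filter _) (card2 x) (by
      intro a b hab
      exact hno (hab.eq_of_two_letters (hx.filter _) (two x)))
    exact hd (ofList.injective this)
  have fu := forms _ _ h hu hdiff
  have fv := forms _ _ h.symm hv hdiff.symm
  -- If w contained q or e, both restrictions would begin with the same letter; having the same
  -- form, they would be equal.
  have hw0 : w.filter (· ∈ ({q, e} : Finset Letter)) = [] := by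
    cases hw' : w.filter (· ∈ ({q, e} : Finset Letter)) with
    | nil => rfl
    | cons a t =>
      exfalso
      rw [eu, hw', List.cons_append] at fu
      rw [ev, hw', List.cons_append] at fv
      rw [eu, ev, hw', List.cons_append, List.cons_append] at hdiff
      rcases fu with fu | fu <;> rcases fv with fv | fv
      · exact hdiff (fu.trans fv.symm)
      · simp only [List.cons.injEq] at fu fv
        exact hqe (fu.1.symm.trans fv.1)
      · simp only [List.cons.injEq] at fu fv
        exact hqe (fv.1.symm.trans fu.1)
      · exact hdiff (fu.trans fv.symm)
  rw [eu, hw0, List.nil_append] at fu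
  rw [ev, hw0, List.nil_append] at fv
  have hm0 : m'.filter (· ∈ ({q, e} : Finset Letter)) = [] := by
    cases hm'' : m'.filter (· ∈ ({q, e} : Finset Letter)) with
    | nil => rfl
    | cons a t =>
      exfalso
      have ha := hm'q a (by rw [hm'']; simp)
      rw [hm'', List.cons_append] at fu
      rcases fu with fu | fu
      · cases t with
        | nil =>
          simp only [List.nil_append, List.cons.injEq] at fu
          exact hqe fu.2.1
        | cons b t =>
          have hb := hm'q b (by rw [hm'']; simp)
          simp only [List.cons_append, List.cons.injEq] at fu
          exact hqe (hb.symm.trans fu.2.1)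
      · simp only [List.cons.injEq] at fu
        exact hqe (ha.symm.trans fu.1)
  rw [hm0, List.nil_append] at fu
  rw [List.filter_pair_eq_nil] at hw0 hm0
  refine ⟨w ++ m', q, e, r, by simp, by simp [hw0, hm0], by simp [hw0, hm0], hqe, ?_, ?_⟩
  · rw [eu, List.filter_pair_eq_nil.2 hw0, List.filter_pair_eq_nil.2 hm0]
    rcases fu with fu | fu
    · exact fu
    · simp only [List.cons.injEq] at fu
      exact absurd fu.1 hqe
  · rw [ev, List.filter_pair_eq_nil.2 hw0]
    rcases fv with fv | fv
    · simp only [List.cons.injEq] at fv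
      exact absurd fv.1.symm hqe
    · exact fv

/-- If `S(isoWords)` satisfies `u ≈ v`, then an identity `wₙ ≈ w'ₙ` can be applied to `u` so as to
exchange two letters whose order is different in `v`. -/
theorem exists_chain_step {u v : List Letter}
    (h : Satisfies (ReesMonoid isoWords) (ofList u, ofList v)) (hu : TwoLimited u)
    (hc : ∀ g, u.count g = v.count g) (hne : u ≠ v) :
    ∃ c d L M R, u = L ++ c :: d :: M ++ c :: d :: R ∧ HasChain L M R ∧
      v.filter (· ∈ ({c, d} : Finset Letter)) = [d, c, d, c] := by
  obtain ⟨l, c, d, r, rfl, hcl, hdl, hcd, hfu, hfv⟩ := exists_adjacent_pair h hu hc hne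
  have hdiff : (l ++ c :: d :: r).filter (· ∈ ({c, d} : Finset Letter)) ≠
      v.filter (· ∈ ({c, d} : Finset Letter)) := by
    rw [hfu, hfv]
    simp [hcd]
  have chains : ∀ S : Finset Letter, S.card ≤ 10 → c ∈ S → d ∈ S →
      ChainAt c d ((l ++ c :: d :: r).filter (· ∈ S)) := fun S hS =>
    chainAt_filter_of_satisfies h hu hcl hdl hcd hfu hdiff S.card hS S rfl
  have hfr : r.filter (· ∈ ({c, d} : Finset Letter)) = [c, d] := by
    rw [List.filter_append, List.filter_pair_eq_nil.2 ⟨hcl, hdl⟩] at hfu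
    simpa using hfu
  have hcr : c ∈ r := List.mem_of_mem_filter (hfr ▸ by simp :
    c ∈ r.filter (· ∈ ({c, d} : Finset Letter)))
  obtain ⟨M, r', rfl, hcM⟩ := List.eq_append_cons_of_mem hcr
  rw [List.filter_append, List.filter_cons_of_pos (by simp)] at hfr
  have hM0 : M.filter (· ∈ ({c, d} : Finset Letter)) = [] := by
    cases hM : M.filter (· ∈ ({c, d} : Finset Letter)) with
    | nil => rfl
    | cons a t =>
      exfalso
      rw [hM, List.cons_append] at hfr
      simp only [List.cons.injEq] at hfr
      have ha : a ∈ M := List.mem_of_mem_filter (hM ▸ by simp :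
        a ∈ M.filter (· ∈ ({c, d} : Finset Letter)))
      exact hcM (hfr.1 ▸ ha)
  rw [hM0, List.nil_append] at hfr
  simp only [List.cons.injEq, true_and] at hfr
  have hdr : d ∈ r' := List.mem_of_mem_filter (hfr ▸ by simp :
    d ∈ r'.filter (· ∈ ({c, d} : Finset Letter)))
  obtain ⟨E, R, rfl, hdE⟩ := List.eq_append_cons_of_mem hdr
  rw [List.filter_pair_eq_nil] at hM0
  have hcE : c ∉ E ∧ c ∉ R ∧ d ∉ R := by
    have h1 := hu c
    have h3 := hu d
    simp only [List.count_append, List.count_cons_self, List.count_cons_of_ne hcd,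
      List.count_cons_of_ne hcd.symm] at h1 h3
    simp only [← List.count_eq_zero]
    exact ⟨by omega, by omega, by omega⟩
  have filt : ∀ S : Finset Letter, c ∈ S → d ∈ S →
      (l ++ c :: d :: (M ++ c :: (E ++ d :: R))).filter (· ∈ S) =
      l.filter (· ∈ S) ++ c :: d :: (M.filter (· ∈ S) ++ c :: (E.filter (· ∈ S) ++
        d :: R.filter (· ∈ S))) := by
    intro S hcS hdS
    simp [List.filter_append, hcS, hdS]
  have nf : ∀ {A : List Letter} {g} (S : Finset Letter), g ∉ A → g ∉ A.filter (· ∈ S) :=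
    fun S h h' => h (List.mem_of_mem_filter h')
  have split : ∀ S : Finset Letter, S.card ≤ 10 → c ∈ S → d ∈ S → ∃ R',
      E.filter (· ∈ S) ++ d :: R.filter (· ∈ S) = d :: R' ∧
      HasChain (l.filter (· ∈ S)) (M.filter (· ∈ S)) R' := by
    intro S hS hcS hdS
    have ch := chains S hS hcS hdS
    obtain ⟨L', M', R', e, hch⟩ := ch
    have tl := hu.filter (· ∈ S)
    rw [e] at tl
    obtain ⟨-, hcL', hcM', -, -, -, -⟩ := tl.factor
    rw [filt S hcS hdS, List.append_assoc] at e
    obtain ⟨e1, e2⟩ := List.eq_of_append_cons_eq e (nf S hcl) hcL'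
    obtain ⟨e3, e4⟩ := List.eq_of_append_cons_eq (List.cons.inj e2).2 (nf S hM0.1) hcM'
    exact ⟨R', e4, by rw [e1, e3]; exact hch⟩
  -- A letter between the second occurrences of c and d would survive in a restriction to three
  -- letters, which has a chain at cd.
  have hE : E = [] := by
    rw [List.eq_nil_iff_forall_not_mem]
    intro a ha
    obtain ⟨R', e, -⟩ := split {c, d, a} (Finset.card_le_three.trans (by norm_num)) (by simp)
      (by simp)
    cases hE : E.filter (· ∈ ({c, d, a} : Finset Letter)) with
    | nil =>
      rw [List.filter_eq_nil_iff] at hE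
      exact hE a ha (by simp)
    | cons b t =>
      rw [hE, List.cons_append] at e
      simp only [List.cons.injEq] at e
      have hb : b ∈ E := List.mem_of_mem_filter (hE ▸ by simp :
        b ∈ E.filter (· ∈ ({c, d, a} : Finset Letter)))
      exact hdE (e.1 ▸ hb)
  subst hE
  refine ⟨c, d, l, M, R, by simp, ?_, hfv⟩
  -- Eight letters together with c and d make ten, the size of the alphabet of `isoWords`.
  apply hasChain_of_filter
  · intro g
    have := hu g
    simp only [List.count_append, List.count_cons, List.nil_append] at this
    omega
  · intro S hS
    obtain ⟨R', e, hch⟩ := split (insert c (insert d S)) (by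
      have := Finset.card_insert_le c (insert d S)
      have := Finset.card_insert_le d S
      omega) (by simp) (by simp)
    simp only [List.filter_nil, List.nil_append, List.cons.injEq, true_and] at e
    rw [← e] at hch
    have red : ∀ A : List Letter, c ∉ A → d ∉ A →
        A.filter (· ∈ insert c (insert d S)) = A.filter (· ∈ S) := by
      intro A h1 h3
      apply List.filter_congr
      intro g hg
      rw [decide_eq_decide, Finset.mem_insert, Finset.mem_insert]
      constructor
      · rintro (rfl | rfl | h)
        · exact absurd hg h1
        · exact absurd hg h3
        · exact h
      · exact fun h => Or.inr (Or.inr h)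
    rwa [red l hcl hdl, red M hM0.1 hM0.2, red R hcE.2.1 hcE.2.2] at hch

end ChainStep

/-! ### Completeness of the bases. -/

section Completeness

open FreeMonoid

theorem HasChain.exists_subst {L M R : List Letter} (h : HasChain L M R) (c d : Letter) :
    ∃ n, 2 ≤ n ∧ ∃ (θ : Letter → List Letter) (l r : List Letter), θ .x = [c] ∧ θ .y = [d] ∧
      L ++ c :: d :: M ++ c :: d :: R = l ++ (toList (chainWord .x .y n)).flatMap θ ++ r ∧
      L ++ d :: c :: M ++ d :: c :: R = l ++ (toList (chainWord .y .x n)).flatMap θ ++ r := by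
  obtain ⟨n, X, Z, P, l, r, hn, rfl, rfl, rfl⟩ := h
  refine ⟨n, hn, fun g => match g with
    | .x => [c] | .y => [d] | .z => Z | .p => P | .xs i => X i | _ => [], l, r, rfl, rfl, ?_, ?_⟩
  · rw [flatMap_chainWord]; simp
  · rw [flatMap_chainWord]; simp

theorem Deducible.mono {Δ Δ' : Set Identity} (h : Δ ⊆ Δ') {e : Identity} (he : Deducible Δ e) :
    Deducible Δ' e :=
  Deducible.mono_of_deducible (fun e he' => by
    have := Deducible.of_mem (h he') (MonoidHom.id _)
    exact this) he

theorem deducible_A3_move (X T1 T2 T3 : Word) :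
    Deducible A3 (T1 * X * T2 * X * T3 * X, X ^ 3 * T1 * T2 * T3) := by
  have := Deducible.of_mem (Δ := A3) (Or.inl rfl) (FreeMonoid.lift fun g => match g with
    | .x => X | .t 1 => T1 | .t 2 => T2 | .t 3 => T3 | _ => 1)
  simpa [letter] using this

theorem deducible_A3_pow (X : Word) : Deducible A3 (X ^ 3, X ^ 4) := by
  have := Deducible.of_mem (Δ := A3) (Or.inr rfl) (FreeMonoid.lift fun _ => X)
  simpa [letter] using this

/-- A further c after c³ is absorbed: c³Sc = c·c·1·c·S·c becomes c⁴S by the first identity of A₃,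
and c⁴ = c³. -/
theorem deducible_A3_absorb (c : Letter) (s : List Letter) :
    Deducible A3 (letter c ^ 3 * ofList s, letter c ^ 3 * ofList (s.filter (· ≠ c))) := by
  induction s using List.reverseRecOn with
  | nil => exact Deducible.refl _ _
  | append_singleton s g ih =>
    have h1 := ih.mul (Deducible.refl A3 (letter g))
    rw [ofList_append, List.filter_append, ofList_append]
    by_cases hg : g = c
    · subst hg
      rw [List.filter_cons_of_neg (by simp), List.filter_nil, ofList_nil, mul_one, ← mul_assoc]
      refine h1.trans ?_
      set S := ofList (s.filter (· ≠ g))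
      have h2 := deducible_A3_move (letter g) (letter g) 1 S
      have e1 : letter g * letter g * 1 * letter g * S * letter g = letter g ^ 3 * S * letter g := by
        simp [pow_succ, mul_assoc]
      have e2 : letter g ^ 3 * letter g * 1 * S = letter g ^ 4 * S := by
        simp [pow_succ, mul_assoc]
      rw [e1, e2] at h2
      exact h2.trans ((deducible_A3_pow _).mul (Deducible.refl _ _)).symm
    · rw [List.filter_cons_of_pos (by simpa using hg), List.filter_nil, ← mul_assoc, ← mul_assoc]
      exact h1

theorem List.exists_three_of_count {u : List Letter} {c : Letter} (h : 3 ≤ u.count c) :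
    ∃ t1 t2 t3 t4, u = t1 ++ c :: t2 ++ c :: t3 ++ c :: t4 := by
  have step : ∀ {m : ℕ} {w : List Letter}, m + 1 ≤ w.count c →
      ∃ t w', w = t ++ c :: w' ∧ m ≤ w'.count c := by
    intro m w hw
    obtain ⟨t, w', rfl, ht⟩ := List.eq_append_cons_of_mem (List.count_pos_iff.1
      (show 0 < w.count c by omega))
    rw [List.count_append, List.count_cons_self, List.count_eq_zero_of_not_mem ht] at hw
    exact ⟨t, w', rfl, by omega⟩
  obtain ⟨t1, w1, rfl, h1⟩ := step h
  obtain ⟨t2, w2, rfl, h2⟩ := step h1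
  obtain ⟨t3, w3, rfl, -⟩ := step h2
  exact ⟨t1, t2, t3, w3, by simp⟩

theorem deducible_A3_cube {c : Letter} {u : List Letter} (h : 3 ≤ u.count c) :
    Deducible A3 (ofList u, letter c ^ 3 * ofList (u.filter (· ≠ c))) := by
  obtain ⟨t1, t2, t3, t4, rfl⟩ := List.exists_three_of_count h
  have h1 := (deducible_A3_move (letter c) (ofList t1) (ofList t2) (ofList t3)).mul
    (Deducible.refl A3 (ofList t4))
  have h2 := deducible_A3_absorb c (t1 ++ t2 ++ t3 ++ t4)
  have e1 : ofList (t1 ++ c :: t2 ++ c :: t3 ++ c :: t4) = ofList t1 * letter c * ofList t2 *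
      letter c * ofList t3 * letter c * ofList t4 := by
    simp [ofList_append, ofList_cons, mul_assoc]
  have e2 : letter c ^ 3 * ofList (t1 ++ t2 ++ t3 ++ t4) =
      letter c ^ 3 * ofList t1 * ofList t2 * ofList t3 * ofList t4 := by
    simp [ofList_append, mul_assoc]
  have e3 : (t1 ++ c :: t2 ++ c :: t3 ++ c :: t4).filter (· ≠ c) =
      (t1 ++ t2 ++ t3 ++ t4).filter (· ≠ c) := by
    simp [List.filter_append]
  rw [e1, e3]
  rw [e2] at h2
  exact h1.trans h2

theorem deducible_A3_cubes (cs : List Letter) (hcs : cs.Nodup) (u : List Letter)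
    (h : ∀ c ∈ cs, 3 ≤ u.count c) :
    Deducible A3 (ofList u, (cs.map fun c => letter c ^ 3).prod * ofList (u.filter (· ∉ cs))) := by
  induction cs generalizing u with
  | nil => simpa using Deducible.refl A3 (ofList u)
  | cons c cs ih =>
    rw [List.nodup_cons] at hcs
    refine (deducible_A3_cube (h c (by simp))).trans ?_
    have := ih hcs.2 (u.filter (· ≠ c)) (fun k hk => by
      rw [List.count_filter (by simpa using fun e : k = c => hcs.1 (e ▸ hk))]
      exact h k (by simp [hk]))
    have := (Deducible.refl A3 (letter c ^ 3)).mul this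
    rw [List.map_cons, List.prod_cons, mul_assoc]
    convert this using 4
    rw [List.filter_filter]
    congr 1
    apply List.filter_congr
    intro g _
    simp [Bool.and_comm]

/-- The empty word, c and c² are isoterms: a chain needs two distinct letters. -/
theorem count_eq_of_satisfies {u v : List Letter}
    (h : Satisfies (ReesMonoid isoWords) (ofList u, ofList v)) {c : Letter} (hc : u.count c ≤ 2) :
    u.count c = v.count c := by
  have hall : ∀ g ∈ u.filter (· ∈ ({c} : Finset Letter)), g = c := fun g hg => by
    simpa using (List.mem_filter.1 hg).2
  have := eq_of_satisfies_isoWords (h.filter {c}) (fun g => by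
      by_cases hg : g = c
      · subst hg
        exact (List.filter_sublist.count_le g).trans hc
      · rw [FreeMonoid.toList_ofList, List.count_eq_zero_of_not_mem fun h => hg (hall g h)]
        exact Nat.zero_le _) (by
      refine (Finset.card_le_card (t := {c}) ?_).trans (by simp)
      intro g hg
      rw [List.mem_toFinset] at hg
      simpa using hall g hg) (by
      intro a b hab
      obtain ⟨L, M, R, e, -⟩ := hab
      rw [FreeMonoid.toList_ofList] at e
      have := congrArg (List.count c) e
      rw [List.count_filter (by simp)] at this
      have ha := hall a (by rw [e]; simp)
      have hb := hall b (by rw [e]; simp)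
      subst ha hb
      simp only [List.count_append, List.count_cons_self] at this
      omega)
  have := congrArg (List.count c) (ofList.injective this)
  rwa [List.count_filter (by simp), List.count_filter (by simp)] at this

theorem filter_swap {L M R : List Letter} {c d : Letter} {S : Finset Letter}
    (h : ¬ (c ∈ S ∧ d ∈ S)) : (L ++ c :: d :: M ++ c :: d :: R).filter (· ∈ S) =
      (L ++ d :: c :: M ++ d :: c :: R).filter (· ∈ S) := by
  by_cases hc : c ∈ S
  · have hd : d ∉ S := fun hd => h ⟨hc, hd⟩
    simp [List.filter_append, hc, hd]
  · by_cases hd : d ∈ S <;> simp [List.filter_append, hc, hd]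

/-- Completeness: `Δ` is a basis of `M` as soon as it contains all identities that are needed to
exchange letters. -/
theorem deducible_of_satisfies {M : Type*} [Monoid M] {Δ : Set Identity} (hA3 : A3 ⊆ Δ)
    (hsat : ∀ e ∈ Δ, Satisfies M e)
    (hM : ∀ e : Identity, Satisfies M e → Satisfies (ReesMonoid isoWords) e)
    (step : ∀ (n : ℕ) (θ : Letter → List Letter) (l r v : List Letter) (c d : Letter), 2 ≤ n →
      θ .x = [c] → θ .y = [d] → TwoLimited (l ++ (toList (chainWord .x .y n)).flatMap θ ++ r) →
      Satisfies M (ofList (l ++ (toList (chainWord .x .y n)).flatMap θ ++ r), ofList v) →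
      v.filter (· ∈ ({c, d} : Finset Letter)) = [d, c, d, c] →
      deleteIdentity {g | θ g = []} (wIdentity n) ∈ Δ)
    {u v : Word} (h : Satisfies M (u, v)) : Deducible Δ (u, v) := by
  -- Induction on the number m of ordered pairs of letters on which the restrictions of u and v
  -- differ.
  have main : ∀ (m : ℕ) (u v : List Letter), TwoLimited u → (∀ g, u.count g = v.count g) →
      Satisfies M (ofList u, ofList v) →
      ((u.toFinset ×ˢ u.toFinset).filter fun p =>
        u.filter (· ∈ ({p.1, p.2} : Finset Letter)) ≠
          v.filter (· ∈ ({p.1, p.2} : Finset Letter))).card = m →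
      Deducible Δ (ofList u, ofList v) := by
    intro m
    induction m using Nat.strong_induction_on with
    | _ m ih =>
    intro u v hu hc h hm
    by_cases hne : u = v
    · rw [hne]; exact Deducible.refl _ _
    obtain ⟨c, d, L, N, R, hueq, hch, hv⟩ := exists_chain_step (hM _ h) hu hc hne
    obtain ⟨n, hn, θ, l, r, hx, hy, e1, e2⟩ := hch.exists_subst c d
    -- The variables with empty value are deleted beforehand. This does not change the images, but
    -- it is the form in which the identity may be asked to belong to Σ_k.
    have hmem := step n θ l r v c d hn hx hy (by rw [← e1, ← hueq]; exact hu)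
      (by rw [← e1, ← hueq]; exact h) hv
    set u' := L ++ d :: c :: N ++ d :: c :: R with hu'
    have hded : Deducible Δ (ofList u, ofList u') := by
      have h1 := Deducible.of_mem hmem (substHom θ)
      have h2 := ((Deducible.refl Δ (ofList l)).mul h1).mul (Deducible.refl Δ (ofList r))
      have key : ∀ w : Word, ofList l * substHom θ (deleteVars {g | θ g = []} w) * ofList r =
          ofList (l ++ (toList w).flatMap θ ++ r) := by
        classical
        intro w
        apply toList.injective
        rw [FreeMonoid.toList_mul, FreeMonoid.toList_mul, toList_substHom, flatMap_deleteVars]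
        simp only [FreeMonoid.toList_ofList]
        congr 2
        apply List.flatMap_congr
        intro g _
        split_ifs with h
        · exact h.symm
        · rfl
      simp only [deleteIdentity, wIdentity, key] at h2
      rwa [← e1, ← e2, ← hueq] at h2
    have hsat' : Satisfies M (ofList u', ofList v) := (hded.satisfies hsat).symm.trans h
    have hcount : ∀ g, u.count g = u'.count g := by
      intro g
      rw [hueq, hu']
      simp only [List.count_append, List.count_cons]
      omega
    have hu2 : TwoLimited u' := fun g => hcount g ▸ hu g
    have hfin : u'.toFinset = u.toFinset := by
      ext g
      rw [List.mem_toFinset, List.mem_toFinset, ← List.count_pos_iff, ← List.count_pos_iff, hcount]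
    have hfac := (hueq ▸ hu : TwoLimited (L ++ c :: d :: N ++ c :: d :: R)).factor
    have hucd : u.filter (· ∈ ({c, d} : Finset Letter)) = [c, d, c, d] := by
      rw [hueq]
      simp only [List.filter_append, List.filter_cons, List.filter_pair_eq_nil.2
        ⟨hfac.2.1, hfac.2.2.2.2.1⟩, List.filter_pair_eq_nil.2 ⟨hfac.2.2.1, hfac.2.2.2.2.2.1⟩,
        List.filter_pair_eq_nil.2 ⟨hfac.2.2.2.1, hfac.2.2.2.2.2.2⟩]
      simp
    have hu'cd : u'.filter (· ∈ ({c, d} : Finset Letter)) = [d, c, d, c] := by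
      rw [hu']
      simp only [List.filter_append, List.filter_cons, List.filter_pair_eq_nil.2
        ⟨hfac.2.1, hfac.2.2.2.2.1⟩, List.filter_pair_eq_nil.2 ⟨hfac.2.2.1, hfac.2.2.2.2.2.1⟩,
        List.filter_pair_eq_nil.2 ⟨hfac.2.2.2.1, hfac.2.2.2.2.2.2⟩]
      simp
    refine hded.trans (ih _ ?_ u' v hu2 (fun g => (hcount g).symm.trans (hc g)) hsat' rfl)
    rw [← hm, hfin]
    apply Finset.card_lt_card
    rw [Finset.ssubset_iff_of_subset]
    · refine ⟨(c, d), ?_, ?_⟩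
      · rw [Finset.mem_filter]
        refine ⟨?_, ?_⟩
        · rw [hueq]; simp
        · rw [hucd, hv]; simp [hfac.1]
      · rw [Finset.mem_filter, not_and_not_right]
        intro _
        rw [hu'cd, hv]
    -- The exchange affects the restriction to {c, d} alone, where u' now agrees with v; on every
    -- other pair u' looks like u.
    · intro p hp
      rw [Finset.mem_filter] at hp ⊢
      refine ⟨hp.1, fun hpe => hp.2 ?_⟩
      by_cases hS : c ∈ ({p.1, p.2} : Finset Letter) ∧ d ∈ ({p.1, p.2} : Finset Letter)
      · have : ({p.1, p.2} : Finset Letter) = {c, d} := by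
          simp only [Finset.mem_insert, Finset.mem_singleton] at hS
          obtain ⟨h1, h3⟩ := hS
          rcases h1 with h1 | h1 <;> rcases h3 with h3 | h3
          · exact absurd (h1.trans h3.symm) hfac.1
          · rw [h1, h3]
          · rw [h1, h3, Finset.pair_comm]
          · exact absurd (h1.trans h3.symm) hfac.1
        rw [this, hu'cd, hv]
      · rw [hu', ← filter_swap hS, ← hueq, hpe]
  have hcount : ∀ g, (toList u).count g ≤ 2 ∨ (toList v).count g ≤ 2 →
      (toList u).count g = (toList v).count g := by
    rintro g (hg | hg)
    · exact count_eq_of_satisfies (hM _ h) hg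
    · exact (count_eq_of_satisfies (hM _ h).symm hg).symm
  -- The letters with three or more occurrences are the same in u and v, as smaller occurrence
  -- numbers agree; so both sides acquire the same product of cubes.
  set cs := ((toList u).toFinset.filter fun g => 3 ≤ (toList u).count g).toList with hcs
  have mem_cs : ∀ g, g ∈ cs ↔ 3 ≤ (toList u).count g := by
    intro g
    simp only [hcs, Finset.mem_toList, Finset.mem_filter, List.mem_toFinset, and_iff_right_iff_imp]
    intro hg
    exact List.count_pos_iff.1 (by omega)
  have mem_cs' : ∀ g, g ∈ cs ↔ 3 ≤ (toList v).count g := by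
    intro g
    rw [mem_cs]
    have := hcount g
    omega
  have du := (deducible_A3_cubes cs (Finset.nodup_toList _) (toList u)
    fun c hc => (mem_cs c).1 hc).mono hA3
  have dv := (deducible_A3_cubes cs (Finset.nodup_toList _) (toList v)
    fun c hc => (mem_cs' c).1 hc).mono hA3
  refine du.trans (Deducible.trans ?_ dv.symm)
  refine (Deducible.refl _ _).mul (main _ _ _ ?_ ?_ ?_ rfl)
  · intro g
    by_cases hg : g ∈ cs
    · rw [List.count_eq_zero_of_not_mem (by simp [hg])]
      exact Nat.zero_le _
    · rw [List.count_filter (by simpa using hg)]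
      rw [mem_cs] at hg
      omega
  · intro g
    by_cases hg : g ∈ cs
    · rw [List.count_eq_zero_of_not_mem (by simp [hg]), List.count_eq_zero_of_not_mem (by simp [hg])]
    · rw [List.count_filter (by simpa using hg), List.count_filter (by simpa using hg)]
      rw [mem_cs] at hg
      exact hcount g (by omega)
  · have := Satisfies.subst h (deleteVars {g | g ∈ cs})
    have key : ∀ w : Word, deleteVars {g | g ∈ cs} w = ofList ((toList w).filter (· ∉ cs)) := by
      intro w
      apply toList.injective
      rw [toList_deleteVars_filter]
      rfl
    rwa [key, key] at this

theorem isBasis_isoWords : IsBasis (ReesMonoid isoWords) (SigmaAll ∪ A3) := by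
  refine ⟨fun e he => satisfies_isoWords he, fun e he => ?_⟩
  refine deducible_of_satisfies Set.subset_union_right (fun e he => satisfies_isoWords he)
    (fun e he => he) ?_ he
  intro n θ l r v c d hn _ _ _ _ _
  exact Or.inl ⟨_, ⟨n, hn, rfl⟩, _, rfl⟩

end Completeness

/-! ### The word xy a₁²⋯a_k² xy and the identities Σ_k. -/

section SigmaK

open FreeMonoid

theorem toList_squareWord (c d : Letter) (l : List Letter) :
    toList (squareWord c d l) = [c, d] ++ l.flatMap (fun b => [b, b]) ++ [c, d] := by
  have : (l.map fun b => letter b ^ 2).prod = ofList (l.flatMap fun b => [b, b]) := by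
    induction l with
    | nil => rfl
    | cons b l ih =>
      rw [List.map_cons, List.prod_cons, ih, List.flatMap_cons, ofList_append, pow_two]
      rfl
  rw [squareWord, this]
  simp only [letter, FreeMonoid.toList_mul, FreeMonoid.toList_of, FreeMonoid.toList_ofList]
  simp

/-- The blocks of a chain in which no two consecutive variables occur form a product of squares. -/
theorem chainBlocks_eq_squares {α : Type*} [DecidableEq α] (f : ℕ → α) (K : Finset ℕ) (h0 : 0 ∉ K)
    (hK : ∀ i ∈ K, i + 1 ∉ K) (n : ℕ) :
    chainBlocks (fun i => if i ∈ K then [f i] else []) n =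
      (((List.range n).filter (· ∈ K)).map f).flatMap (fun b => [b, b]) ++
        (if n ∈ K then [f n] else []) := by
  induction n with
  | zero => simp [chainBlocks, h0]
  | succ n ih =>
    rw [chainBlocks_succ, ih, List.range_succ]
    by_cases h : n ∈ K
    · have := hK n h
      simp [h, this, List.filter_append]
    · simp [h, List.filter_append]

theorem deleteIdentity_wIdentity_eq_square {Y : Set Letter} {n : ℕ} {K : Finset ℕ}
    (hx : Letter.x ∉ Y) (hy : Letter.y ∉ Y) (hz : Letter.z ∈ Y) (hp : Letter.p ∈ Y)
    (h : ∀ i ≤ n, Letter.xs i ∈ Y ↔ i ∉ K) (h0 : 0 ∉ K) (hn : n ∉ K)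
    (hK : ∀ i ∈ K, i + 1 ∉ K) :
    deleteIdentity Y (wIdentity n) =
      (squareWord .x .y (((List.range n).filter (· ∈ K)).map Letter.xs),
        squareWord .y .x (((List.range n).filter (· ∈ K)).map Letter.xs)) := by
  classical
  have hc : chainBlocks (fun i => if Letter.xs i ∈ Y then [] else [Letter.xs i]) n =
      chainBlocks (fun i => if i ∈ K then [Letter.xs i] else []) n := by
    rw [chainBlocks, chainBlocks]
    apply List.flatMap_congr
    intro i hi
    rw [List.mem_range] at hi
    simp only [h i (by omega), h (i + 1) (by omega), ite_not]
  refine Prod.ext (toList.injective ?_) (toList.injective ?_) <;>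
  · simp only [deleteIdentity, wIdentity]
    rw [toList_deleteVars, flatMap_chainWord, toList_squareWord, hc,
      chainBlocks_eq_squares _ K h0 hK]
    simp [hx, hy, hz, hp, h 0 (by omega), h0, h n le_rfl, hn]

theorem deleteIdentity_deleteIdentity (X Y : Set Letter) (e : Identity) :
    deleteIdentity Y (deleteIdentity X e) = deleteIdentity (X ∪ Y) e := by
  classical
  refine Prod.ext (toList.injective ?_) (toList.injective ?_) <;>
  · simp only [deleteIdentity, toList_deleteVars_filter, List.filter_filter]
    apply List.filter_congr
    intro g _
    simp [Bool.and_comm, not_or]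

theorem toList_uWord (k : ℕ) : toList (uWord k) = [.x, .y] ++
    ((List.range k).map fun i => Letter.a (i + 1)).flatMap (fun b => [b, b]) ++ [.x, .y] :=
  toList_squareWord _ _ _

theorem nodup_map_a (k : ℕ) : ((List.range k).map fun i => Letter.a (i + 1)).Nodup :=
  List.nodup_range.map fun i j h => by simpa using h

theorem count_flatMap_pair {α : Type*} [DecidableEq α] (l : List α) (g : α) :
    (l.flatMap fun b => [b, b]).count g = 2 * l.count g := by
  induction l with
  | nil => rfl
  | cons b l ih =>
    simp only [List.flatMap_cons, List.count_append, ih, List.count_cons, List.count_nil]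
    split_ifs <;> omega

theorem twoLimited_uWord (k : ℕ) : TwoLimited (toList (uWord k)) := by
  intro g
  have h := List.nodup_iff_count_le_one.1 (nodup_map_a k) g
  rw [toList_uWord, List.count_append, List.count_append, count_flatMap_pair]
  by_cases hg : g ∈ (List.range k).map fun i => Letter.a (i + 1)
  · obtain ⟨i, -, rfl⟩ := List.mem_map.1 hg
    simpa using h
  · rw [List.count_eq_zero_of_not_mem hg]
    cases g <;> simp

/-- In a product of squares of distinct letters, nothing stands between equal letters. -/
theorem eq_nil_of_flatMap_pair {α : Type*} {l P Q A B C : List α} {g : α} (hl : l.Nodup)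
    (hP : g ∉ P) (hQ : g ∉ Q) (hg : g ∈ l)
    (h : P ++ l.flatMap (fun b => [b, b]) ++ Q = A ++ g :: B ++ g :: C) : B = [] := by
  classical
  obtain ⟨s, t, rfl⟩ := List.append_of_mem hg
  rw [List.nodup_append, List.nodup_cons] at hl
  have hs : g ∉ s := fun hs => hl.2.2 g hs g (by simp) rfl
  have hc := congrArg (List.count g) h
  simp only [List.flatMap_append, List.flatMap_cons, List.count_append, count_flatMap_pair,
    List.count_eq_zero_of_not_mem hs, List.count_eq_zero_of_not_mem hl.2.1.1,
    List.count_eq_zero_of_not_mem hP, List.count_eq_zero_of_not_mem hQ,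
    List.count_cons_self, List.count_nil] at hc
  have hA : g ∉ A := List.count_eq_zero.1 (by omega)
  have e : (P ++ s.flatMap (fun b => [b, b])) ++ g :: (g :: t.flatMap (fun b => [b, b]) ++ Q) =
      A ++ g :: (B ++ g :: C) := by
    simpa using h
  have := (List.eq_of_append_cons_eq e (by simpa [hP] using hs) hA).2
  cases B with
  | nil => rfl
  | cons b B =>
    simp only [List.cons_append, List.cons.injEq] at this
    rw [← this.1] at hc
    simp only [List.count_cons_self] at hc
    omega

/-- The factor `xy` is the only one that occurs twice in `xy a₁² ⋯ a_k² xy`. -/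
theorem uWord_factor {k : ℕ} {L M R : List Letter} {c d : Letter}
    (h : toList (uWord k) = L ++ c :: d :: M ++ c :: d :: R) :
    c = .x ∧ d = .y ∧ L = [] ∧ R = [] ∧
      M = ((List.range k).map fun i => Letter.a (i + 1)).flatMap (fun b => [b, b]) := by
  have h2 := (h ▸ twoLimited_uWord k : TwoLimited _).factor
  obtain ⟨hcd, hcL, hcM, hcR, hdL, hdM, hdR⟩ := h2
  rw [toList_uWord] at h
  set l := (List.range k).map fun i => Letter.a (i + 1) with hl
  have hxl : ∀ g ∈ l, g ≠ .x ∧ g ≠ .y := by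
    intro g hg
    obtain ⟨i, -, rfl⟩ := List.mem_map.1 hg
    simp
  have key : ∀ g ∈ l, ∀ A B C, [Letter.x, Letter.y] ++ l.flatMap (fun b => [b, b]) ++ [.x, .y] =
      A ++ g :: B ++ g :: C → B = [] := by
    intro g hg A B C e
    have := hxl g hg
    exact eq_nil_of_flatMap_pair (nodup_map_a k) (by simp [this]) (by simp [this]) hg e
  have hc : c ∉ l := fun hc => by
    have := key c hc L (d :: M) (d :: R) (by rw [h])
    simp at this
  have hd : d ∉ l := fun hd => by
    have := key d hd (L ++ [c]) (M ++ [c]) R (by rw [h]; simp)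
    simp at this
  have hmem : ∀ g, g ∈ L ++ c :: d :: M ++ c :: d :: R → g ∉ l → g = .x ∨ g = .y := by
    intro g hg hgl
    rw [← h] at hg
    simp only [List.mem_append, List.mem_flatMap, List.mem_cons, List.not_mem_nil, or_false,
      or_self] at hg
    rcases hg with (hg | ⟨b, hb, rfl⟩) | hg
    · exact hg
    · exact absurd hb hgl
    · exact hg
  have hc' := hmem c (by simp) hc
  have hd' := hmem d (by simp) hd
  have hL : L = [] := by
    cases L with
    | nil => rfl
    | cons g L =>
      simp only [List.cons_append, List.cons.injEq, List.nil_append] at h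
      have h1 := h.1
      simp only [List.mem_cons, not_or] at hcL hdL
      rcases hc' with rfl | rfl
      · exact absurd h1 hcL.1
      · rcases hd' with rfl | rfl
        · exact absurd h1 hdL.1
        · exact absurd rfl hcd
  subst hL
  simp only [List.cons_append, List.cons.injEq, List.nil_append] at h
  obtain ⟨rfl, rfl, h⟩ := h
  have := List.eq_of_append_cons_eq h (by simpa using fun h' => (hxl _ h').1 rfl) hcM
  refine ⟨rfl, rfl, rfl, ?_, this.1.symm⟩
  simpa using this.2.symm

theorem chainBlocks_prefix {α : Type*} [DecidableEq α] (X : ℕ → List α) {m n : ℕ} (h : m ≤ n) :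
    chainBlocks X m <+: chainBlocks X n := by
  induction n, h using Nat.le_induction with
  | base => exact List.prefix_refl _
  | succ n _ ih =>
    rw [chainBlocks_succ]
    exact ih.trans (List.prefix_append _ _)

/-- Between the two copies of the first letter of Xₘ₊₁ stand the rest of that block, Xₘ and Xₘ₊₂. In
a product of squares of distinct letters all of this is empty. -/
theorem chainBlocks_eq_flatMap_pair {α : Type*} [DecidableEq α] {X : ℕ → List α} {n m : ℕ} {l : List α}
    (hl : l.Nodup) (h : chainBlocks X n = l.flatMap fun b => [b, b]) (hm : m + 2 ≤ n)
    (hX : X (m + 1) ≠ []) : (X (m + 1)).length = 1 ∧ X m = [] ∧ X (m + 2) = [] := by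
  obtain ⟨r, hr⟩ := chainBlocks_prefix X hm
  rw [h, chainBlocks_succ, chainBlocks_succ] at hr
  obtain ⟨g, t, ht⟩ := List.exists_cons_of_ne_nil hX
  have hg : g ∈ l := by
    have : g ∈ l.flatMap fun b => [b, b] := by rw [← hr, ht]; simp
    simpa using this
  have := eq_nil_of_flatMap_pair (P := []) (Q := []) (A := chainBlocks X m)
    (B := t ++ X m ++ X (m + 2)) (C := t ++ r) hl (by simp) (by simp) hg (by
      rw [List.nil_append, List.append_nil, ← hr, ht]
      simp)
  simp only [List.append_eq_nil_iff] at this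
  rw [ht, this.1.1]
  exact ⟨rfl, this.1.2, this.2⟩

/-- The only nontrivial applications of `wₙ ≈ w'ₙ` to `xy a₁² ⋯ a_k² xy` come from
`xy b₁² ⋯ b_k² xy ≈ yx b₁² ⋯ b_k² yx`. -/
theorem exists_square_of_infix_uWord {k n : ℕ} {θ : Letter → List Letter} (hn : 2 ≤ n)
    (h : (toList (chainWord .x .y n)).flatMap θ <:+: toList (uWord k)) (hx : θ .x ≠ [])
    (hy : θ .y ≠ []) : ∃ l : List ℕ, l.length = k ∧ (∀ j ∈ l, 1 ≤ j ∧ j < n) ∧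
      deleteIdentity {g | θ g = []} (wIdentity n) =
        (squareWord .x .y (l.map Letter.xs), squareWord .y .x (l.map Letter.xs)) := by
  obtain ⟨l, r, h⟩ := h
  obtain ⟨x', c, hx'⟩ := List.eq_nil_or_concat (θ .x) |>.resolve_left hx
  obtain ⟨d, y', hy'⟩ := List.exists_cons_of_ne_nil hy
  rw [List.concat_eq_append] at hx'
  have hf := uWord_factor (k := k) (L := l ++ θ (.xs 0) ++ (θ .z ++ x'))
    (M := (y' ++ θ .p) ++ chainBlocks (fun i => θ (.xs i)) n ++ (θ .z ++ x'))
    (R := (y' ++ θ .p) ++ θ (.xs n) ++ r) (c := c) (d := d) (by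
      rw [← h, flatMap_chainWord, hx', hy']
      simp)
  -- Nothing stands outside the two factors xy, so x₀, xₙ, z and p have empty values and M is the
  -- chain of blocks alone.
  obtain ⟨-, -, hL, hR, hM⟩ := hf
  simp only [List.append_eq_nil_iff] at hL hR
  obtain ⟨⟨-, h0⟩, hz, hxn⟩ := hL
  obtain ⟨⟨⟨hyn, hp⟩, hn'⟩, -⟩ := hR
  rw [hyn, hp, hz, hxn] at hM
  simp only [List.nil_append, List.append_nil] at hM
  have key := fun m => chainBlocks_eq_flatMap_pair (m := m) (nodup_map_a k) hM
  have hpos : ∀ i ≤ n, θ (.xs i) ≠ [] → ∃ m, i = m + 1 ∧ m + 2 ≤ n := by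
    intro i hi hne
    have : i ≠ 0 := fun e => hne (e ▸ h0)
    have : i ≠ n := fun e => hne (e ▸ hn')
    exact ⟨i - 1, by omega, by omega⟩
  set K := (Finset.range (n + 1)).filter fun i => θ (.xs i) ≠ [] with hK
  have memK : ∀ i ≤ n, (i ∈ K ↔ θ (.xs i) ≠ []) := fun i hi => by
    rw [hK, Finset.mem_filter, Finset.mem_range]
    exact and_iff_right (by omega)
  have K0 : 0 ∉ K := by rw [memK 0 (by omega)]; simpa using h0
  have Kn : n ∉ K := by rw [memK n le_rfl]; simpa using hn'
  have leK : ∀ i ∈ K, i ≤ n := fun i hi => by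
    rw [hK, Finset.mem_filter, Finset.mem_range] at hi
    omega
  have Ksucc : ∀ i ∈ K, i + 1 ∉ K := by
    intro i hi hi'
    have h1 := leK i hi
    rw [memK i h1] at hi
    rw [memK _ (leK _ hi')] at hi'
    obtain ⟨m, rfl, hm⟩ := hpos i h1 hi
    exact hi' (key m hm hi).2.2
  refine ⟨(List.range n).filter (· ∈ K), ?_, ?_, ?_⟩
  -- Nonempty blocks are single letters, so the chain of images has the length of the chain of
  -- surviving variables; comparison with a₁²⋯a_k² gives exactly k squares.
  · have e := chainBlocks_eq_squares Letter.xs K K0 Ksucc n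
    rw [if_neg Kn, List.append_nil] at e
    have hlen : (chainBlocks (fun i => θ (.xs i)) n).length =
        (chainBlocks (fun i => if i ∈ K then [Letter.xs i] else []) n).length := by
      have hi : ∀ i ≤ n, (θ (.xs i)).length =
          (if i ∈ K then [Letter.xs i] else [] : List Letter).length := by
        intro i hi
        by_cases hiK : i ∈ K
        · rw [if_pos hiK]
          rw [memK i hi] at hiK
          obtain ⟨m, rfl, hm⟩ := hpos i hi hiK
          exact (key m hm hiK).1
        · rw [if_neg hiK]
          rw [memK i hi, not_not] at hiK
          rw [hiK]
      rw [chainBlocks, chainBlocks, List.length_flatMap, List.length_flatMap]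
      congr 1
      apply List.map_congr_left
      intro i hi'
      rw [List.mem_range] at hi'
      rw [List.length_append, List.length_append, hi i (by omega), hi (i + 1) (by omega)]
    have len : ∀ l : List Letter, (l.flatMap fun b => [b, b]).length = 2 * l.length := by
      intro l
      rw [List.length_flatMap]
      simp [mul_comm]
    rw [hM, e, len, len, List.length_map, List.length_map, List.length_range] at hlen
    omega
  · intro j hj
    rw [List.mem_filter, List.mem_range] at hj
    have : j ∈ K := by simpa using hj.2
    refine ⟨?_, hj.1⟩
    by_contra h'
    have : j = 0 := by omega
    exact K0 (this ▸ ‹j ∈ K›)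
  · exact deleteIdentity_wIdentity_eq_square hx hy hz hp
      (fun i hi => by rw [memK i hi, not_not]; rfl) K0 Kn Ksucc

theorem satisfies_mono {W W' : Set Word} (h : W ⊆ W') {e : Identity}
    (he : Satisfies (ReesMonoid W') e) : Satisfies (ReesMonoid W) e := by
  rw [satisfies_iff] at he ⊢
  intro θ
  refine (he θ).imp_right fun h' => ?_
  exact ⟨fun ⟨w, hw, hu⟩ => h'.1 ⟨w, h hw, hu⟩, fun ⟨w, hw, hu⟩ => h'.2 ⟨w, h hw, hu⟩⟩

theorem sigmaK_subset (k : ℕ) : SigmaK k ⊆ SigmaAll := by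
  rintro e ⟨n, hn, ⟨X, rfl⟩, -⟩
  exact ⟨_, ⟨n, hn, rfl⟩, X, rfl⟩

theorem satisfies_uWord {k : ℕ} {e : Identity} (he : e ∈ SigmaK k) :
    Satisfies (ReesMonoid {uWord k}) e := by
  classical
  obtain ⟨n, hn, ⟨X, rfl⟩, hno⟩ := he
  rw [satisfies_iff]
  intro θ
  simp only [deleteIdentity, wIdentity, flatMap_deleteVars]
  set θ' : Letter → List Letter := fun c => if c ∈ X then [] else θ c with hθ'
  -- Deleting X and then further variables is a single deletion, so membership in Σ_k also excludes
  -- the square identities reached after emptying more variables.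
  have key : ¬ ∃ l : List ℕ, l.length = k ∧ (∀ j ∈ l, 1 ≤ j ∧ j < n) ∧
      deleteIdentity {g | θ' g = []} (wIdentity n) =
        (squareWord .x .y (l.map Letter.xs), squareWord .y .x (l.map Letter.xs)) := by
    rintro ⟨l, hl, hj, h⟩
    refine hno ⟨l, hl, hj, {g | θ' g = []}, ?_⟩
    rw [deleteIdentity_deleteIdentity, Set.union_eq_self_of_subset_left, h]
    intro g hg
    simp [hθ', hg]
  by_cases heq : (toList (chainWord .x .y n)).flatMap θ' = (toList (chainWord .y .x n)).flatMap θ'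
  · exact Or.inl heq
  have hx : θ' .x ≠ [] := fun h => heq (flatMap_chainWord_eq_of_nil n (Or.inl h))
  have hy : θ' .y ≠ [] := fun h => heq (flatMap_chainWord_eq_of_nil n (Or.inr h))
  right
  constructor
  · rintro ⟨w, rfl, hw⟩
    exact key (exists_square_of_infix_uWord hn hw hx hy)
  · rintro ⟨w, rfl, hw⟩
    rw [← (flatMap_chainWord_swapXY θ' n).1] at hw
    have hset : {g | swapXY θ' g = []} = {g | θ' g = []} := by
      ext g
      simp only [swapXY, Set.mem_ofPred_eq, Function.update_apply]
      split_ifs with h1 h2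
      · subst h1; simp [hx, hy]
      · subst h2; simp [hx, hy]
      · rfl
    have := exists_square_of_infix_uWord hn hw (by simpa [swapXY] using hy)
      (by simpa [swapXY] using hx)
    rw [hset] at this
    exact key this

theorem satisfies_reesMonoid_union {V : Set Word} {k : ℕ} {e : Identity}
    (hV : ∀ e ∈ SigmaAll ∪ A3, Satisfies (ReesMonoid V) e) (he : e ∈ SigmaK k ∪ A3) :
    Satisfies (ReesMonoid (V ∪ {uWord k})) e := by
  apply satisfies_of_forall_singleton
  rintro w (hw | hw)
  · exact satisfies_mono (Set.singleton_subset_iff.2 hw)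
      (hV e (Set.union_subset_union_left _ (sigmaK_subset k) he))
  · rw [Set.mem_singleton_iff] at hw
    subst hw
    rcases he with he | he
    · exact satisfies_uWord he
    · exact satisfies_A3 (by simpa using twoLimited_uWord k) he

theorem List.Sublist.map_sublist_flatMap {α : Type*} {s w : List α} {θ : α → List α} {ι : α → α}
    (h : List.Sublist s w) (hι : ∀ g ∈ s, ι g ∈ θ g) :
    List.Sublist (s.map ι) (w.flatMap θ) := by
  induction h with
  | slnil => exact List.Sublist.refl _
  | cons a _ ih => exact (ih hι).trans (List.sublist_append_right _ _)
  | cons_cons a _ ih =>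
    rw [List.map_cons, List.flatMap_cons]
    exact (List.singleton_sublist.2 (hι a (by simp))).append
      (ih fun g hg => hι g (List.mem_cons_of_mem _ hg))

theorem exists_perm_map_eq {L L' : List Letter} (hL : L.Nodup) (hL' : L'.Nodup)
    (h : L.length = L'.length) : ∃ σ : Equiv.Perm Letter, L.map σ = L' := by
  have := Equiv.Perm.isMultiplyPretransitive Letter L.length
  let a : Fin L.length ↪ Letter := ⟨L.get, List.nodup_iff_injective_get.1 hL⟩
  let b : Fin L.length ↪ Letter := ⟨fun i => L'.get (i.cast h), fun i j e => by
    simpa using List.nodup_iff_injective_get.1 hL' e⟩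
  obtain ⟨σ, hσ⟩ := MulAction.exists_smul_eq (M := Equiv.Perm Letter) a b
  refine ⟨σ, List.ext_getElem (by simpa using h) fun i h1 h2 => ?_⟩
  rw [List.length_map] at h1
  have := DFunLike.congr_fun hσ ⟨i, h1⟩
  simpa [a, b] using this

theorem TwoLimited.length_filter_le {u : List Letter} (hu : TwoLimited u) (S : Finset Letter) :
    (u.filter (· ∈ S)).length ≤ 2 * S.card := by
  rw [← List.sum_toFinset_count_eq_length]
  refine (Finset.sum_le_card_nsmul _ _ 2 fun g _ => hu.filter _ g).trans ?_
  rw [smul_eq_mul, mul_comm]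
  refine Nat.mul_le_mul_left _ (Finset.card_le_card fun g hg => ?_)
  simpa using (List.mem_filter.1 (List.mem_toFinset.1 hg)).2

/-- `xy a₁² ⋯ a_k² xy` being an isoterm, no identity outside `Σ_k` is ever needed. -/
theorem deleteIdentity_mem_sigmaK {V : Set Word} {k n : ℕ} {θ : Letter → List Letter}
    {l r v : List Letter} {c d : Letter} (hn : 2 ≤ n) (hx : θ .x = [c]) (hy : θ .y = [d])
    (hu : TwoLimited (l ++ (toList (chainWord .x .y n)).flatMap θ ++ r))
    (h : Satisfies (ReesMonoid (V ∪ {uWord k}))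
      (ofList (l ++ (toList (chainWord .x .y n)).flatMap θ ++ r), ofList v))
    (hv : v.filter (· ∈ ({c, d} : Finset Letter)) = [d, c, d, c]) :
    deleteIdentity {g | θ g = []} (wIdentity n) ∈ SigmaK k := by
  classical
  refine ⟨n, hn, ⟨_, rfl⟩, ?_⟩
  rintro ⟨s, hs, -, Y, hY⟩
  set u := l ++ (toList (chainWord .x .y n)).flatMap θ ++ r with hudef
  -- Each surviving variable is represented by the first letter of its value; the default is never
  -- used for variables with nonempty value. The image of the square word is then a sublist of u.
  set ι : Letter → Letter := fun g => (θ g).headD .x with hι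
  have hsq : toList (squareWord .x .y (s.map Letter.xs)) =
      ((toList (chainWord .x .y n)).filter (· ∉ {g | θ g = []})).filter (· ∉ Y) := by
    have := congrArg (fun e : Identity => toList e.1) hY
    simp only [deleteIdentity, wIdentity, toList_deleteVars_filter] at this
    exact this.symm
  have hsub := List.Sublist.map_sublist_flatMap (ι := ι) (θ := θ)
    (s := toList (squareWord .x .y (s.map Letter.xs))) (w := toList (chainWord .x .y n)) (by
      rw [hsq]; exact List.filter_sublist.trans List.filter_sublist) (by
    intro g hg
    rw [hsq] at hg
    have hne : θ g ≠ [] := by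
      simpa using (List.mem_filter.1 (List.mem_filter.1 hg).1).2
    obtain ⟨a, t, ht⟩ := List.exists_cons_of_ne_nil hne
    simp [hι, ht])
  have hsub' : List.Sublist ((toList (squareWord .x .y (s.map Letter.xs))).map ι) u :=
    hsub.trans (List.infix_append l _ r).sublist
  set L := (s.map Letter.xs).map ι with hL
  have hmap : (toList (squareWord .x .y (s.map Letter.xs))).map ι = toList (squareWord c d L) := by
    rw [toList_squareWord, toList_squareWord, hL]
    simp [hι, hx, hy, List.flatMap_map, List.map_flatMap]
  rw [hmap] at hsub'
  set S := (c :: d :: L).toFinset with hS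
  have hlen : (toList (squareWord c d L)).length = 2 * (c :: d :: L).length := by
    rw [toList_squareWord, List.length_append, List.length_append, List.length_flatMap]
    simp
    ring
  have hself : (toList (squareWord c d L)).filter (· ∈ S) = toList (squareWord c d L) := by
    rw [List.filter_eq_self]
    intro g hg
    rw [toList_squareWord] at hg
    simp only [List.mem_append, List.mem_flatMap, List.mem_cons, List.not_mem_nil, or_false,
      or_self] at hg
    rw [decide_eq_true_eq, hS, List.mem_toFinset]
    rcases hg with (hg | ⟨b, hb, rfl⟩) | hg
    · rcases hg with rfl | rfl <;> simp
    · simp [hb]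
    · rcases hg with rfl | rfl <;> simp
  have hfs := hsub'.filter (· ∈ S)
  rw [hself] at hfs
  -- The sublist has length 2(k + 2), while u restricted to its letters has length at most 2|S| ≤
  -- 2(k + 2). Hence they are equal and the k + 2 letters are distinct.
  have hle := hu.length_filter_le S
  have hcard : S.card ≤ (c :: d :: L).length := List.toFinset_card_le _
  have hlen' := hfs.length_le
  have heq : toList (squareWord c d L) = u.filter (· ∈ S) :=
    hfs.eq_of_length_le (by omega)
  have hnodup : (c :: d :: L).Nodup := by
    have hc : S.card = (c :: d :: L).length := by omega
    exact Multiset.coe_nodup.1 (Multiset.toFinset_card_eq_card_iff_nodup.1 hc)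
  obtain ⟨σ, hσ⟩ := exists_perm_map_eq (L' := .x :: .y :: (List.range k).map fun i => .a (i + 1))
    hnodup (by simpa using nodup_map_a k) (by simp [hL, hs])
  simp only [List.map_cons, List.cons.injEq] at hσ
  have hσu : (toList (squareWord c d L)).map σ = toList (uWord k) := by
    rw [toList_uWord, toList_squareWord, ← hσ.2.2]
    simp [hσ.1, hσ.2.1, List.flatMap_map, List.map_flatMap]
  have hsat := (h.filter S).subst (FreeMonoid.map σ)
  rw [← heq] at hsat
  -- Up to renaming the restriction of u is xy a₁²⋯a_k² xy, an isoterm, so v has the same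
  -- restriction, with c first. But the restriction of v to c and d begins with d.
  have := eq_of_satisfies_of_mem hsat (Or.inr (toList.injective hσu))
  have : toList (squareWord c d L) = v.filter (· ∈ S) :=
    (List.map_injective_iff.2 σ.injective) this
  have hcd : ∀ w : List Letter, (w.filter (· ∈ S)).filter (· ∈ ({c, d} : Finset Letter)) =
      w.filter (· ∈ ({c, d} : Finset Letter)) := by
    intro w
    rw [List.filter_filter]
    apply List.filter_congr
    intro g _
    rw [← Bool.decide_and, decide_eq_decide]
    refine and_iff_left_of_imp fun hg => ?_
    simp only [Finset.mem_insert, Finset.mem_singleton] at hg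
    rcases hg with rfl | rfl <;> simp [hS]
  have hfin := hcd v
  rw [← this, hv, toList_squareWord] at hfin
  simp only [List.filter_append, List.filter_cons, List.cons_append] at hfin
  simp only [Finset.mem_insert, Finset.mem_singleton, true_or, decide_true, if_true,
    List.cons.injEq] at hfin
  rw [List.nodup_cons] at hnodup
  exact hnodup.1 (by rw [hfin.1]; simp)

/-- The choice of V does not matter: identities of S(V) follow from Σ ∪ A₃, which holds in
S(`isoWords`). -/
theorem satisfies_isoWords_of_isBasis {V : Set Word} {k : ℕ}
    (hV : IsBasis (ReesMonoid V) (SigmaAll ∪ A3)) {e : Identity}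
    (he : Satisfies (ReesMonoid (V ∪ {uWord k})) e) : Satisfies (ReesMonoid isoWords) e :=
  (hV.2 e (satisfies_mono Set.subset_union_left he)).satisfies fun _ h => satisfies_isoWords h

theorem isBasis_sigmaK {V : Set Word} (hV : IsBasis (ReesMonoid V) (SigmaAll ∪ A3)) (k : ℕ) :
    IsBasis (ReesMonoid (V ∪ {uWord k})) (SigmaK k ∪ A3) := by
  have hs := fun e he => satisfies_reesMonoid_union (e := e) (k := k) hV.1 he
  refine ⟨hs, fun e he => deducible_of_satisfies Set.subset_union_right hs
    (fun e he => satisfies_isoWords_of_isBasis hV he) ?_ he⟩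
  intro n θ l r v c d hn hx hy hu h hv
  exact Or.inl (deleteIdentity_mem_sigmaK hn hx hy hu h hv)

end SigmaK

/-! ### Finiteness of Σ_k up to renaming. -/

section Finiteness

open FreeMonoid

/-- Among 2k + 1 elements in increasing order, those in the even places second, fourth, and so on
have an element of J on either side, and any two of them are separated by one. -/
theorem exists_sparse_subset {J : Finset ℕ} {k : ℕ} (hJ : 2 * k + 1 ≤ J.card) :
    ∃ K ⊆ J, K.card = k ∧ (∀ i ∈ K, i + 1 ∉ K) ∧
      ∀ i ∈ K, (∃ j ∈ J, j < i) ∧ ∃ j ∈ J, i < j := by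
  set f := J.orderEmbOfFin rfl with hf
  have hmem : ∀ i, f i ∈ J := fun i => J.orderEmbOfFin_mem rfl i
  let g : Fin k → ℕ := fun i => f ⟨2 * i + 1, by omega⟩
  have hg : Function.Injective g := fun i j h => by
    have := f.injective h
    rw [Fin.mk.injEq] at this
    exact Fin.ext (by omega)
  refine ⟨Finset.univ.image g, ?_, ?_, ?_, ?_⟩
  · intro i hi
    obtain ⟨a, -, rfl⟩ := Finset.mem_image.1 hi
    exact hmem _
  · rw [Finset.card_image_of_injective _ hg, Finset.card_univ, Fintype.card_fin]
  · intro i hi hi'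
    obtain ⟨a, -, rfl⟩ := Finset.mem_image.1 hi
    obtain ⟨b, -, hb⟩ := Finset.mem_image.1 hi'
    have hlt : g a < g b := by omega
    have hab := f.lt_iff_lt.1 hlt
    rw [Fin.mk_lt_mk] at hab
    have h1 : g a < f ⟨2 * a + 2, by omega⟩ := f.lt_iff_lt.2 (Fin.mk_lt_mk.2 (by omega))
    have h2 : f ⟨2 * a + 2, by omega⟩ < g b := f.lt_iff_lt.2 (Fin.mk_lt_mk.2 (by omega))
    omega
  · intro i hi
    obtain ⟨a, -, rfl⟩ := Finset.mem_image.1 hi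
    exact ⟨⟨_, hmem ⟨2 * a, by omega⟩, f.lt_iff_lt.2 (Fin.mk_lt_mk.2 (by omega))⟩,
      ⟨_, hmem ⟨2 * a + 2, by omega⟩, f.lt_iff_lt.2 (Fin.mk_lt_mk.2 (by omega))⟩⟩

theorem mem_chainWord {n : ℕ} {c d g : Letter} (h : g ∈ toList (chainWord c d n)) :
    g = c ∨ g = d ∨ g = .z ∨ g = .p ∨ ∃ i ≤ n, g = .xs i := by
  rw [toList_chainWord, chainBlocks] at h
  simp only [List.mem_append, List.mem_cons, List.not_mem_nil, or_false, List.mem_flatMap,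
    List.mem_range] at h
  rcases h with (((h | h) | ⟨i, hi, h | h⟩) | h) | h
  · exact .inr <| .inr <| .inr <| .inr ⟨0, by omega, h⟩
  · tauto
  · exact .inr <| .inr <| .inr <| .inr ⟨i + 1, by omega, h⟩
  · exact .inr <| .inr <| .inr <| .inr ⟨i, by omega, h⟩
  · tauto
  · exact .inr <| .inr <| .inr <| .inr ⟨n, le_rfl, h⟩

/-- Nontrivial identities in `Σ_k` have at most `2k + 4` variables. -/
theorem encard_identityVars_le {k : ℕ} {e : Identity} (he : e ∈ SigmaK k) (hne : e.1 ≠ e.2) :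
    (identityVars e).encard ≤ ((2 * k + 4 : ℕ) : ℕ∞) := by
  classical
  obtain ⟨n, hn, ⟨X, rfl⟩, hno⟩ := he
  have htriv : ¬ (Letter.x ∈ X ∨ Letter.y ∈ X) := by
    intro h
    apply hne
    apply toList.injective
    simp only [deleteIdentity, wIdentity, toList_deleteVars]
    exact flatMap_chainWord_eq_of_nil n (by simpa using h)
  rw [not_or] at htriv
  set J := (Finset.range (n + 1)).filter fun i => Letter.xs i ∉ X with hJ
  -- Otherwise k pairwise nonconsecutive surviving indices can be retained. They lie strictly
  -- between 0 and n, so the corresponding variables become the squares of a forbidden identity.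
  have hcard : J.card ≤ 2 * k := by
    by_contra hlt
    obtain ⟨K, hKJ, hK, hKs, hKm⟩ := exists_sparse_subset (J := J) (k := k) (by omega)
    have leJ : ∀ i ∈ J, i ≤ n := fun i hi => by
      rw [hJ, Finset.mem_filter, Finset.mem_range] at hi
      omega
    have h0 : 0 ∉ K := fun h => by
      obtain ⟨⟨j, -, hj⟩, -⟩ := hKm 0 h
      omega
    have hn' : n ∉ K := fun h => by
      obtain ⟨-, j, hj, hj'⟩ := hKm n h
      have := leJ j hj
      omega
    have hKn : ∀ i ∈ K, i < n := fun i hi => by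
      have := leJ i (hKJ hi)
      have : i ≠ n := fun e => hn' (e ▸ hi)
      omega
    refine hno ⟨(List.range n).filter (· ∈ K), ?_, ?_,
      {g | g ≠ .x ∧ g ≠ .y ∧ ∀ i ∈ K, g ≠ .xs i}, ?_⟩
    · rw [← hK, ← List.toFinset_card_of_nodup (List.nodup_range.filter _)]
      congr 1
      ext i
      simpa using hKn i
    · intro j hj
      rw [List.mem_filter, List.mem_range, decide_eq_true_eq] at hj
      refine ⟨?_, hj.1⟩
      have : j ≠ 0 := fun e => h0 (e ▸ hj.2)
      omega
    · rw [deleteIdentity_deleteIdentity]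
      refine deleteIdentity_wIdentity_eq_square (by simp [htriv.1]) (by simp [htriv.2]) (by simp)
        (by simp) (fun i hi => ?_) h0 hn' hKs
      have : i ∈ K → Letter.xs i ∉ X := fun h => (Finset.mem_filter.1 (hKJ h)).2
      simp only [Set.mem_union, Set.mem_ofPred_eq, ne_eq, reduceCtorEq, not_false_eq_true,
        true_and, Letter.xs.injEq]
      constructor
      · rintro (h | h) hi
        · exact this hi h
        · exact h i hi rfl
      · intro h
        right
        rintro j hj rfl
        exact h hj
  have hsub : identityVars (deleteIdentity X (wIdentity n)) ⊆
      (({.x, .y, .z, .p} : Finset Letter) ∪ J.image Letter.xs : Finset Letter) := by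
    intro g hg
    have : g ∉ X ∧ (g = .x ∨ g = .y ∨ g = .z ∨ g = .p ∨ ∃ i ≤ n, g = .xs i) := by
      simp only [identityVars, deleteIdentity, wIdentity, toList_deleteVars_filter,
        Set.mem_ofPred_eq, List.mem_filter, decide_eq_true_eq] at hg
      rcases hg with hg | hg
      · exact ⟨hg.2, mem_chainWord hg.1⟩
      · have := mem_chainWord hg.1
        exact ⟨hg.2, by tauto⟩
    simp only [Finset.coe_union, Set.mem_union, Finset.mem_coe, Finset.mem_insert,
      Finset.mem_singleton, Finset.mem_image]
    rcases this with ⟨hX, h | h | h | h | ⟨i, hi, rfl⟩⟩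
    · tauto
    · tauto
    · tauto
    · tauto
    · exact Or.inr ⟨i, Finset.mem_filter.2 ⟨Finset.mem_range.2 (by omega), hX⟩, rfl⟩
  refine (Set.encard_le_encard hsub).trans ?_
  rw [Set.encard_coe_eq_coe_finsetCard, Nat.cast_le]
  refine (Finset.card_union_le _ _).trans ?_
  have h1 : ({.x, .y, .z, .p} : Finset Letter).card ≤ 4 := Finset.card_le_four
  have h2 : (J.image Letter.xs).card ≤ J.card := Finset.card_image_le
  omega

theorem twoLimited_chainWord {c d : Letter} (n : ℕ) (h : [Letter.z, c, d, .p].Nodup)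
    (hc : ∀ i, Letter.xs i ≠ c) (hd : ∀ i, Letter.xs i ≠ d) :
    TwoLimited (toList (chainWord c d n)) := by
  intro g
  have h1 := count_chainBlocks (fun i => [Letter.xs i]) n g
  have h2 := List.nodup_iff_count_le_one.1 h g
  rw [toList_chainWord]
  simp only [List.count_append]
  by_cases hg : ∃ i, g = .xs i
  · obtain ⟨i, rfl⟩ := hg
    have h3 : [Letter.z, c, d, .p].count (.xs i) = 0 :=
      List.count_eq_zero_of_not_mem (by simp [hc, hd])
    have h4 : ∑ j ∈ Finset.range (n + 1), [Letter.xs j].count (.xs i) ≤ 1 := by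
      simp only [List.count_singleton, beq_iff_eq, Letter.xs.injEq]
      rw [Finset.sum_ite_eq']
      split_ifs <;> omega
    omega
  · push Not at hg
    have h3 : ∀ j, [Letter.xs j].count g = 0 := fun j =>
      List.count_eq_zero_of_not_mem (by simpa using hg j)
    simp only [h3, Finset.sum_const_zero] at h1 ⊢
    omega

theorem twoLimited_of_mem_sigmaAll {e : Identity} (he : e ∈ SigmaAll) :
    TwoLimited (toList e.1) ∧ TwoLimited (toList e.2) := by
  classical
  obtain ⟨_, ⟨n, -, rfl⟩, X, rfl⟩ := he
  simp only [deleteIdentity, wIdentity, toList_deleteVars_filter]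
  exact ⟨(twoLimited_chainWord n (by simp) (by simp) (by simp)).filter _,
    (twoLimited_chainWord n (by simp) (by simp) (by simp)).filter _⟩

theorem renameIdentity_symm (σ : Equiv.Perm Letter) (e : Identity) :
    renameIdentity σ.symm (renameIdentity σ e) = e := by
  refine Prod.ext (toList.injective ?_) (toList.injective ?_) <;>
  · simp only [renameIdentity, FreeMonoid.toList_map, List.map_map]
    simp

theorem renameIdentity_trans (σ τ : Equiv.Perm Letter) (e : Identity) :
    renameIdentity τ (renameIdentity σ e) = renameIdentity (σ.trans τ) e := by
  refine Prod.ext (toList.injective ?_) (toList.injective ?_) <;>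
  · simp only [renameIdentity, FreeMonoid.toList_map, List.map_map]
    simp

theorem TwoLimited.map {u : List Letter} (hu : TwoLimited u) (σ : Equiv.Perm Letter) :
    TwoLimited (u.map σ) := by
  intro g
  rw [← σ.apply_symm_apply g, List.count_map_of_injective _ _ σ.injective]
  exact hu _

/-- Renamed into 2k + 4 fixed letters, the sides are two-limited words, of which there are finitely
many. Renaming may leave Σ_k, so for every renamed identity an original in Σ_k is chosen. -/
theorem exists_finite_representatives (k : ℕ) : ∃ F : Set Identity, F.Finite ∧ F ⊆ SigmaK k ∧
    ∀ e ∈ SigmaK k, e.1 ≠ e.2 → ∃ f ∈ F, ∃ π : Equiv.Perm Letter, e = renameIdentity π f := by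
  set B := (Finset.range (2 * k + 4)).image Letter.xs with hB
  set A := {w : Word | TwoLimited (toList w) ∧ ∀ g ∈ toList w, g ∈ B} with hA
  set T := {t : Identity | t ∈ A ×ˢ A ∧ ∃ f ∈ SigmaK k, ∃ σ : Equiv.Perm Letter,
    t = renameIdentity σ f} with hT
  have hTf : T.Finite := ((finite_twoLimited B).prod (finite_twoLimited B)).subset fun t ht => ht.1
  have hch : ∀ t : Identity, ∃ f, t ∈ T → f ∈ SigmaK k ∧ ∃ σ : Equiv.Perm Letter,
      t = renameIdentity σ f := by
    intro t
    by_cases ht : t ∈ T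
    · obtain ⟨f, hf, h⟩ := ht.2
      exact ⟨f, fun _ => ⟨hf, h⟩⟩
    · exact ⟨t, fun h => absurd h ht⟩
  choose r hr using hch
  refine ⟨r '' T, hTf.image r, ?_, ?_⟩
  · rintro _ ⟨t, ht, rfl⟩
    exact (hr t ht).1
  · intro e he hne
    have hcard : (toList e.1 ++ toList e.2).toFinset.card ≤ 2 * k + 4 := by
      have := encard_identityVars_le he hne
      have hs : identityVars e = ((toList e.1 ++ toList e.2).toFinset : Set Letter) := by
        ext g
        simp [identityVars]
      rw [hs, Set.encard_coe_eq_coe_finsetCard, Nat.cast_le] at this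
      exact this
    obtain ⟨σ, hσ⟩ := exists_perm_mapsTo_image _ hcard (f := Letter.xs) fun a b h => by simpa using h
    have h2 := twoLimited_of_mem_sigmaAll (sigmaK_subset k he)
    have ht : renameIdentity σ e ∈ T := by
      refine ⟨⟨⟨?_, ?_⟩, ⟨?_, ?_⟩⟩, e, he, σ, rfl⟩
      · exact h2.1.map σ
      · intro g hg
        obtain ⟨a, ha, rfl⟩ := List.mem_map.1 hg
        exact hσ a (by simp [ha])
      · exact h2.2.map σ
      · intro g hg
        obtain ⟨a, ha, rfl⟩ := List.mem_map.1 hg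
        exact hσ a (by simp [ha])
    obtain ⟨-, τ, hτ⟩ := hr _ ht
    refine ⟨_, ⟨_, ht, rfl⟩, τ.trans σ.symm, ?_⟩
    rw [← renameIdentity_trans, ← hτ, renameIdentity_symm]

theorem IsBasis.of_representatives {M : Type*} [Monoid M] {Δ F Γ : Set Identity}
    (h : IsBasis M (Δ ∪ Γ)) (hF : F ⊆ Δ)
    (hr : ∀ e ∈ Δ, e.1 ≠ e.2 → ∃ f ∈ F, ∃ π : Equiv.Perm Letter, e = renameIdentity π f) :
    IsBasis M (F ∪ Γ) := by
  refine ⟨fun e he => h.1 e (Set.union_subset_union_left _ hF he), fun e he => ?_⟩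
  refine Deducible.mono_of_deducible ?_ (h.2 e he)
  rintro ⟨u, v⟩ (he | he)
  · by_cases hne : u = v
    · rw [hne]
      exact Deducible.refl _ _
    · obtain ⟨f, hf, π, hπ⟩ := hr _ he hne
      rw [hπ]
      exact Deducible.of_mem (Or.inl hf) (FreeMonoid.map π)
  · exact Deducible.of_mem (Δ := F ∪ Γ) (Or.inr he) (MonoidHom.id _)

end Finiteness

/-! ### From monoid bases to semigroup bases. -/

section Semigroup

open FreeMonoid

theorem toList_toWord (a : FreeSemigroup Letter) : toList (toWord a) = a.head :: a.tail := by
  induction a using FreeSemigroup.recOnMul with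
  | ih1 c => rfl
  | ih2 c a _ ih =>
    rw [map_mul, FreeMonoid.toList_mul, ih]
    rfl

theorem toWord_injective : Function.Injective toWord := by
  intro a b h
  have := congrArg toList h
  rw [toList_toWord, toList_toWord, List.cons.injEq] at this
  exact FreeSemigroup.ext this.1 this.2

theorem exists_toWord_eq {w : Word} (h : w ≠ 1) : ∃ a, toWord a = w := by
  obtain ⟨c, t, ht⟩ := List.exists_cons_of_ne_nil (l := toList w) fun e => h (toList.injective e)
  refine ⟨⟨c, t⟩, toList.injective ?_⟩
  rw [toList_toWord, ht]

theorem semigroupSatisfies_iff {M : Type*} [Monoid M] {e : SemigroupIdentity} :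
    SemigroupSatisfies M e ↔ Satisfies M (toWord e.1, toWord e.2) := by
  constructor
  · intro h f
    exact h (f.toMulHom.comp toWord)
  · intro h f
    have : f = (FreeMonoid.lift (f ∘ FreeSemigroup.of)).toMulHom.comp toWord :=
      FreeSemigroup.hom_ext (by funext c; rfl)
    rw [this]
    exact h (FreeMonoid.lift (f ∘ FreeSemigroup.of))

/-- A monoid substitution is the deletion of the variables with empty value followed by a
substitution of nonempty words; deleted variables may get any nonempty value. -/
theorem exists_semigroup_substitution (Θ : Word →* Word) :
    ∃ Θ' : FreeSemigroup Letter →ₙ* FreeSemigroup Letter, ∀ (w : Word) (a : FreeSemigroup Letter),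
      toWord a = deleteVars {g | Θ (letter g) = 1} w → Θ w = toWord (Θ' a) := by
  classical
  have hex : ∀ g, ∃ a, Θ (letter g) ≠ 1 → toWord a = Θ (letter g) := by
    intro g
    by_cases h : Θ (letter g) = 1
    · exact ⟨FreeSemigroup.of g, fun h' => absurd h h'⟩
    · obtain ⟨a, ha⟩ := exists_toWord_eq h
      exact ⟨a, fun _ => ha⟩
  choose s hs using hex
  refine ⟨FreeSemigroup.lift s, fun w a ha => ?_⟩
  set Θ'' : Word →* Word := FreeMonoid.lift fun g => toWord (s g) with hΘ
  have h1 : toWord.comp (FreeSemigroup.lift s) = Θ''.toMulHom.comp toWord :=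
    FreeSemigroup.hom_ext (by
      funext c
      simp [hΘ, toWord, letter])
  have h2 : Θ''.comp (deleteVars {g | Θ (letter g) = 1}) = Θ := by
    refine FreeMonoid.hom_eq fun g => ?_
    by_cases hg : Θ (letter g) = 1
    · simp [deleteVars, hg]
    · simp [deleteVars, hΘ, hg, hs]
  have h3 := DFunLike.congr_fun h1 a
  simp only [MulHom.comp_apply] at h3
  rw [h3, ha, ← DFunLike.congr_fun h2 w]
  rfl

/-- A basis of monoid identities that is closed under deleting variables yields a basis of
semigroup identities. -/
theorem IsBasis.isSemigroupBasis {M : Type*} [Monoid M] {Δ : Set Identity} (h : IsBasis M Δ)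
    (hdel : ∀ e ∈ Δ, ∀ X, deleteIdentity X e ∈ Δ) (hone : ∀ e ∈ Δ, e.1 = 1 ↔ e.2 = 1) :
    IsSemigroupBasis M (semigroupPart Δ) := by
  refine ⟨fun e he => semigroupSatisfies_iff.2 (h.1 _ he), fun e he => ?_⟩
  have hd := h.2 _ (semigroupSatisfies_iff.1 he)
  set S := conGen (fun b c : FreeSemigroup Letter => ∃ d ∈ semigroupPart Δ,
    ∃ Θ : FreeSemigroup Letter →ₙ* FreeSemigroup Letter, b = Θ d.1 ∧ c = Θ d.2) with hS
  -- Semigroup deducibility, extended to all words by equality alone, is a congruence on the free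
  -- monoid. It contains all instances of Δ, hence all monoid consequences.
  let C : Con Word :=
    { r := fun u v => u = v ∨ ∃ a b, toWord a = u ∧ toWord b = v ∧ S a b
      iseqv :=
        { refl := fun _ => Or.inl rfl
          symm := by
            rintro u v (h | ⟨a, b, ha, hb, h⟩)
            · exact Or.inl h.symm
            · exact Or.inr ⟨b, a, hb, ha, S.symm h⟩
          trans := by
            rintro u v w (rfl | ⟨a, b, ha, hb, h⟩) (rfl | ⟨a', b', ha', hb', h'⟩)
            · exact Or.inl rfl
            · exact Or.inr ⟨a', b', ha', hb', h'⟩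
            · exact Or.inr ⟨a, b, ha, hb, h⟩
            · have := toWord_injective (hb.trans ha'.symm)
              subst this
              exact Or.inr ⟨a, b', ha, hb', S.trans h h'⟩ }
      mul' := by
        rintro u v u' v' (rfl | ⟨a, b, rfl, rfl, h⟩) (rfl | ⟨a', b', rfl, rfl, h'⟩)
        · exact Or.inl rfl
        · by_cases hu : u = 1
          · subst hu
            exact Or.inr ⟨a', b', by simp, by simp, h'⟩
          · obtain ⟨c, rfl⟩ := exists_toWord_eq hu
            exact Or.inr ⟨c * a', c * b', by simp, by simp, S.mul (S.refl c) h'⟩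
        · by_cases hu : u' = 1
          · subst hu
            exact Or.inr ⟨a, b, by simp, by simp, h⟩
          · obtain ⟨c, rfl⟩ := exists_toWord_eq hu
            exact Or.inr ⟨a * c, b * c, by simp, by simp, S.mul h (S.refl c)⟩
        · exact Or.inr ⟨a * a', b * b', by simp, by simp, S.mul h h'⟩ }
  have hC : C (toWord e.1) (toWord e.2) := by
    refine Deducible.le (c := C) ?_ hd
    intro d hdΔ Θ
    obtain ⟨Θ', hΘ'⟩ := exists_semigroup_substitution Θ
    have hmem := hdel d hdΔ {g | Θ (letter g) = 1}
    have hone' := hone _ hmem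
    have hfix : ∀ w : Word, Θ (deleteVars {g | Θ (letter g) = 1} w) = Θ w := by
      intro w
      refine DFunLike.congr_fun (f := Θ.comp (deleteVars _)) (FreeMonoid.hom_eq fun g => ?_) w
      by_cases hg : Θ (letter g) = 1
      · simp [deleteVars, hg]
      · simp [deleteVars, hg]
    -- The deleted identity either has both sides empty, so that the instance is trivial, or both
    -- nonempty, so that it lies in the semigroup part of Δ.
    by_cases h1 : (deleteIdentity {g | Θ (letter g) = 1} d).1 = 1
    · have h2 := hone'.1 h1
      left
      rw [← hfix d.1, ← hfix d.2]
      exact (congrArg Θ h1).trans (congrArg Θ h2).symm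
    · have h2 := fun h => h1 (hone'.2 h)
      obtain ⟨a, ha⟩ := exists_toWord_eq h1
      obtain ⟨b, hb⟩ := exists_toWord_eq h2
      refine Or.inr ⟨Θ' a, Θ' b, (hΘ' _ a ha).symm, (hΘ' _ b hb).symm, ?_⟩
      refine ConGen.Rel.of _ _ ⟨(a, b), ?_, Θ', rfl, rfl⟩
      change (toWord a, toWord b) ∈ Δ
      rw [ha, hb]
      exact hmem
  rcases hC with hC | ⟨a, b, ha, hb, hab⟩
  · have := toWord_injective hC
    change S e.1 e.2
    rw [this]
    exact S.refl _
  · change S e.1 e.2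
    rw [← toWord_injective ha, ← toWord_injective hb]
    exact hab

theorem Satisfies.deleteIdentity {M : Type*} [Monoid M] {e : Identity} (h : Satisfies M e)
    (X : Set Letter) : Satisfies M (deleteIdentity X e) := Satisfies.subst h (deleteVars X)

theorem deleteIdentity_empty (e : Identity) : deleteIdentity ∅ e = e := by
  classical
  refine Prod.ext (toList.injective ?_) (toList.injective ?_) <;>
    simp [deleteIdentity, toList_deleteVars_filter]

theorem subset_deletionClosure (Δ : Set Identity) : Δ ⊆ deletionClosure Δ := fun e he =>
  ⟨e, he, ∅, (deleteIdentity_empty e).symm⟩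

theorem deleteIdentity_mem_deletionClosure {Δ : Set Identity} {e : Identity}
    (he : e ∈ deletionClosure Δ) (X : Set Letter) : deleteIdentity X e ∈ deletionClosure Δ := by
  obtain ⟨d, hd, Y, rfl⟩ := he
  exact ⟨d, hd, _, deleteIdentity_deleteIdentity Y X d⟩

theorem finite_deletionClosure {Δ : Set Identity} (h : Δ.Finite) : (deletionClosure Δ).Finite := by
  classical
  have hs : ∀ w : Word, {v : Word | List.Sublist (toList v) (toList w)}.Finite := fun w => by
    refine Set.Finite.subset (s := toList ⁻¹' {l | l ∈ (toList w).sublists})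
      ((List.finite_toSet _).preimage toList.injective.injOn) fun v hv => ?_
    exact List.mem_sublists.2 hv
  refine (h.biUnion fun d _ => (hs d.1).prod (hs d.2)).subset ?_
  rintro _ ⟨d, hd, X, rfl⟩
  refine Set.mem_biUnion hd ⟨?_, ?_⟩ <;>
  · simp only [deleteIdentity, Set.mem_ofPred_eq, toList_deleteVars_filter]
    exact List.filter_sublist

theorem finite_semigroupPart {Δ : Set Identity} (h : Δ.Finite) : (semigroupPart Δ).Finite :=
  h.preimage (f := fun e : SemigroupIdentity => (toWord e.1, toWord e.2))
    (Function.Injective.injOn fun a b hab => by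
      rw [Prod.mk.injEq] at hab
      exact Prod.ext (toWord_injective hab.1) (toWord_injective hab.2))

theorem deleteIdentity_mem_sigmaK_of_mem {k : ℕ} {e : Identity} (he : e ∈ SigmaK k)
    (X : Set Letter) : deleteIdentity X e ∈ SigmaK k := by
  obtain ⟨n, hn, ⟨Y, rfl⟩, hno⟩ := he
  refine ⟨n, hn, ⟨_, deleteIdentity_deleteIdentity Y X _⟩, ?_⟩
  rintro ⟨l, hl, hj, Z, hZ⟩
  rw [deleteIdentity_deleteIdentity X] at hZ
  exact hno ⟨l, hl, hj, _, hZ⟩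

/-- The empty word is a subword of every word, hence an isoterm for S(W). -/
theorem Satisfies.eq_one_iff {W : Set Word} (hW : W.Nonempty) {e : Identity}
    (h : Satisfies (ReesMonoid W) e) : e.1 = 1 ↔ e.2 = 1 := by
  obtain ⟨w, hw⟩ := hW
  have hnil : ([] : List Letter) ∈ listClosure W := ⟨w, hw, List.nil_infix⟩
  have := satisfies_iff.1 h fun g => [g]
  simp only [List.flatMap_singleton'] at this
  constructor
  · intro h1
    rw [h1] at this
    exact toList.injective (this.resolve_right fun h' => h'.1 hnil).symm
  · intro h1
    rw [h1] at this
    exact toList.injective (this.resolve_right fun h' => h'.2 hnil)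

theorem IsBasis.of_subset {M : Type*} [Monoid M] {Δ Δ' : Set Identity} (h : IsBasis M Δ)
    (hsub : Δ ⊆ Δ') (hsat : ∀ e ∈ Δ', Satisfies M e) : IsBasis M Δ' :=
  ⟨hsat, fun e he => (h.2 e he).mono hsub⟩

theorem IsBasis.satisfies_deletionClosure {M : Type*} [Monoid M] {Δ : Set Identity}
    (h : ∀ e ∈ Δ, Satisfies M e) : ∀ e ∈ deletionClosure Δ, Satisfies M e := by
  rintro _ ⟨d, hd, X, rfl⟩
  exact (h d hd).deleteIdentity X

end Semigroup

/-! ### The main theorem. -/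

theorem mainTheorem6 :
    (∃ V : Set Word, V.Finite ∧ IsBasis (ReesMonoid V) (SigmaAll ∪ A3)) ∧
    ∀ V : Set Word, V.Finite → IsBasis (ReesMonoid V) (SigmaAll ∪ A3) →
      ∀ k : ℕ, 1 ≤ k →
        IsBasis (ReesMonoid (V ∪ {uWord k})) (SigmaK k ∪ A3) ∧
        IsSemigroupBasis (ReesMonoid (V ∪ {uWord k}))
          (semigroupPart (SigmaK k ∪ deletionClosure A3)) ∧
        (∀ e ∈ SigmaK k, e.1 ≠ e.2 → (identityVars e).encard ≤ ((2 * k + 4 : ℕ) : ℕ∞)) ∧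
        (∃ F : Set Identity, F.Finite ∧ F ⊆ SigmaK k ∧
          (∀ e ∈ SigmaK k, e.1 ≠ e.2 →
            ∃ f ∈ F, ∃ π : Equiv.Perm Letter, e = renameIdentity π f) ∧
          IsBasis (ReesMonoid (V ∪ {uWord k})) (F ∪ A3)) ∧
        IsFinitelyBased (ReesMonoid (V ∪ {uWord k})) := by
  refine ⟨⟨isoWords, finite_isoWords, isBasis_isoWords⟩, fun V _ hV k _ => ?_⟩
  have hne : (V ∪ {uWord k}).Nonempty := ⟨uWord k, Or.inr rfl⟩
  have hbasis := isBasis_sigmaK hV k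
  obtain ⟨F, hFfin, hF, hFr⟩ := exists_finite_representatives k
  have hbasisF := hbasis.of_representatives hF hFr
  refine ⟨hbasis, ?_, fun e he hne => encard_identityVars_le he hne,
    ⟨F, hFfin, hF, hFr, hbasisF⟩, ?_⟩
  · have hb := hbasis.of_subset (Δ' := SigmaK k ∪ deletionClosure A3)
      (Set.union_subset_union_right _ (subset_deletionClosure _)) (by
        rintro e (he | he)
        · exact hbasis.1 e (Or.inl he)
        · exact IsBasis.satisfies_deletionClosure (fun e he => hbasis.1 e (Or.inr he)) e he)
    refine hb.isSemigroupBasis ?_ fun e he => (hb.1 e he).eq_one_iff hne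
    rintro e (he | he) X
    · exact Or.inl (deleteIdentity_mem_sigmaK_of_mem he X)
    · exact Or.inr (deleteIdentity_mem_deletionClosure he X)
  · have hA3 : A3.Finite := by
      rw [A3]
      exact Set.toFinite _
    -- Closing the finite basis under deletion keeps it finite and makes the passage to semigroup
    -- identities possible.
    have hb := hbasisF.of_subset (subset_deletionClosure _)
      (IsBasis.satisfies_deletionClosure hbasisF.1)
    exact ⟨_, finite_semigroupPart (finite_deletionClosure (hFfin.union hA3)),
      hb.isSemigroupBasis (fun e he X => deleteIdentity_mem_deletionClosure he X)
        fun e he => (hb.1 e he).eq_one_iff hne⟩
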